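/- **Setting.** Let $d\ge 1$ and let $U\subset\mathbb R^d$ be a bounded simply connected domain. Let $g:U\times U\to\mathbb R$ be continuous, integrable on $U\times U$ and bounded from above, and put $$C_X(x,y)=\log\frac1{|x-y|}+g(x,y)\quad (x,y\in U),\qquad C_X(x,y)=0\quad\text{if }(x,y)\notin U\times U .$$ Assume that $C_X$ is symmetric and positive semi-definite, i.e. $\int\!\!\int C_X(x,y)f(x)f(y)\,dx\,dy\ge 0$ for all real $f\in C_c^\infty(\mathbb R^d)$. Let $X$ be the corresponding log-correlated field, that is, a random real tempered distribution on $\mathbb R^d$ whose pairings with Schwartz functions are jointly Gaussian and centred with $\mathbb E[X(f)X(h)]=\int\!\!\int C_X(x,y)f(x)h(y)\,dx\,dy$. A *bump function* is a non-negative, radially symmetric $\eta\in C_c^\infty(\mathbb R^d)$ with $\int\eta=1$ and $\operatorname{supp}\eta\subset B(0,1)$. Put $\eta_\varepsilon(y)=\varepsilon^{-d}\eta(y/\varepsilon)$. For positive numbers $c_n\to0$, the *convolution approximations* of $X$ given by $\eta$ and $(c_n)$ are $X_n=X*\eta_{c_n}$ on $U$; write $C_n(x,x)=\mathbb E[X_n(x)^2]$.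 Let $0<\beta<\sqrt d$. The random generalized function "$\cos(\beta X)$" on $U$ is defined by its pairings with (complex valued) test functions $\varphi\in C_c^\infty(U)$: $\langle\cos(\beta X),\varphi\rangle$ is the limit in probability, which exists and does not depend on the choice of $\eta$ and $(c_n)$, of $$\int_U\varphi(x)\,e^{\frac12\beta^2C_n(x,x)}\cos(\beta X_n(x))\,dx .$$ **Theorem.** Let $(X_n)$ be the convolution approximations of $X$ given by a bump function $\eta$ and positive numbers $c_n\to0$, and let $H:\mathbb R\to\mathbb R$ be a locally integrable, even, $2\pi/\beta$-periodic function with mean zero over a period. (i) If the Fourier series of $H$ converges absolutely, then there is a constant $a\in\mathbb R$ such that for every $\varphi\in C_c^\infty(U)$ $$\int_U\varphi(x)\,e^{\frac12\beta^2C_n(x,x)}H(X_n(x))\,dx\ \longrightarrow\ a\,\langle\cos(\beta X),\varphi\rangle\qquad\text{in probability as }n\to\infty .$$ (ii) If $d=2$, $g\in C^2(U\times U)$, $g(x,x)=g(y,y)$ for all $x,y\in U$, and $\eta$ is moreover radially decreasing (that is, $\eta(y)\le\eta(x)$ whenever $|x|\le|y|$), then the same conclusion holds without any assumption on the Fourier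 series of $H$. In both cases, for each $\varphi$ and all sufficiently large $n$, the integrand on the left is almost surely integrable over $U$ and the integral is a well-defined random variable. -/

import Mathlib

open MeasureTheory ProbabilityTheory Filter Topology TopologicalSpace
open scoped SchwartzMap Distributions

noncomputable section

namespace LogField

/-- The space `ℝ^d` with its Euclidean norm. -/
abbrev Space (d : ℕ) := EuclideanSpace ℝ (Fin d)

/-- The covariance kernel `C(x,y) = log (1/|x-y|) + g(x,y)` on `U × U`, extended by zero to
`ℝ^d × ℝ^d`. (The value on the diagonal, a null set, is irrelevant.) -/
def covKernel {d : ℕ} (U : Opens (Space d)) (g : Space d → Space d → ℝ) (x y : Space d) : ℝ :=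
  open scoped Classical in
  if x ∈ U ∧ y ∈ U then Real.log ‖x - y‖⁻¹ + g x y else 0

/-- The standing assumptions on the domain `U` and on the covariance kernel given by `g`. -/
structure IsLogKernel {d : ℕ} (U : Opens (Space d)) (g : Space d → Space d → ℝ) : Prop where
  simplyConnected : SimplyConnectedSpace U
  bounded : Bornology.IsBounded (U : Set (Space d))
  continuousOn : ContinuousOn (Function.uncurry g) ((U : Set (Space d)) ×ˢ (U : Set (Space d)))
  integrableOn : IntegrableOn (Function.uncurry g) ((U : Set (Space d)) ×ˢ (U : Set (Space d)))
  bddAbove : ∃ M : ℝ, ∀ x ∈ U, ∀ y ∈ U, g x y ≤ M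
  symm : ∀ x y, covKernel U g x y = covKernel U g y x
  /-- For a real symmetric kernel, positivity on real test functions is the same as positivity
  on complex ones. -/
  posSemidef : ∀ f : 𝓓((⊤ : Opens (Space d)), ℝ),
    0 ≤ ∫ x, ∫ y, covKernel U g x y * f x * f y

/-- `X` is a log-correlated Gaussian field on `U`: a random real tempered distribution, jointly
Gaussian and centred when tested against Schwartz functions, with covariance kernel
`covKernel U g`, where `U` and `g` satisfy the standing assumptions. -/
structure IsLogCorrelatedField {d : ℕ} {Ω : Type*} [MeasurableSpace Ω] (P : Measure Ω)
    (U : Opens (Space d)) (g : Space d → Space d → ℝ)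
    (X : Ω → (𝓢(Space d, ℝ) →L[ℝ] ℝ)) : Prop where
  kernel : IsLogKernel U g
  gaussian : IsGaussianProcess (fun (f : 𝓢(Space d, ℝ)) ω => X ω f) P
  centred : ∀ f : 𝓢(Space d, ℝ), ∫ ω, X ω f ∂P = 0
  covariance : ∀ f h : 𝓢(Space d, ℝ),
    ∫ ω, X ω f * X ω h ∂P = ∫ x, ∫ y, covKernel U g x y * f x * h y

/-- A bump function: smooth, non-negative, radially symmetric, of unit mass, with support in the
unit ball. -/
structure Bump (d : ℕ) where
  toFun : Space d → ℝ
  contDiff : ContDiff ℝ (⊤ : ℕ∞) toFun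
  nonneg : ∀ x, 0 ≤ toFun x
  radial : ∀ x y, ‖x‖ = ‖y‖ → toFun x = toFun y
  integral_eq_one : ∫ x, toFun x = 1
  support_subset : tsupport toFun ⊆ Metric.ball 0 1

/-- The bump function decreases (weakly) with the distance from the origin. -/
def Bump.RadiallyDecreasing {d : ℕ} (η : Bump d) : Prop :=
  ∀ x y, ‖x‖ ≤ ‖y‖ → η.toFun y ≤ η.toFun x

/-- The function `y ↦ η_ε (x - y) = ε^{-d} η ((x - y) / ε)`. -/
def Bump.scaledFun {d : ℕ} (η : Bump d) (ε : ℝ) (x : Space d) : Space d → ℝ :=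
  fun y => (ε ^ d)⁻¹ * η.toFun (ε⁻¹ • (x - y))

theorem Bump.hasCompactSupport_scaledFun {d : ℕ} (η : Bump d) {ε : ℝ} (hε : 0 < ε)
    (x : Space d) : HasCompactSupport (η.scaledFun ε x) := by
  refine HasCompactSupport.intro (isCompact_closedBall x ε) ?_
  intro y hy
  have h : η.toFun (ε⁻¹ • (x - y)) = 0 := by
    refine image_eq_zero_of_notMem_tsupport fun hmem => hy ?_
    have h1 := η.support_subset hmem
    rw [mem_ball_zero_iff, norm_smul, norm_inv, Real.norm_of_nonneg hε.le, inv_mul_lt_iff₀ hε,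
      mul_one] at h1
    rw [Metric.mem_closedBall, dist_comm, dist_eq_norm]
    exact h1.le
  simp [Bump.scaledFun, h]

theorem Bump.contDiff_scaledFun {d : ℕ} (η : Bump d) (ε : ℝ) (x : Space d) :
    ContDiff ℝ (⊤ : ℕ∞) (η.scaledFun ε x) :=
  contDiff_const.mul
    (η.contDiff.comp ((contDiff_const.sub contDiff_id : ContDiff ℝ _ fun y => x - y).const_smul ε⁻¹))

/-- `y ↦ η_ε (x - y)` as a Schwartz function, for `ε > 0`; only positive `ε` are ever used. -/
def Bump.scaled {d : ℕ} (η : Bump d) (ε : ℝ) (x : Space d) : 𝓢(Space d, ℝ) :=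
  if hε : 0 < ε then
    (η.hasCompactSupport_scaledFun hε x).toSchwartzMap (η.contDiff_scaledFun ε x)
  else 0

section

variable {d : ℕ} {Ω : Type*} [MeasurableSpace Ω]

/-- The convolution approximation `X_ε(x) = (X * η_ε)(x)`. -/
def mollify (X : Ω → (𝓢(Space d, ℝ) →L[ℝ] ℝ)) (η : Bump d) (ε : ℝ) (x : Space d) (ω : Ω) : ℝ :=
  X ω (η.scaled ε x)

/-- The integrand `φ(x) e^{β² E[X_ε(x)²] / 2} H(X_ε(x))`. -/
def renormIntegrand (P : Measure Ω) (X : Ω → (𝓢(Space d, ℝ) →L[ℝ] ℝ)) (η : Bump d) (β ε : ℝ)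
    (H : ℝ → ℝ) (φ : Space d → ℂ) (ω : Ω) (x : Space d) : ℂ :=
  φ x * ((Real.exp (β ^ 2 / 2 * ∫ ω', (mollify X η ε x ω') ^ 2 ∂P) *
    H (mollify X η ε x ω) : ℝ) : ℂ)

/-- The random variable `∫_U φ(x) e^{β² E[X_ε(x)²] / 2} H(X_ε(x)) dx`. -/
def renormIntegral (P : Measure Ω) (U : Opens (Space d)) (X : Ω → (𝓢(Space d, ℝ) →L[ℝ] ℝ))
    (η : Bump d) (β ε : ℝ) (H : ℝ → ℝ) (φ : Space d → ℂ) (ω : Ω) : ℂ :=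
  ∫ x in (U : Set (Space d)), renormIntegrand P X η β ε H φ ω x

/-- `cosX` is the random generalized function `cos (β X)`: for each test function `φ` the random
variable `cosX φ` is the limit in probability of `∫_U φ(x) e^{β² E[X_n(x)²] / 2} cos (β X_n(x)) dx`
along every sequence `X_n = X * η_{c_n}`, `c_n → 0`, of convolution approximations of `X`. -/
def IsCosine (P : Measure Ω) (U : Opens (Space d)) (X : Ω → (𝓢(Space d, ℝ) →L[ℝ] ℝ)) (β : ℝ)
    (cosX : 𝓓(U, ℂ) → Ω → ℂ) : Prop :=
  ∀ φ : 𝓓(U, ℂ), AEMeasurable (cosX φ) P ∧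
    ∀ (η : Bump d) (c : ℕ → ℝ), (∀ n, 0 < c n) → Tendsto c atTop (𝓝 0) →
      TendstoInMeasure P
        (fun n => renormIntegral P U X η β (c n) (fun t => Real.cos (β * t)) φ) atTop (cosX φ)

/-- For some constant `a` and every test function `φ`, the variables
`∫_U φ(x) e^{β² E[X_n(x)²] / 2} H(X_n(x)) dx` are well defined (for all large `n`, the integrand is
almost surely integrable and the integral is a random variable) and converge in probability to
`⟨a cos (β X), φ⟩`. -/
def ConvergesToMultiple (P : Measure Ω) (U : Opens (Space d))
    (X : Ω → (𝓢(Space d, ℝ) →L[ℝ] ℝ)) (η : Bump d) (c : ℕ → ℝ) (β : ℝ) (H : ℝ → ℝ)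
    (cosX : 𝓓(U, ℂ) → Ω → ℂ) : Prop :=
  ∃ a : ℝ, ∀ φ : 𝓓(U, ℂ),
    (∀ᶠ n in atTop,
      (∀ᵐ ω ∂P, IntegrableOn (renormIntegrand P X η β (c n) H φ ω) (U : Set (Space d))) ∧
      AEMeasurable (renormIntegral P U X η β (c n) H φ) P) ∧
    TendstoInMeasure P (fun n => renormIntegral P U X η β (c n) H φ) atTop
      (fun ω => (a : ℂ) * cosX φ ω)

end

/-- `H` is locally integrable, `T`-periodic, even and of mean zero. -/
structure IsEvenMeanZeroPeriodic (T : ℝ) (H : ℝ → ℝ) : Prop where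
  locallyIntegrable : LocallyIntegrable H
  periodic : Function.Periodic H T
  even : Function.Even H
  mean_zero : ∫ t in (0 : ℝ)..T, H t = 0

/-- The Fourier series of the `T`-periodic function `H` converges absolutely. -/
def HasAbsConvFourierSeries {T : ℝ} (hT : 0 < T) (H : ℝ → ℝ) : Prop :=
  Summable fun k : ℤ => ‖fourierCoeffOn hT (fun t => (H t : ℂ)) k‖

end LogField

end

/-!
Write `Z_k = ∫_U φ e^{β² E[X_ε²] / 2} e^{i k β X_ε}` for the `k`-th mode of the field at scale `ε`
(`waveIntegral`). Since the field is Gaussian, the mixed moments `E[Z_k conj Z_j]` are double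
integrals of an explicit exponential of covariances (`integral_waveIntegral_mul_conj`), and
everything rests on bounds for the covariance of the mollified field: on compact subsets of `U` it
is `-log (|x - y| ∨ ε)` up to a bounded error (`exists_mollCov_bounds`).

For `k = ±1` the variances cancel in these moments, and they converge by dominated convergence, with
a limit that does not depend on the mollifiers; here `β² < d` makes `|x - y|^{-β²}` integrable. Hence
`Z_{±1}` converge in `L²` (`exists_waveIntegral_limit`), and half the sum of their limits is
`cos (β X)` (`exists_isCosine`).

An even function `H` of mean zero is, up to a multiple of `cos (β ·)`, an `L¹` limit of trigonometric
polynomials without modes of order less than two. Their coefficients can be kept bounded, or, if the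
Fourier series of `H` converges absolutely, absolutely summable with a common bound
(`exists_trigSum_approx_even`). Once the variance of `X_ε` is at least one, the law of `X_ε(x)` modulo
the period has a bounded density, so for fixed `ε` an error that is small in `L¹` over a period gives
a random variable that is small in `L¹` (`exists_eLpNorm_fieldIntegral_le`). It remains to see that the
combinations `∑ t_k Z_k` over `|k| ≥ 2` vanish in the limit uniformly over the class of polynomials
(`convergesToMultiple_of_trigSum_approx`).

For absolutely summable coefficients it is enough that `E|Z_k|² → 0` uniformly in `|k| ≥ 2`. Let `G`
be the mean of the variances at `x` and `y` minus the absolute value of their covariance. The moment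
is bounded by the integral of `e^{β² (|C| - G / 2)}`, which tends to zero because `G → ∞` off the
diagonal (`exists_decay_of_summable`).

For bounded coefficients all pairs `(k, j)` have to be summed. The exponent of the mixed moment has
a term `-(|k| - |j|)²` and a term `-|k j| G` (`moment_exponent_le`). At distances much larger than `ε`
the gap `G` is at least one, which gives exponential decay in `|k|` and `|j|`. At distances `r` of
order at most `ε` one has `G ≥ b r² / ε²` (`exists_le_covGap`): by the Cauchy–Schwarz inequality the
variance of `X_ε(x) - X_ε(y)` is bounded below through its covariance with the increment between two
points at a large multiple of `ε` on either side on the same line, where the logarithm dominates the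
Lipschitz function `g`. In the plane, integrating `e^{-b |k j| r² / ε²}` yields a factor `ε² / |k j|`;
together with `e^{-b (|k| - |j|)²}` this is summable over `k` and `j`, and `ε² ε^{-β²} → 0`
(`exists_decay_of_bounded`).
-/

noncomputable section

namespace LogField

/-! ### Logarithmic potentials of bump functions -/

theorem integrableOn_norm_rpow_neg {d : ℕ} [NeZero d] {s : ℝ} (hs : s < d) (r : ℝ) :
    IntegrableOn (fun x : Space d => ‖x‖ ^ (-s)) (Metric.ball 0 r) := by
  have h := integrableOn_fun_norm_addHaar (volume : Measure (Space d))
    (f := fun t : ℝ => t ^ (-s)) (r := r)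
  refine h.2 ?_
  rcases le_or_gt r 0 with hr | hr
  · simp [Set.Ioo_eq_empty_of_le hr]
  have hd : 1 ≤ d := NeZero.one_le
  have h2 : IntegrableOn (fun y : ℝ => y ^ ((d : ℝ) - 1 - s)) (Set.Ioo 0 r) := by
    rw [intervalIntegral.integrableOn_Ioo_rpow_iff hr]
    linarith
  refine h2.congr_fun (fun y hy => ?_) measurableSet_Ioo
  simp only [finrank_euclideanSpace, Fintype.card_fin, smul_eq_mul]
  rw [← Real.rpow_natCast, ← Real.rpow_add hy.1]
  congr 1
  push_cast [Nat.cast_sub hd]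
  ring

namespace Bump

variable {d : ℕ}

theorem continuous (η : Bump d) : Continuous η.toFun := η.contDiff.continuous

theorem eq_zero_of_one_le_norm (η : Bump d) {x : Space d} (hx : 1 ≤ ‖x‖) : η.toFun x = 0 := by
  refine image_eq_zero_of_notMem_tsupport fun h => ?_
  have := η.support_subset h
  rw [mem_ball_zero_iff] at this
  linarith

theorem hasCompactSupport (η : Bump d) : HasCompactSupport η.toFun :=
  HasCompactSupport.of_support_subset_isCompact (isCompact_closedBall 0 1)
    ((subset_tsupport _).trans (η.support_subset.trans Metric.ball_subset_closedBall))

theorem integrable (η : Bump d) : Integrable η.toFun :=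
  η.continuous.integrable_of_hasCompactSupport η.hasCompactSupport

/-- The probability measure with density `η`. -/
def law (η : Bump d) : Measure (Space d) :=
  volume.withDensity fun u => ENNReal.ofReal (η.toFun u)

instance (η : Bump d) : IsProbabilityMeasure η.law := by
  constructor
  rw [law, withDensity_apply _ MeasurableSet.univ, Measure.restrict_univ,
    ← ofReal_integral_eq_lintegral_ofReal η.integrable (ae_of_all _ η.nonneg), η.integral_eq_one,
    ENNReal.ofReal_one]

theorem law_absolutelyContinuous (η : Bump d) : η.law ≪ volume :=
  withDensity_absolutelyContinuous _ _

theorem ae_norm_lt_one (η : Bump d) : ∀ᵐ u ∂η.law, ‖u‖ < 1 := by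
  rw [law, ae_withDensity_iff (by have := η.continuous.measurable; fun_prop)]
  refine ae_of_all _ fun u hu => ?_
  by_contra h
  exact hu (by simp [η.eq_zero_of_one_le_norm (not_lt.1 h)])

theorem integral_law (η : Bump d) (F : Space d → ℝ) :
    ∫ u, F u ∂η.law = ∫ u, F u * η.toFun u := by
  rw [law, integral_withDensity_eq_integral_toReal_smul
    (by have := η.continuous.measurable; fun_prop) (by simp)]
  refine integral_congr_ae (ae_of_all _ fun u => ?_)
  simp [ENNReal.toReal_ofReal (η.nonneg u), mul_comm]

/-- Testing against `η_ε (x - ·)` is averaging over `x - ε u` with `u` distributed according to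
`η`. -/
theorem integral_mul_scaledFun (η : Bump d) {ε : ℝ} (hε : 0 < ε) (x : Space d)
    (F : Space d → ℝ) :
    ∫ y, F y * η.scaledFun ε x y = ∫ u, F (x - ε • u) ∂η.law := by
  rw [integral_law, ← integral_sub_left_eq_self _ volume x]
  have h := Measure.integral_comp_smul (volume : Measure (Space d))
    (fun z => F (x - z) * η.scaledFun ε x (x - z)) ε
  have h2 : ∫ y, F (x - y) * η.scaledFun ε x (x - y) =
      ε ^ d * ∫ u, F (x - ε • u) * η.scaledFun ε x (x - ε • u) := by
    rw [h]
    simp only [finrank_euclideanSpace, Fintype.card_fin, smul_eq_mul]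
    rw [abs_of_pos (by positivity), mul_inv_cancel_left₀ (by positivity)]
  rw [h2, ← integral_const_mul]
  refine integral_congr_ae (ae_of_all _ fun u => ?_)
  simp only [scaledFun, sub_sub_cancel, smul_smul, inv_mul_cancel₀ hε.ne', one_smul]
  field_simp

theorem scaled_apply (η : Bump d) {ε : ℝ} (hε : 0 < ε) (x y : Space d) :
    η.scaled ε x y = η.scaledFun ε x y := by
  simp [scaled, hε]

/-- The singularity `‖p - ·‖^{-1/2}` is integrable against a bump, uniformly in `p`. -/
theorem exists_lintegral_rpow_le [NeZero d] (η : Bump d) :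
    ∃ B : ℝ, 0 ≤ B ∧ ∀ p : Space d,
      ∫⁻ u, ENNReal.ofReal (‖p - u‖ ^ (-(1 / 2) : ℝ)) ∂η.law ≤ ENNReal.ofReal B := by
  obtain ⟨A, hA⟩ := η.hasCompactSupport.exists_bound_of_continuous η.continuous
  have hA0 : 0 ≤ A := (norm_nonneg _).trans (hA 0)
  have hint : IntegrableOn (fun x : Space d => ‖x‖ ^ (-(1 / 2) : ℝ)) (Metric.ball 0 1) := by
    refine integrableOn_norm_rpow_neg ?_ 1
    have : (1 : ℝ) ≤ d := by exact_mod_cast (NeZero.one_le : 1 ≤ d)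
    linarith
  set J : ℝ := ∫ x in Metric.ball (0 : Space d) 1, ‖x‖ ^ (-(1 / 2) : ℝ) with hJ
  have hJ0 : 0 ≤ J := integral_nonneg fun x => by positivity
  refine ⟨1 + A * J, by positivity, fun p => ?_⟩
  have hm : Measurable fun u : Space d => ENNReal.ofReal (‖p - u‖ ^ (-(1 / 2) : ℝ)) := by fun_prop
  set b : Space d → ENNReal :=
    (Metric.ball (0 : Space d) 1).indicator fun x => ENNReal.ofReal (‖x‖ ^ (-(1 / 2) : ℝ)) with hb
  have hbm : Measurable b := by
    refine Measurable.indicator ?_ measurableSet_ball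
    fun_prop
  -- The singularity is split off at distance one; the rest is bounded by one.
  have h1 : ∀ u, ENNReal.ofReal (‖p - u‖ ^ (-(1 / 2) : ℝ)) ≤ 1 + b (p - u) := by
    intro u
    by_cases hu : p - u ∈ Metric.ball (0 : Space d) 1
    · rw [hb, Set.indicator_of_mem hu]
      exact le_add_self
    · rw [hb, Set.indicator_of_notMem hu, add_zero, ENNReal.ofReal_le_one]
      rw [mem_ball_zero_iff, not_lt] at hu
      exact Real.rpow_le_one_of_one_le_of_nonpos hu (by norm_num)
  calc ∫⁻ u, ENNReal.ofReal (‖p - u‖ ^ (-(1 / 2) : ℝ)) ∂η.law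
      ≤ ∫⁻ u, (1 + b (p - u)) ∂η.law := lintegral_mono h1
    _ = 1 + ∫⁻ u, b (p - u) ∂η.law := by
        rw [lintegral_add_left measurable_const]
        simp
    _ ≤ 1 + ENNReal.ofReal A * ∫⁻ u, b (p - u) := by
        gcongr
        rw [law, lintegral_withDensity_eq_lintegral_mul _
          (by have := η.continuous.measurable; fun_prop) (by fun_prop),
          ← lintegral_const_mul _ (by fun_prop)]
        refine lintegral_mono fun u => ?_
        simp only [Pi.mul_apply]
        gcongr
        exact (le_abs_self _).trans (hA u)
    _ = 1 + ENNReal.ofReal A * ENNReal.ofReal J := by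
        rw [lintegral_sub_left_eq_self b p, hb, lintegral_indicator measurableSet_ball, hJ,
          ofReal_integral_eq_lintegral_ofReal hint (ae_of_all _ fun x => by positivity)]
    _ = ENNReal.ofReal (1 + A * J) := by
        rw [ENNReal.ofReal_add zero_le_one (by positivity), ENNReal.ofReal_mul hA0,
          ENNReal.ofReal_one]

/-- The same uniform bound when the position of the singularity depends on a second, independent
variable. -/
theorem exists_integral_rpow_le [NeZero d] (η : Bump d) :
    ∃ B : ℝ, 0 ≤ B ∧ ∀ (m : Measure (Space d)) [IsProbabilityMeasure m]
      (p : Space d → Space d), Measurable p →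
      Integrable (fun w : Space d × Space d => ‖p w.2 - w.1‖ ^ (-(1 / 2) : ℝ)) (η.law.prod m) ∧
      ∫ w, ‖p w.2 - w.1‖ ^ (-(1 / 2) : ℝ) ∂(η.law.prod m) ≤ B ∧
      Integrable (fun w : Space d × Space d => ‖p w.1 - w.2‖ ^ (-(1 / 2) : ℝ)) (m.prod η.law) ∧
      ∫ w, ‖p w.1 - w.2‖ ^ (-(1 / 2) : ℝ) ∂(m.prod η.law) ≤ B := by
  obtain ⟨B, hB0, hB⟩ := η.exists_lintegral_rpow_le
  refine ⟨B, hB0, fun m _ p hp => ?_⟩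
  have hm : Measurable fun w : Space d × Space d => ‖p w.1 - w.2‖ ^ (-(1 / 2) : ℝ) := by fun_prop
  have hl : ∫⁻ w, ENNReal.ofReal (‖p w.1 - w.2‖ ^ (-(1 / 2) : ℝ)) ∂(m.prod η.law) ≤
      ENNReal.ofReal B := by
    rw [lintegral_prod _ (by fun_prop)]
    calc _ ≤ ∫⁻ _, ENNReal.ofReal B ∂m := lintegral_mono fun v => hB (p v)
      _ = _ := by simp
  have hnn : ∀ w : Space d × Space d, 0 ≤ ‖p w.1 - w.2‖ ^ (-(1 / 2) : ℝ) := fun w => by positivity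
  have hi : Integrable (fun w : Space d × Space d => ‖p w.1 - w.2‖ ^ (-(1 / 2) : ℝ))
      (m.prod η.law) := by
    refine ⟨hm.aestronglyMeasurable, ?_⟩
    rw [hasFiniteIntegral_iff_ofReal (ae_of_all _ hnn)]
    exact hl.trans_lt ENNReal.ofReal_lt_top
  have hle : ∫ w, ‖p w.1 - w.2‖ ^ (-(1 / 2) : ℝ) ∂(m.prod η.law) ≤ B := by
    rw [integral_eq_lintegral_of_nonneg_ae (ae_of_all _ hnn) hm.aestronglyMeasurable]
    exact ENNReal.toReal_le_of_le_ofReal hB0 hl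
  refine ⟨hi.swap, ?_, hi, hle⟩
  rw [← integral_prod_swap]
  exact hle

end Bump

/-- As `log s ≤ 2 √s`, a logarithmic singularity is dominated by one of order `-1/2`. -/
theorem neg_log_le_of_scale {d : ℕ} {ε : ℝ} (hε : 0 < ε) {q : Space d} (hq : q ≠ 0) :
    -Real.log ‖ε • q‖ ≤ -Real.log ε + 2 * ‖q‖ ^ (-(1 / 2) : ℝ) := by
  have hq' : 0 < ‖q‖ := norm_pos_iff.2 hq
  rw [norm_smul, Real.norm_of_nonneg hε.le, Real.log_mul hε.ne' hq'.ne']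
  have := Real.log_le_rpow_div (x := ‖q‖⁻¹) (by positivity) (ε := 1 / 2) (by norm_num)
  rw [Real.log_inv, Real.inv_rpow hq'.le, ← Real.rpow_neg hq'.le] at this
  linarith

/-- Either one of the two scales is comparable to `‖z‖`, and smoothing at that scale controls the
singularity, or the distance is comparable to `‖z‖` itself. -/
theorem neg_log_norm_le {d : ℕ} {ε ε' : ℝ} (hε : 0 < ε) (hε' : 0 < ε') {z u v : Space d}
    (hz : z ≠ 0) (hu : ‖u‖ < 1) (hv : ‖v‖ < 1) (hN : z - ε • u + ε' • v ≠ 0) :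
    -Real.log ‖z - ε • u + ε' • v‖ ≤ -Real.log ‖z‖ + (4 +
      2 * ‖ε⁻¹ • (z + ε' • v) - u‖ ^ (-(1 / 2) : ℝ) +
      2 * ‖ε'⁻¹ • (ε • u - z) - v‖ ^ (-(1 / 2) : ℝ)) := by
  have hr : 0 < ‖z‖ := norm_pos_iff.2 hz
  have e1 : z - ε • u + ε' • v = ε • (ε⁻¹ • (z + ε' • v) - u) := by
    rw [smul_sub, smul_inv_smul₀ hε.ne']; abel
  have e2 : z - ε • u + ε' • v = (-ε') • (ε'⁻¹ • (ε • u - z) - v) := by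
    rw [neg_smul, smul_sub, smul_inv_smul₀ hε'.ne']; abel
  have n1 : ε⁻¹ • (z + ε' • v) - u ≠ 0 := by
    intro h; rw [e1, h, smul_zero] at hN; exact hN rfl
  have n2 : ε'⁻¹ • (ε • u - z) - v ≠ 0 := by
    intro h; rw [e2, h, smul_zero] at hN; exact hN rfl
  have p1 : 0 ≤ ‖ε⁻¹ • (z + ε' • v) - u‖ ^ (-(1 / 2) : ℝ) := by positivity
  have p2 : 0 ≤ ‖ε'⁻¹ • (ε • u - z) - v‖ ^ (-(1 / 2) : ℝ) := by positivity
  have hlog4 : Real.log 4 ≤ 3 := by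
    have := Real.log_le_sub_one_of_pos (x := 4) (by norm_num); linarith
  rcases le_or_gt (‖z‖ / 4) ε with h | h
  · have h1 := neg_log_le_of_scale hε n1
    rw [← e1] at h1
    have h2 : Real.log (‖z‖ / 4) ≤ Real.log ε := Real.log_le_log (by positivity) h
    rw [Real.log_div hr.ne' (by norm_num)] at h2
    linarith
  rcases le_or_gt (‖z‖ / 4) ε' with h' | h'
  · have h1 := neg_log_le_of_scale hε' n2
    have e3 : ‖ε' • (ε'⁻¹ • (ε • u - z) - v)‖ = ‖z - ε • u + ε' • v‖ := by
      rw [e2, neg_smul, norm_neg]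
    rw [e3] at h1
    have h2 : Real.log (‖z‖ / 4) ≤ Real.log ε' := Real.log_le_log (by positivity) h'
    rw [Real.log_div hr.ne' (by norm_num)] at h2
    linarith
  · have a1 : ‖ε • u‖ ≤ ε := by
      rw [norm_smul, Real.norm_of_nonneg hε.le]; nlinarith
    have a2 : ‖ε' • v‖ ≤ ε' := by
      rw [norm_smul, Real.norm_of_nonneg hε'.le]; nlinarith
    have a3 : ‖z‖ - ‖ε • u‖ - ‖ε' • v‖ ≤ ‖z - ε • u + ε' • v‖ := by
      have b1 := norm_sub_norm_le z (ε • u)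
      have b2 := norm_sub_norm_le (z - ε • u) (-(ε' • v))
      rw [sub_neg_eq_add, norm_neg] at b2
      linarith
    have h2 : Real.log (‖z‖ / 4) ≤ Real.log ‖z - ε • u + ε' • v‖ :=
      Real.log_le_log (by positivity) (by linarith)
    rw [Real.log_div hr.ne' (by norm_num)] at h2
    linarith

/-- The logarithmic interaction energy of two bumps of scales `ε`, `ε'` at displacement `z`. -/
def logPot {d : ℕ} (η η' : Bump d) (ε ε' : ℝ) (z : Space d) : ℝ :=
  ∫ w, -Real.log ‖z - ε • w.1 + ε' • w.2‖ ∂(η.law.prod η'.law)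

theorem ae_norm_lt_one_prod {d : ℕ} (η η' : Bump d) :
    ∀ᵐ w ∂(η.law.prod η'.law), ‖w.1‖ < 1 ∧ ‖w.2‖ < 1 :=
  (Measure.quasiMeasurePreserving_fst.ae η.ae_norm_lt_one).and
    (Measure.quasiMeasurePreserving_snd.ae η'.ae_norm_lt_one)

theorem ae_ne_zero_prod {d : ℕ} [NeZero d] (η η' : Bump d) {ε : ℝ} (ε' : ℝ) (hε : 0 < ε)
    (z : Space d) :
    ∀ᵐ w ∂(η.law.prod η'.law), z - ε • w.1 + ε' • w.2 ≠ 0 := by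
  have hms : MeasurableSet {w : Space d × Space d | z - ε • w.1 + ε' • w.2 ≠ 0} :=
    (measurableSet_eq_fun (by fun_prop) measurable_const).compl
  have hsw : ∀ᵐ w ∂(η'.law.prod η.law), z - ε • w.2 + ε' • w.1 ≠ 0 := by
    refine (Measure.ae_prod_iff_ae_ae (p := fun w => z - ε • w.2 + ε' • w.1 ≠ 0)
      (measurable_swap hms)).2 ?_
    refine ae_of_all _ fun v => ?_
    refine η.law_absolutelyContinuous.ae_le ?_
    filter_upwards [(measure_singleton (μ := (volume : Measure (Space d)))
      (ε⁻¹ • (z + ε' • v)) : _) |> compl_mem_ae_iff.2] with u hu h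
    refine hu ?_
    have : ε • u = z + ε' • v := by
      have : z + ε' • v - ε • u = 0 := by rw [← h]; abel
      exact (sub_eq_zero.1 this).symm
    simp [← this, smul_smul, inv_mul_cancel₀ hε.ne']
  exact (Measure.measurePreserving_swap (μ := η.law) (ν := η'.law)).quasiMeasurePreserving.ae hsw

theorem norm_sub_add_le {d : ℕ} {ε ε' : ℝ} (hε : 0 < ε) (hε' : 0 < ε') (z : Space d)
    {u v : Space d} (hu : ‖u‖ < 1) (hv : ‖v‖ < 1) :
    ‖z - ε • u + ε' • v‖ ≤ ‖z‖ + ε + ε' ∧ ‖z‖ - ε - ε' ≤ ‖z - ε • u + ε' • v‖ := by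
  have a1 : ‖ε • u‖ ≤ ε := by
    rw [norm_smul, Real.norm_of_nonneg hε.le]; nlinarith
  have a2 : ‖ε' • v‖ ≤ ε' := by
    rw [norm_smul, Real.norm_of_nonneg hε'.le]; nlinarith
  have b1 := norm_sub_norm_le z (ε • u)
  have b2 := norm_sub_norm_le (z - ε • u) (-(ε' • v))
  rw [sub_neg_eq_add, norm_neg] at b2
  have c1 := norm_add_le (z - ε • u) (ε' • v)
  have c2 := norm_sub_le z (ε • u)
  constructor <;> linarith

theorem integrable_log_norm {d : ℕ} [NeZero d] (η η' : Bump d) {ε ε' : ℝ} (hε : 0 < ε)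
    (hε' : 0 < ε') (z : Space d) :
    Integrable (fun w : Space d × Space d => -Real.log ‖z - ε • w.1 + ε' • w.2‖)
      (η.law.prod η'.law) := by
  obtain ⟨B, hB0, hB⟩ := η.exists_integral_rpow_le
  have h1 := (hB η'.law (fun v => ε⁻¹ • (z + ε' • v)) (by fun_prop)).1
  have hdom : Integrable (fun w : Space d × Space d => (|Real.log ε| +
      2 * ‖ε⁻¹ • (z + ε' • w.2) - w.1‖ ^ (-(1 / 2) : ℝ)) + (‖z‖ + ε + ε')) (η.law.prod η'.law) :=
    ((integrable_const _).add (h1.const_mul 2)).add (integrable_const _)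
  refine hdom.mono'
    (Real.measurable_log.comp (by fun_prop)).neg.aestronglyMeasurable ?_
  filter_upwards [ae_norm_lt_one_prod η η', ae_ne_zero_prod η η' ε' hε z] with w hw hne
  have e1 : z - ε • w.1 + ε' • w.2 = ε • (ε⁻¹ • (z + ε' • w.2) - w.1) := by
    rw [smul_sub, smul_inv_smul₀ hε.ne']; abel
  have n1 : ε⁻¹ • (z + ε' • w.2) - w.1 ≠ 0 := by
    intro h; rw [e1, h, smul_zero] at hne; exact hne rfl
  have k1 := neg_log_le_of_scale hε n1
  rw [← e1] at k1
  have k2 := (norm_sub_add_le hε hε' z hw.1 hw.2).1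
  have k3 := Real.log_le_sub_one_of_pos (norm_pos_iff.2 hne)
  have k4 := neg_abs_le (Real.log ε)
  have k5 : 0 ≤ ‖ε⁻¹ • (z + ε' • w.2) - w.1‖ ^ (-(1 / 2) : ℝ) := by positivity
  have k6 := abs_nonneg (Real.log ε)
  have k7 := norm_nonneg z
  rw [Real.norm_eq_abs, abs_le]
  constructor <;> linarith

theorem integral_const_add_add {α : Type*} [MeasurableSpace α] {μ : Measure α}
    [IsProbabilityMeasure μ] {f g : α → ℝ} (hf : Integrable f μ) (hg : Integrable g μ)
    {a b c e : ℝ} :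
    ∫ w, (a + (b + c * f w + e * g w)) ∂μ = a + (b + c * ∫ w, f w ∂μ + e * ∫ w, g w ∂μ) := by
  have h1 : Integrable (fun w => b + c * f w) μ := (integrable_const _).add (hf.const_mul c)
  have h2 : Integrable (fun w => e * g w) μ := hg.const_mul e
  have h3 : Integrable (fun w => b + c * f w + e * g w) μ := h1.add h2
  rw [integral_add (integrable_const _) h3, integral_add h1 h2,
    integral_add (integrable_const _) (hf.const_mul c), integral_const_mul, integral_const_mul]
  simp

/-- The interaction energy of two bumps is, up to an additive constant, at most that of two points,
and at most that of two points at distance `ε`. -/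
theorem exists_logPot_le {d : ℕ} [NeZero d] (η η' : Bump d) :
    ∃ C : ℝ, 0 ≤ C ∧ ∀ ε ε' : ℝ, 0 < ε → 0 < ε' → ∀ z : Space d,
      (z ≠ 0 → logPot η η' ε ε' z ≤ -Real.log ‖z‖ + C) ∧
      logPot η η' ε ε' z ≤ -Real.log ε + C := by
  obtain ⟨B, hB0, hB⟩ := η.exists_integral_rpow_le
  obtain ⟨B', hB0', hB'⟩ := η'.exists_integral_rpow_le
  refine ⟨4 + 2 * B + 2 * B', by positivity, fun ε ε' hε hε' z => ?_⟩
  have h1 := hB η'.law (fun v => ε⁻¹ • (z + ε' • v)) (by fun_prop)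
  have h2 := hB' η.law (fun u => ε'⁻¹ • (ε • u - z)) (by fun_prop)
  have i1 := h1.1
  have j1 := h1.2.1
  have i2 := h2.2.2.1
  have j2 := h2.2.2.2
  constructor
  · intro hz
    have hd : Integrable (fun w : Space d × Space d => -Real.log ‖z‖ + (4 +
        2 * ‖ε⁻¹ • (z + ε' • w.2) - w.1‖ ^ (-(1 / 2) : ℝ) +
        2 * ‖ε'⁻¹ • (ε • w.1 - z) - w.2‖ ^ (-(1 / 2) : ℝ))) (η.law.prod η'.law) :=
      (integrable_const _).add
        (((integrable_const _).add (i1.const_mul 2)).add (i2.const_mul 2))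
    have := integral_mono_ae (integrable_log_norm η η' hε hε' z) hd (by
      filter_upwards [ae_norm_lt_one_prod η η', ae_ne_zero_prod η η' ε' hε z] with w hw hne
      exact neg_log_norm_le hε hε' hz hw.1 hw.2 hne)
    rw [integral_const_add_add i1 i2] at this
    unfold logPot
    linarith
  · have hd : Integrable (fun w : Space d × Space d => -Real.log ε +
        2 * ‖ε⁻¹ • (z + ε' • w.2) - w.1‖ ^ (-(1 / 2) : ℝ)) (η.law.prod η'.law) :=
      (integrable_const _).add (i1.const_mul 2)
    have := integral_mono_ae (integrable_log_norm η η' hε hε' z) hd (by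
      filter_upwards [ae_ne_zero_prod η η' ε' hε z] with w hne
      have e1 : z - ε • w.1 + ε' • w.2 = ε • (ε⁻¹ • (z + ε' • w.2) - w.1) := by
        rw [smul_sub, smul_inv_smul₀ hε.ne']; abel
      have n1 : ε⁻¹ • (z + ε' • w.2) - w.1 ≠ 0 := by
        intro h; rw [e1, h, smul_zero] at hne; exact hne rfl
      have k1 := neg_log_le_of_scale hε n1
      rwa [← e1] at k1)
    rw [integral_add (integrable_const _) (i1.const_mul 2), integral_const_mul] at this
    simp only [integral_const, probReal_univ, one_smul] at this
    unfold logPot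
    linarith

theorem le_logPot {d : ℕ} [NeZero d] (η η' : Bump d) {ε ε' : ℝ} (hε : 0 < ε) (hε' : 0 < ε')
    (z : Space d) : -Real.log (‖z‖ + ε + ε') ≤ logPot η η' ε ε' z := by
  have := integral_mono_ae (integrable_const (-Real.log (‖z‖ + ε + ε')))
    (integrable_log_norm η η' hε hε' z) (by
      filter_upwards [ae_norm_lt_one_prod η η', ae_ne_zero_prod η η' ε' hε z] with w hw hne
      have := Real.log_le_log (norm_pos_iff.2 hne) (norm_sub_add_le hε hε' z hw.1 hw.2).1
      simpa using this)
  simpa [logPot] using this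

theorem logPot_le_of_lt {d : ℕ} [NeZero d] (η η' : Bump d) {ε ε' : ℝ} (hε : 0 < ε)
    (hε' : 0 < ε') {z : Space d} (hz : ε + ε' < ‖z‖) :
    logPot η η' ε ε' z ≤ -Real.log (‖z‖ - ε - ε') := by
  have := integral_mono_ae (integrable_log_norm η η' hε hε' z)
    (integrable_const (-Real.log (‖z‖ - ε - ε'))) (by
      filter_upwards [ae_norm_lt_one_prod η η'] with w hw
      have := Real.log_le_log (by linarith) (norm_sub_add_le hε hε' z hw.1 hw.2).2
      simpa using this)
  simpa [logPot] using this

theorem tendsto_logPot {d : ℕ} [NeZero d] (η η' : Bump d) {ι : Type*} {l : Filter ι}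
    {e e' : ι → ℝ} (he : ∀ᶠ i in l, 0 < e i) (he' : ∀ᶠ i in l, 0 < e' i)
    (h : Tendsto e l (𝓝 0)) (h' : Tendsto e' l (𝓝 0)) {z : Space d} (hz : z ≠ 0) :
    Tendsto (fun i => logPot η η' (e i) (e' i) z) l (𝓝 (-Real.log ‖z‖)) := by
  have hr : 0 < ‖z‖ := norm_pos_iff.2 hz
  have h1 : Tendsto (fun i => -Real.log (‖z‖ + e i + e' i)) l (𝓝 (-Real.log ‖z‖)) := by
    have : Tendsto (fun i => ‖z‖ + e i + e' i) l (𝓝 ‖z‖) := by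
      simpa using (tendsto_const_nhds.add h).add h'
    exact (this.log hr.ne').neg
  have h2 : Tendsto (fun i => -Real.log (‖z‖ - e i - e' i)) l (𝓝 (-Real.log ‖z‖)) := by
    have : Tendsto (fun i => ‖z‖ - e i - e' i) l (𝓝 ‖z‖) := by
      simpa using (tendsto_const_nhds.sub h).sub h'
    exact (this.log hr.ne').neg
  have h3 : Tendsto (fun i => e i + e' i) l (𝓝 0) := by simpa using h.add h'
  refine tendsto_of_tendsto_of_tendsto_of_le_of_le' h1 h2 ?_ ?_
  · filter_upwards [he, he'] with i a b using le_logPot η η' a b z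
  · filter_upwards [he, he', h3.eventually_lt_const hr] with i a b c
      using logPot_le_of_lt η η' a b c

/-! ### The covariance of the convolution approximations -/

section Covariance

variable {d : ℕ} {Ω : Type*} [MeasurableSpace Ω] {P : Measure Ω} {U : Opens (Space d)}
  {g : Space d → Space d → ℝ} {X : Ω → (𝓢(Space d, ℝ) →L[ℝ] ℝ)}

namespace IsLogCorrelatedField

theorem memLp_two (hX : IsLogCorrelatedField P U g X) (f : 𝓢(Space d, ℝ)) :
    MemLp (fun ω => X ω f) 2 P :=
  (hX.gaussian.hasGaussianLaw_eval f).memLp_two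

theorem integrable_mul (hX : IsLogCorrelatedField P U g X) (f h : 𝓢(Space d, ℝ)) :
    Integrable (fun ω => X ω f * X ω h) P :=
  (hX.memLp_two f).integrable_mul (hX.memLp_two h)

end IsLogCorrelatedField

/-- The covariance `E[X_ε(x) X'_ε'(y)]` of two convolution approximations of `X`. -/
def mollCov (P : Measure Ω) (X : Ω → (𝓢(Space d, ℝ) →L[ℝ] ℝ)) (η η' : Bump d) (ε ε' : ℝ)
    (x y : Space d) : ℝ :=
  ∫ ω, mollify X η ε x ω * mollify X η' ε' y ω ∂P

/-- The contribution of `g` to the covariance of the convolution approximations. -/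
def smoothPart (g : Space d → Space d → ℝ) (η η' : Bump d) (ε ε' : ℝ) (x y : Space d) : ℝ :=
  ∫ w, g (x - ε • w.1) (y - ε' • w.2) ∂(η.law.prod η'.law)

theorem sub_smul_mem_cthickening {K : Set (Space d)} {δ ε : ℝ} (hε : 0 < ε)
    (hεδ : ε ≤ δ) {x u : Space d} (hx : x ∈ K) (hu : ‖u‖ < 1) :
    x - ε • u ∈ Metric.cthickening δ K := by
  refine Metric.mem_cthickening_of_dist_le _ x _ _ hx ?_
  rw [dist_eq_norm, sub_sub_cancel_left, norm_neg, norm_smul, Real.norm_of_nonneg hε.le]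
  nlinarith

theorem integrable_smoothPart {K : Set (Space d)} (hK : IsCompact K) {δ : ℝ}
    (hg : ContinuousOn (Function.uncurry g)
      (Metric.cthickening δ K ×ˢ Metric.cthickening δ K)) (η η' : Bump d)
    {ε ε' : ℝ} (hε : 0 < ε) (hεδ : ε ≤ δ) (hε' : 0 < ε') (hεδ' : ε' ≤ δ) {x y : Space d}
    (hx : x ∈ K) (hy : y ∈ K) :
    Integrable (fun w : Space d × Space d => g (x - ε • w.1) (y - ε' • w.2))
      (η.law.prod η'.law) := by
  have hKc : IsCompact (Metric.cthickening δ K) := hK.cthickening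
  obtain ⟨G, hG⟩ := (hKc.prod hKc).exists_bound_of_continuousOn hg
  have hmem : ∀ᵐ w ∂(η.law.prod η'.law),
      w ∈ Metric.ball (0 : Space d) 1 ×ˢ Metric.ball (0 : Space d) 1 := by
    filter_upwards [ae_norm_lt_one_prod η η'] with w hw
    simpa using hw
  have hcont : ContinuousOn (fun w : Space d × Space d => g (x - ε • w.1) (y - ε' • w.2))
      (Metric.ball (0 : Space d) 1 ×ˢ Metric.ball (0 : Space d) 1) := by
    refine hg.comp (f := fun w : Space d × Space d => (x - ε • w.1, y - ε' • w.2))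
      (by fun_prop) fun w hw => ⟨?_, ?_⟩
    · exact sub_smul_mem_cthickening hε hεδ hx (by simpa using hw.1)
    · exact sub_smul_mem_cthickening hε' hεδ' hy (by simpa using hw.2)
  have hmeas := hcont.aestronglyMeasurable (μ := η.law.prod η'.law)
    (measurableSet_ball.prod measurableSet_ball)
  rw [Measure.restrict_eq_self_of_ae_mem hmem] at hmeas
  refine Integrable.of_bound hmeas G ?_
  filter_upwards [ae_norm_lt_one_prod η η'] with w hw
  exact hG (x - ε • w.1, y - ε' • w.2) ⟨sub_smul_mem_cthickening hε hεδ hx hw.1,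
    sub_smul_mem_cthickening hε' hεδ' hy hw.2⟩

/-- Away from the boundary of `U`, the covariance of the convolution approximations is a smoothed
logarithm plus a smoothed `g`. -/
theorem mollCov_eq [NeZero d] (hX : IsLogCorrelatedField P U g X) {K : Set (Space d)}
    (hK : IsCompact K) {δ : ℝ} (hKU : Metric.cthickening δ K ⊆ U) (η η' : Bump d)
    {ε ε' : ℝ} (hε : 0 < ε) (hεδ : ε ≤ δ) (hε' : 0 < ε') (hεδ' : ε' ≤ δ) {x y : Space d}
    (hx : x ∈ K) (hy : y ∈ K) :
    mollCov P X η η' ε ε' x y =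
      logPot η η' ε ε' (x - y) + smoothPart g η η' ε ε' x y := by
  have hg : ContinuousOn (Function.uncurry g)
      (Metric.cthickening δ K ×ˢ Metric.cthickening δ K) :=
    hX.kernel.continuousOn.mono (Set.prod_mono hKU hKU)
  have hi1 := integrable_log_norm η η' hε hε' (x - y)
  have hi2 := integrable_smoothPart hK hg η η' hε hεδ hε' hεδ' hx hy
  have hi3 : Integrable (fun w : Space d × Space d => -Real.log ‖x - y - ε • w.1 + ε' • w.2‖ +
      g (x - ε • w.1) (y - ε' • w.2)) (η.law.prod η'.law) := hi1.add hi2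
  rw [logPot, smoothPart, ← integral_add hi1 hi2, integral_prod _ hi3]
  unfold mollCov mollify
  rw [hX.covariance]
  have h1 : ∀ p : Space d, ∫ q, covKernel U g p q * η.scaled ε x p * η'.scaled ε' y q =
      (∫ v, covKernel U g p (y - ε' • v) ∂η'.law) * η.scaledFun ε x p := by
    intro p
    rw [← η'.integral_mul_scaledFun hε' y, ← integral_mul_const]
    refine integral_congr_ae (ae_of_all _ fun q => ?_)
    simp only [η.scaled_apply hε, η'.scaled_apply hε']
    ring
  simp only [h1]
  rw [η.integral_mul_scaledFun hε x fun p => ∫ v, covKernel U g p (y - ε' • v) ∂η'.law]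
  refine integral_congr_ae ?_
  filter_upwards [η.ae_norm_lt_one] with u hu
  refine integral_congr_ae ?_
  filter_upwards [η'.ae_norm_lt_one] with v hv
  have m1 : x - ε • u ∈ U := hKU (sub_smul_mem_cthickening hε hεδ hx hu)
  have m2 : y - ε' • v ∈ U := hKU (sub_smul_mem_cthickening hε' hεδ' hy hv)
  rw [covKernel, if_pos ⟨m1, m2⟩, Real.log_inv]
  congr 4
  abel

theorem abs_smoothPart_sub_le {K : Set (Space d)} (hK : IsCompact K) {δ : ℝ}
    (hg : ContinuousOn (Function.uncurry g)
      (Metric.cthickening δ K ×ˢ Metric.cthickening δ K)) (η η' : Bump d)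
    {ε ε' : ℝ} (hε : 0 < ε) (hεδ : ε ≤ δ) (hε' : 0 < ε') (hεδ' : ε' ≤ δ) {x y : Space d}
    (hx : x ∈ K) (hy : y ∈ K) {a G : ℝ}
    (hG : ∀ u v : Space d, ‖u‖ < 1 → ‖v‖ < 1 → |g (x - ε • u) (y - ε' • v) - a| ≤ G) :
    |smoothPart g η η' ε ε' x y - a| ≤ G := by
  have hi := integrable_smoothPart hK hg η η' hε hεδ hε' hεδ' hx hy
  have h : smoothPart g η η' ε ε' x y - a =
      ∫ w, (g (x - ε • w.1) (y - ε' • w.2) - a) ∂(η.law.prod η'.law) := by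
    rw [integral_sub hi (integrable_const _)]
    simp [smoothPart]
  rw [h, ← Real.norm_eq_abs]
  have := norm_integral_le_of_norm_le_const (μ := η.law.prod η'.law) (C := G)
    (f := fun w => g (x - ε • w.1) (y - ε' • w.2) - a) (by
      filter_upwards [ae_norm_lt_one_prod η η'] with w hw
      exact hG _ _ hw.1 hw.2)
  simpa using this

/-- Uniform bounds for the covariance of the convolution approximations on a compact set. -/
theorem exists_mollCov_bounds [NeZero d] (hX : IsLogCorrelatedField P U g X) {K : Set (Space d)}
    (hK : IsCompact K) (hKU : K ⊆ U) (η η' : Bump d) :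
    ∃ ε₀ > 0, ∃ C ≥ 0, ∀ ε ε' : ℝ, 0 < ε → ε ≤ ε₀ → 0 < ε' → ε' ≤ ε₀ → ∀ x ∈ K, ∀ y ∈ K,
      (x ≠ y → mollCov P X η η' ε ε' x y ≤ -Real.log ‖x - y‖ + C) ∧
      mollCov P X η η' ε ε' x y ≤ -Real.log ε + C ∧
      -Real.log (‖x - y‖ + ε + ε') - C ≤ mollCov P X η η' ε ε' x y := by
  obtain ⟨δ, hδ, hδU⟩ := hK.exists_cthickening_subset_open U.isOpen hKU
  have hg : ContinuousOn (Function.uncurry g)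
      (Metric.cthickening δ K ×ˢ Metric.cthickening δ K) :=
    hX.kernel.continuousOn.mono (Set.prod_mono hδU hδU)
  have hKc : IsCompact (Metric.cthickening δ K) := hK.cthickening
  obtain ⟨G, hG⟩ := (hKc.prod hKc).exists_bound_of_continuousOn hg
  obtain ⟨C, hC0, hC⟩ := exists_logPot_le η η'
  refine ⟨δ, hδ, C + |G|, by positivity, fun ε ε' hε hεδ hε' hεδ' x hx y hy => ?_⟩
  have h1 := mollCov_eq hX hK hδU η η' hε hεδ hε' hεδ' hx hy
  have h2 : |smoothPart g η η' ε ε' x y - 0| ≤ G :=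
    abs_smoothPart_sub_le hK hg η η' hε hεδ hε' hεδ' hx hy fun u v hu hv => by
      rw [sub_zero]
      exact hG (x - ε • u, y - ε' • v) ⟨sub_smul_mem_cthickening hε hεδ hx hu,
        sub_smul_mem_cthickening hε' hεδ' hy hv⟩
  rw [sub_zero] at h2
  have h3 := abs_le.1 (h2.trans (le_abs_self G))
  obtain ⟨h4, h5⟩ := hC ε ε' hε hε' (x - y)
  have h6 := le_logPot η η' hε hε' (x - y)
  rw [h1]
  refine ⟨fun hxy => ?_, by linarith, by linarith⟩
  have := h4 (sub_ne_zero.2 hxy)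
  linarith

theorem tendsto_mollCov [NeZero d] (hX : IsLogCorrelatedField P U g X) (η η' : Bump d)
    {ι : Type*} {l : Filter ι} {e e' : ι → ℝ} (he : ∀ᶠ i in l, 0 < e i)
    (he' : ∀ᶠ i in l, 0 < e' i) (h : Tendsto e l (𝓝 0)) (h' : Tendsto e' l (𝓝 0))
    {x y : Space d} (hx : x ∈ U) (hy : y ∈ U) (hxy : x ≠ y) :
    Tendsto (fun i => mollCov P X η η' (e i) (e' i) x y) l (𝓝 (-Real.log ‖x - y‖ + g x y)) := by
  have hK : IsCompact ({x, y} : Set (Space d)) := (Set.toFinite _).isCompact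
  obtain ⟨δ, hδ, hδU⟩ := hK.exists_cthickening_subset_open U.isOpen
    (Set.insert_subset hx (Set.singleton_subset_iff.2 hy))
  have hg : ContinuousOn (Function.uncurry g)
      (Metric.cthickening δ {x, y} ×ˢ Metric.cthickening δ {x, y}) :=
    hX.kernel.continuousOn.mono (Set.prod_mono hδU hδU)
  have hlog := tendsto_logPot η η' he he' h h' (sub_ne_zero.2 hxy)
  have hs : Tendsto (fun i => smoothPart g η η' (e i) (e' i) x y) l (𝓝 (g x y)) := by
    rw [Metric.tendsto_nhds]
    intro γ hγ
    have hgc : ContinuousAt (Function.uncurry g) (x, y) :=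
      hX.kernel.continuousOn.continuousAt ((U.isOpen.prod U.isOpen).mem_nhds ⟨hx, hy⟩)
    obtain ⟨ρ, hρ, hρg⟩ := Metric.continuousAt_iff.1 hgc (γ / 2) (by positivity)
    filter_upwards [he, he', h.eventually_lt_const hδ, h'.eventually_lt_const hδ,
      h.eventually_lt_const hρ, h'.eventually_lt_const hρ] with i a a' b b' c c'
    rw [Real.dist_eq]
    refine lt_of_le_of_lt (abs_smoothPart_sub_le hK hg η η' a b.le a' b'.le (by simp) (by simp)
      (G := γ / 2) fun u v hu hv => ?_) (by linarith)
    have key : ∀ (t : ℝ) (p w : Space d), 0 < t → t < ρ → ‖w‖ < 1 → dist (p - t • w) p < ρ := by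
      intro t p w ht htρ hw
      rw [dist_eq_norm, sub_sub_cancel_left, norm_neg, norm_smul, Real.norm_of_nonneg ht.le]
      nlinarith
    have := hρg (x := (x - e i • u, y - e' i • v)) (by
      rw [Prod.dist_eq]
      exact max_lt (key _ _ _ a c hu) (key _ _ _ a' c' hv))
    rw [Real.dist_eq] at this
    exact this.le
  refine (hlog.add hs).congr' ?_
  filter_upwards [he, he', h.eventually_lt_const hδ, h'.eventually_lt_const hδ] with i a a' b b'
  exact (mollCov_eq hX hK hδU η η' a b.le a' b'.le (by simp) (by simp)).symm

/-- The Cauchy–Schwarz inequality, weakened by the inequality of arithmetic and geometric means. -/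
theorem abs_mollCov_le (hX : IsLogCorrelatedField P U g X) (η : Bump d) (ε : ℝ)
    (x y : Space d) :
    |mollCov P X η η ε ε x y| ≤ (mollCov P X η η ε ε x x + mollCov P X η η ε ε y y) / 2 := by
  have key : ∀ f h : 𝓢(Space d, ℝ), |∫ ω, X ω f * X ω h ∂P| ≤
      (∫ ω, X ω f * X ω f ∂P + ∫ ω, X ω h * X ω h ∂P) / 2 := by
    intro f h
    rw [← integral_add (hX.integrable_mul f f) (hX.integrable_mul h h), ← integral_div]
    refine (abs_integral_le_integral_abs).trans (integral_mono (hX.integrable_mul f h).abs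
      (((hX.integrable_mul f f).add (hX.integrable_mul h h)).div_const 2) fun ω => ?_)
    rw [abs_le]
    constructor <;> nlinarith [sq_nonneg (X ω f - X ω h), sq_nonneg (X ω f + X ω h)]
  exact key _ _

end Covariance

/-! ### Path continuity and joint measurability of the convolution approximations -/

theorem continuous_compSubConstCLM {d : ℕ} {ψ : 𝓢(Space d, ℝ)} (hψ : HasCompactSupport ψ) :
    Continuous fun a : Space d => ψ.compSubConstCLM ℝ a := by
  rw [continuous_iff_continuousAt]
  intro b
  refine ((schwartz_withSeminorms ℝ (Space d) ℝ).tendsto_nhds _ _).2 ?_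
  rintro ⟨k, n⟩ γ hγ
  have hsupp : HasCompactSupport (iteratedFDeriv ℝ n ψ) := hψ.iteratedFDeriv n
  have hcont : Continuous (iteratedFDeriv ℝ n ψ) :=
    (ψ.smooth n).continuous_iteratedFDeriv le_rfl
  obtain ⟨R, hR⟩ := hsupp.isCompact.isBounded.subset_closedBall 0
  set A : ℝ := (|R| + ‖b‖ + 1) ^ k with hA
  have hA0 : 0 < A := by positivity
  have huc := hsupp.uniformContinuous_of_continuous hcont
  obtain ⟨ρ, hρ, hρu⟩ := Metric.uniformContinuous_iff.1 huc (γ / (2 * A)) (by positivity)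
  filter_upwards [Metric.ball_mem_nhds b (lt_min hρ one_pos)] with a ha
  have ha1 : dist a b < ρ := lt_of_lt_of_le ha (min_le_left _ _)
  have ha2 : dist a b < 1 := lt_of_lt_of_le ha (min_le_right _ _)
  refine lt_of_le_of_lt (SchwartzMap.seminorm_le_bound ℝ k n _ (M := γ / 2) (by positivity)
    fun y => ?_) (by linarith)
  have hd : iteratedFDeriv ℝ n (ψ.compSubConstCLM ℝ a - ψ.compSubConstCLM ℝ b : 𝓢(Space d, ℝ)) y =
      iteratedFDeriv ℝ n ψ (y - a) - iteratedFDeriv ℝ n ψ (y - b) := by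
    have e1 : ((ψ.compSubConstCLM ℝ a - ψ.compSubConstCLM ℝ b : 𝓢(Space d, ℝ)) : Space d → ℝ) =
        (fun z => ψ (z - a)) - fun z => ψ (z - b) := rfl
    rw [e1, iteratedFDeriv_sub_apply, iteratedFDeriv_comp_sub, iteratedFDeriv_comp_sub]
    · exact ((ψ.smooth n).comp (contDiff_id.sub contDiff_const)).contDiffAt
    · exact ((ψ.smooth n).comp (contDiff_id.sub contDiff_const)).contDiffAt
  rw [hd]
  have hz : ∀ c : Space d, dist c b < 1 → |R| + ‖b‖ + 1 < ‖y‖ →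
      iteratedFDeriv ℝ n ψ (y - c) = 0 := by
    intro c hc hy
    refine image_eq_zero_of_notMem_tsupport fun h => ?_
    have h1 := hR h
    rw [mem_closedBall_zero_iff] at h1
    have h2 := norm_sub_norm_le y c
    have h3 := norm_sub_norm_le c b
    rw [dist_eq_norm] at hc
    have := le_abs_self R
    linarith
  rcases lt_or_ge (|R| + ‖b‖ + 1) ‖y‖ with hy | hy
  · rw [hz a ha2 hy, hz b (by simp) hy]
    simp only [sub_zero, norm_zero, mul_zero]
    positivity
  · have h1 : ‖y‖ ^ k ≤ A := by rw [hA]; gcongr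
    have h2 : dist (y - a) (y - b) < ρ := by rwa [dist_sub_left]
    have h3 := (hρu h2).le
    rw [dist_eq_norm] at h3
    calc _ ≤ A * (γ / (2 * A)) := by gcongr
      _ = γ / 2 := by field_simp

theorem Bump.scaled_eq_compSubConstCLM {d : ℕ} (η : Bump d) (ε : ℝ) (x : Space d) :
    η.scaled ε x = (η.scaled ε 0).compSubConstCLM ℝ x := by
  ext y
  rw [SchwartzMap.compSubConstCLM_apply]
  by_cases hε : 0 < ε
  · rw [η.scaled_apply hε, η.scaled_apply hε]
    unfold Bump.scaledFun
    congr 1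
    apply η.radial
    rw [zero_sub, norm_smul, norm_smul, norm_neg, norm_sub_rev]
  · simp [Bump.scaled, hε]

theorem continuous_mollify {d : ℕ} {Ω : Type*} (X : Ω → (𝓢(Space d, ℝ) →L[ℝ] ℝ)) (η : Bump d)
    (ε : ℝ) (ω : Ω) :
    Continuous fun x => mollify X η ε x ω := by
  have hc : HasCompactSupport (η.scaled ε 0) := by
    by_cases hε : 0 < ε
    · have : (η.scaled ε 0 : Space d → ℝ) = η.scaledFun ε 0 :=
        funext fun y => η.scaled_apply hε 0 y
      rw [this]
      exact η.hasCompactSupport_scaledFun hε 0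
    · simp only [Bump.scaled, hε, dif_neg, not_false_eq_true]
      exact HasCompactSupport.zero
  have := (X ω).continuous.comp (continuous_compSubConstCLM hc)
  refine this.congr fun x => ?_
  rw [mollify, η.scaled_eq_compSubConstCLM ε x]
  rfl

section Paths

variable {d : ℕ} {Ω : Type*} [MeasurableSpace Ω] {P : Measure Ω} {U : Opens (Space d)}
  {g : Space d → Space d → ℝ} {X : Ω → (𝓢(Space d, ℝ) →L[ℝ] ℝ)}

/-- The convolution approximations have a jointly measurable version, all of whose values agree
almost surely with the given ones: by continuity of the paths it is enough to correct countably
many of the variables. -/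
theorem exists_measurable_mollify (hX : IsLogCorrelatedField P U g X) (η : Bump d) (ε : ℝ) :
    ∃ Y : Space d → Ω → ℝ, Measurable (Function.uncurry Y) ∧
      ∀ᵐ ω ∂P, ∀ x, Y x ω = mollify X η ε x ω := by
  have hae : ∀ x, AEMeasurable (mollify X η ε x) P := fun x => hX.gaussian.aemeasurable _
  have hq : ∀ᵐ ω ∂P, ∀ n, mollify X η ε (denseSeq (Space d) n) ω =
      (hae (denseSeq (Space d) n)).mk _ ω :=
    ae_all_iff.2 fun n => (hae (denseSeq (Space d) n)).ae_eq_mk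
  obtain ⟨A, hA, hAm, hAq⟩ : ∃ A : Set Ω, (∀ᵐ ω ∂P, ω ∈ A) ∧ MeasurableSet A ∧ ∀ ω ∈ A, ∀ n,
      mollify X η ε (denseSeq (Space d) n) ω = (hae (denseSeq (Space d) n)).mk _ ω := by
    refine ⟨(toMeasurable P {ω | ∀ n, mollify X η ε (denseSeq (Space d) n) ω =
      (hae (denseSeq (Space d) n)).mk _ ω}ᶜ)ᶜ, ?_, (measurableSet_toMeasurable _ _).compl,
      fun ω hω => ?_⟩
    · have : P {ω | ∀ n, mollify X η ε (denseSeq (Space d) n) ω =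
          (hae (denseSeq (Space d) n)).mk _ ω}ᶜ = 0 := hq
      rw [← measure_toMeasurable] at this
      exact compl_mem_ae_iff.2 this
    · by_contra h
      exact hω (subset_toMeasurable _ _ h)
  refine ⟨fun x => A.indicator (mollify X η ε x), ?_, ?_⟩
  · refine measurable_uncurry_of_continuous_of_measurable (u := fun x => A.indicator
      (mollify X η ε x)) (fun ω => ?_) fun x => ?_
    · by_cases hω : ω ∈ A
      · simpa [Set.indicator_of_mem hω] using continuous_mollify X η ε ω
      · simpa [Set.indicator_of_notMem hω] using continuous_const
    · obtain ⟨u, hu⟩ : ∃ u : ℕ → ℕ, Tendsto (fun n => denseSeq (Space d) (u n)) atTop (𝓝 x) := by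
        have hmem : x ∈ closure (Set.range (denseSeq (Space d))) :=
          (denseRange_denseSeq (Space d)) x
        obtain ⟨v, hv, hvx⟩ := mem_closure_iff_seq_limit.1 hmem
        choose u hu using hv
        exact ⟨u, by simpa only [hu] using hvx⟩
      refine measurable_of_tendsto_metrizable (f := fun n => A.indicator
        ((hae (denseSeq (Space d) (u n))).mk _))
        (fun n => ((hae (denseSeq (Space d) (u n))).measurable_mk).indicator hAm) ?_
      rw [tendsto_pi_nhds]
      intro ω
      by_cases hω : ω ∈ A
      · simp only [Set.indicator_of_mem hω]
        have := ((continuous_mollify X η ε ω).tendsto x).comp hu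
        refine this.congr fun n => ?_
        exact hAq ω hω (u n)
      · simp only [Set.indicator_of_notMem hω]
        exact tendsto_const_nhds
  · filter_upwards [hA] with ω hω x
    rw [Set.indicator_of_mem hω]

/-- The characteristic function of a pairing of the field. -/
theorem integral_cexp_field (hX : IsLogCorrelatedField P U g X) (f : 𝓢(Space d, ℝ)) :
    ∫ ω, Complex.exp ((X ω f : ℝ) * Complex.I) ∂P =
      (Real.exp (-(∫ ω, X ω f ^ 2 ∂P) / 2) : ℝ) := by
  have hg := hX.gaussian.hasGaussianLaw_eval f
  have : IsProbabilityMeasure P := hX.gaussian.isProbabilityMeasure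
  have hm := hg.map_eq_gaussianReal
  have h1 : charFun (P.map fun ω => X ω f) 1 = ∫ ω, Complex.exp ((X ω f : ℝ) * Complex.I) ∂P := by
    rw [charFun_apply_real, integral_map hg.aemeasurable (by fun_prop)]
    simp
  have hv : Var[fun ω => X ω f; P] = ∫ ω, X ω f ^ 2 ∂P := by
    rw [variance_of_integral_eq_zero hg.aemeasurable (hX.centred f)]
  rw [← h1, hm, charFun_gaussianReal, hX.centred f, hv,
    Real.coe_toNNReal _ (integral_nonneg fun ω => sq_nonneg _)]
  push_cast
  congr 1
  simp
  ring

/-- Second moments of spatial integrals of a bounded random field. -/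
theorem integral_mul_conj_integral {E : Type*} [MeasurableSpace E] {μ : Measure E}
    [IsFiniteMeasure μ] [IsProbabilityMeasure P] {F G : E → Ω → ℂ}
    (hF : Measurable (Function.uncurry F)) (hG : Measurable (Function.uncurry G)) {B B' : ℝ}
    (bF : ∀ x ω, ‖F x ω‖ ≤ B) (bG : ∀ x ω, ‖G x ω‖ ≤ B') :
    ∫ ω, (∫ x, F x ω ∂μ) * (starRingEnd ℂ) (∫ y, G y ω ∂μ) ∂P =
      ∫ w, (∫ ω, F w.1 ω * (starRingEnd ℂ) (G w.2 ω) ∂P) ∂(μ.prod μ) := by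
  have hm : Measurable (Function.uncurry fun (w : E × E) (ω : Ω) =>
      F w.1 ω * (starRingEnd ℂ) (G w.2 ω)) := by
    have h1 : Measurable fun q : (E × E) × Ω => F q.1.1 q.2 :=
      hF.comp (f := fun q : (E × E) × Ω => (q.1.1, q.2)) (by fun_prop)
    have h2 : Measurable fun q : (E × E) × Ω => G q.1.2 q.2 :=
      hG.comp (f := fun q : (E × E) × Ω => (q.1.2, q.2)) (by fun_prop)
    exact h1.mul (Complex.continuous_conj.measurable.comp h2)
  have hi : Integrable (Function.uncurry fun (w : E × E) (ω : Ω) =>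
      F w.1 ω * (starRingEnd ℂ) (G w.2 ω)) ((μ.prod μ).prod P) := by
    refine Integrable.of_bound hm.aestronglyMeasurable (B * B') (ae_of_all _ fun q => ?_)
    have h0 : 0 ≤ B := (norm_nonneg _).trans (bF q.1.1 q.2)
    simp only [Function.uncurry, norm_mul, RCLike.norm_conj]
    exact mul_le_mul (bF _ _) (bG _ _) (norm_nonneg _) h0
  rw [integral_integral_swap hi]
  refine integral_congr_ae (ae_of_all _ fun ω => ?_)
  simp only
  rw [← integral_conj, ← integral_prod_mul]

end Paths

/-! ### Exponentials of the convolution approximations -/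

theorem integrable_norm_sub_rpow_neg {d : ℕ} [NeZero d] {S : Set (Space d)}
    (hSm : MeasurableSet S) (hS : Bornology.IsBounded S) {s : ℝ} (hs : s < d) :
    Integrable (fun w : Space d × Space d => ‖w.1 - w.2‖ ^ (-s))
      ((volume.restrict S).prod (volume.restrict S)) := by
  obtain ⟨R, hR⟩ := hS.subset_ball 0
  have hfin : volume S < ⊤ := hS.measure_lt_top
  have : IsFiniteMeasure (volume.restrict S) := ⟨by simpa using hfin⟩
  have hm : Measurable fun w : Space d × Space d => ‖w.1 - w.2‖ ^ (-s) := by fun_prop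
  refine ⟨hm.aestronglyMeasurable, ?_⟩
  rw [hasFiniteIntegral_iff_ofReal (ae_of_all _ fun w => by positivity),
    lintegral_prod _ (by fun_prop)]
  set b : Space d → ENNReal :=
    (Metric.ball (0 : Space d) (2 * R)).indicator fun x => ENNReal.ofReal (‖x‖ ^ (-s)) with hb
  have hJ : ∫⁻ y, b y < ⊤ := by
    rw [hb, lintegral_indicator measurableSet_ball]
    have := (integrableOn_norm_rpow_neg (d := d) hs (2 * R)).2
    rwa [hasFiniteIntegral_iff_ofReal (ae_of_all _ fun w => by positivity)] at this
  have h1 : ∀ x ∈ Metric.ball (0 : Space d) R,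
      ∫⁻ y in S, ENNReal.ofReal (‖x - y‖ ^ (-s)) ≤ ∫⁻ y, b y := by
    intro x hx
    calc ∫⁻ y in S, ENNReal.ofReal (‖x - y‖ ^ (-s))
        ≤ ∫⁻ y in Metric.ball 0 R, ENNReal.ofReal (‖x - y‖ ^ (-s)) := lintegral_mono_set hR
      _ ≤ ∫⁻ y in Metric.ball 0 R, b (x - y) := by
          refine setLIntegral_mono' measurableSet_ball fun y hy => ?_
          rw [hb, Set.indicator_of_mem]
          rw [mem_ball_zero_iff] at *
          exact (norm_sub_le _ _).trans_lt (by linarith)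
      _ ≤ ∫⁻ y, b (x - y) := setLIntegral_le_lintegral _ _
      _ = _ := lintegral_sub_left_eq_self b x
  calc ∫⁻ x in S, ∫⁻ y in S, ENNReal.ofReal (‖x - y‖ ^ (-s))
      ≤ ∫⁻ _ in S, ∫⁻ y, b y := by
        exact setLIntegral_mono' hSm fun x hx => h1 x (hR hx)
    _ < ⊤ := by
        rw [lintegral_const]
        exact ENNReal.mul_lt_top hJ (by simpa using hfin)

theorem ae_fst_ne_snd {d : ℕ} [NeZero d] (S : Set (Space d)) :
    ∀ᵐ w ∂((volume.restrict S).prod (volume.restrict S)), w.1 ≠ w.2 := by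
  refine (Measure.ae_prod_iff_ae_ae (p := fun w : Space d × Space d => w.1 ≠ w.2)
    (measurableSet_diagonal.compl)).2 (ae_of_all _ fun x => ?_)
  refine ae_restrict_of_ae ?_
  filter_upwards [compl_mem_ae_iff.2 (measure_singleton (μ := (volume : Measure (Space d))) x)]
    with y hy h
  exact hy h.symm

section Waves

variable {d : ℕ} {Ω : Type*} [MeasurableSpace Ω] {P : Measure Ω} {U : Opens (Space d)}
  {g : Space d → Space d → ℝ} {X : Ω → (𝓢(Space d, ℝ) →L[ℝ] ℝ)}

/-- The deterministic factor `φ(x) e^{β² E[X_ε(x)²] / 2}`. -/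
def waveWeight (P : Measure Ω) (X : Ω → (𝓢(Space d, ℝ) →L[ℝ] ℝ)) (η : Bump d) (β ε : ℝ)
    (φ : Space d → ℂ) (x : Space d) : ℂ :=
  φ x * (Real.exp (β ^ 2 / 2 * mollCov P X η η ε ε x x) : ℝ)

/-- The random variable `∫_U φ(x) e^{β² E[X_ε(x)²] / 2} e^{i k β X_ε(x)} dx`. -/
def waveIntegral (P : Measure Ω) (U : Opens (Space d)) (X : Ω → (𝓢(Space d, ℝ) →L[ℝ] ℝ))
    (η : Bump d) (β ε : ℝ) (φ : Space d → ℂ) (k : ℤ) (ω : Ω) : ℂ :=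
  ∫ x in (U : Set (Space d)),
    waveWeight P X η β ε φ x * Complex.exp ((k * β * mollify X η ε x ω : ℝ) * Complex.I)

theorem integral_mollify_sq (P : Measure Ω) (X : Ω → (𝓢(Space d, ℝ) →L[ℝ] ℝ)) (η : Bump d)
    (ε : ℝ) (x : Space d) :
    ∫ ω, mollify X η ε x ω ^ 2 ∂P = mollCov P X η η ε ε x x := by
  simp [mollCov, pow_two]

theorem renormIntegrand_eq (P : Measure Ω) (X : Ω → (𝓢(Space d, ℝ) →L[ℝ] ℝ)) (η : Bump d)
    (β ε : ℝ) (H : ℝ → ℝ) (φ : Space d → ℂ) (ω : Ω) (x : Space d) :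
    renormIntegrand P X η β ε H φ ω x =
      waveWeight P X η β ε φ x * (H (mollify X η ε x ω) : ℝ) := by
  rw [renormIntegrand, waveWeight, integral_mollify_sq]
  push_cast
  ring

theorem measurable_mollCov [SFinite P] (hX : IsLogCorrelatedField P U g X) (η η' : Bump d)
    (ε ε' : ℝ) :
    Measurable fun w : Space d × Space d => mollCov P X η η' ε ε' w.1 w.2 := by
  obtain ⟨Y, hY, hYX⟩ := exists_measurable_mollify hX η ε
  obtain ⟨Y', hY', hYX'⟩ := exists_measurable_mollify hX η' ε'
  have h1 : Measurable fun q : (Space d × Space d) × Ω => Y q.1.1 q.2 :=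
    hY.comp (f := fun q : (Space d × Space d) × Ω => (q.1.1, q.2)) (by fun_prop)
  have h2 : Measurable fun q : (Space d × Space d) × Ω => Y' q.1.2 q.2 :=
    hY'.comp (f := fun q : (Space d × Space d) × Ω => (q.1.2, q.2)) (by fun_prop)
  have h3 := ((h1.mul h2).stronglyMeasurable.integral_prod_right' (ν := P)).measurable
  convert h3 using 2 with w
  refine integral_congr_ae ?_
  filter_upwards [hYX, hYX'] with ω h h'
  simp [h, h']

theorem measurable_waveWeight [SFinite P] (hX : IsLogCorrelatedField P U g X) (η : Bump d)
    (β ε : ℝ) {φ : Space d → ℂ} (hφ : Measurable φ) : Measurable (waveWeight P X η β ε φ) := by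
  have h := (measurable_mollCov hX η η ε ε).comp (f := fun x : Space d => (x, x)) (by fun_prop)
  exact hφ.mul (Complex.measurable_ofReal.comp (Real.measurable_exp.comp (h.const_mul _)))

theorem norm_waveWeight_le (P : Measure Ω) (X : Ω → (𝓢(Space d, ℝ) →L[ℝ] ℝ)) (η : Bump d)
    (β ε : ℝ) {φ : Space d → ℂ} {M b : ℝ} (hM : ∀ x, ‖φ x‖ ≤ M)
    (hb : ∀ x ∈ tsupport φ, mollCov P X η η ε ε x x ≤ b) (x : Space d) :
    ‖waveWeight P X η β ε φ x‖ ≤ M * Real.exp (β ^ 2 / 2 * b) := by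
  have hM0 : 0 ≤ M := (norm_nonneg _).trans (hM x)
  by_cases hx : x ∈ tsupport φ
  · rw [waveWeight, norm_mul, Complex.norm_real, Real.norm_eq_abs, Real.abs_exp]
    gcongr
    · exact hM x
    · exact hb x hx
  · rw [waveWeight, image_eq_zero_of_notMem_tsupport hx, zero_mul, norm_zero]
    positivity

theorem norm_cexp_real_mul_I (t : ℝ) : ‖Complex.exp ((t : ℂ) * Complex.I)‖ = 1 :=
  Complex.norm_exp_ofReal_mul_I t

/-- The waves are, up to a null set of `ω`, integrals of a jointly measurable field. -/
theorem exists_measurable_wave [SFinite P] (hX : IsLogCorrelatedField P U g X) (η : Bump d)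
    (β ε : ℝ) {φ : Space d → ℂ} (hφ : Measurable φ) (k : ℤ) :
    ∃ F : Space d → Ω → ℂ, Measurable (Function.uncurry F) ∧
      (∀ x ω, ‖F x ω‖ = ‖waveWeight P X η β ε φ x‖) ∧
      ∀ᵐ ω ∂P, ∀ x, F x ω = waveWeight P X η β ε φ x *
        Complex.exp ((k * β * mollify X η ε x ω : ℝ) * Complex.I) := by
  obtain ⟨Y, hY, hYX⟩ := exists_measurable_mollify hX η ε
  refine ⟨fun x ω => waveWeight P X η β ε φ x *
    Complex.exp ((k * β * Y x ω : ℝ) * Complex.I), ?_, fun x ω => ?_, ?_⟩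
  · have h1 := measurable_waveWeight hX η β ε hφ
    have h2 : Measurable fun q : Space d × Ω => Y q.1 q.2 := hY
    have h3 : Measurable fun q : Space d × Ω => ((k * β * Y q.1 q.2 : ℝ) : ℂ) :=
      Complex.measurable_ofReal.comp (h2.const_mul _)
    exact (h1.comp measurable_fst).mul (Complex.measurable_exp.comp (h3.mul_const _))
  · rw [norm_mul, norm_cexp_real_mul_I, mul_one]
  · filter_upwards [hYX] with ω h x
    rw [h]

theorem aestronglyMeasurable_waveIntegral [SFinite P] (hX : IsLogCorrelatedField P U g X)
    (η : Bump d) (β ε : ℝ) {φ : Space d → ℂ} (hφ : Measurable φ) (k : ℤ) :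
    AEStronglyMeasurable (waveIntegral P U X η β ε φ k) P := by
  obtain ⟨F, hF, -, hFX⟩ := exists_measurable_wave hX η β ε hφ k
  refine ⟨fun ω => ∫ x in (U : Set (Space d)), F x ω, ?_, ?_⟩
  · exact (hF.stronglyMeasurable).integral_prod_left' (μ := volume.restrict (U : Set (Space d)))
  · filter_upwards [hFX] with ω h
    simp only [h, waveIntegral]

theorem norm_waveIntegral_le (hX : IsLogCorrelatedField P U g X) (η : Bump d) (β ε : ℝ)
    {φ : Space d → ℂ} {B : ℝ} (hB : ∀ x, ‖waveWeight P X η β ε φ x‖ ≤ B) (k : ℤ) (ω : Ω) :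
    ‖waveIntegral P U X η β ε φ k ω‖ ≤ B * volume.real (U : Set (Space d)) := by
  refine norm_setIntegral_le_of_norm_le_const hX.kernel.bounded.measure_lt_top fun x _ => ?_
  rw [norm_mul, norm_cexp_real_mul_I, mul_one]
  exact hB x

/-- The joint characteristic function of two values of the convolution approximations. -/
theorem integral_cexp_pair (hX : IsLogCorrelatedField P U g X) (η η' : Bump d) (β ε ε' : ℝ)
    (k j : ℤ) (x y : Space d) :
    ∫ ω, Complex.exp ((k * β * mollify X η ε x ω : ℝ) * Complex.I) *
      (starRingEnd ℂ) (Complex.exp ((j * β * mollify X η' ε' y ω : ℝ) * Complex.I)) ∂P =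
    (Real.exp (-(β ^ 2 / 2) * (k ^ 2 * mollCov P X η η ε ε x x +
      j ^ 2 * mollCov P X η' η' ε' ε' y y - 2 * k * j * mollCov P X η η' ε ε' x y)) : ℝ) := by
  have h := integral_cexp_field hX
    ((k * β) • η.scaled ε x - (j * β) • η'.scaled ε' y)
  have e1 : ∀ ω, X ω ((k * β) • η.scaled ε x - (j * β) • η'.scaled ε' y) =
      k * β * mollify X η ε x ω - j * β * mollify X η' ε' y ω := by
    intro ω
    simp [mollify]
  simp only [e1] at h
  have e2 : ∫ ω, (k * β * mollify X η ε x ω - j * β * mollify X η' ε' y ω) ^ 2 ∂P =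
      β ^ 2 * (k ^ 2 * mollCov P X η η ε ε x x +
      j ^ 2 * mollCov P X η' η' ε' ε' y y - 2 * k * j * mollCov P X η η' ε ε' x y) := by
    have i1 : Integrable (fun ω => mollify X η ε x ω * mollify X η ε x ω) P :=
      hX.integrable_mul _ _
    have i2 : Integrable (fun ω => mollify X η' ε' y ω * mollify X η' ε' y ω) P :=
      hX.integrable_mul _ _
    have i3 : Integrable (fun ω => mollify X η ε x ω * mollify X η' ε' y ω) P :=
      hX.integrable_mul _ _
    have e3 : ∀ ω, (k * β * mollify X η ε x ω - j * β * mollify X η' ε' y ω) ^ 2 =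
        (k * β) ^ 2 * (mollify X η ε x ω * mollify X η ε x ω) +
        (j * β) ^ 2 * (mollify X η' ε' y ω * mollify X η' ε' y ω) -
        (2 * (k * β) * (j * β)) * (mollify X η ε x ω * mollify X η' ε' y ω) := by
      intro ω; ring
    simp only [e3]
    have i4 : Integrable (fun ω => (k * β) ^ 2 * (mollify X η ε x ω * mollify X η ε x ω) +
        (j * β) ^ 2 * (mollify X η' ε' y ω * mollify X η' ε' y ω)) P :=
      (i1.const_mul _).add (i2.const_mul _)
    rw [integral_sub i4 (i3.const_mul _),
      integral_add (i1.const_mul _) (i2.const_mul _), integral_const_mul, integral_const_mul,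
      integral_const_mul]
    unfold mollCov
    ring
  rw [e2] at h
  have e4 : ∀ ω, Complex.exp ((k * β * mollify X η ε x ω : ℝ) * Complex.I) *
      (starRingEnd ℂ) (Complex.exp ((j * β * mollify X η' ε' y ω : ℝ) * Complex.I)) =
      Complex.exp ((k * β * mollify X η ε x ω - j * β * mollify X η' ε' y ω : ℝ) *
        Complex.I) := by
    intro ω
    rw [← Complex.exp_conj, ← Complex.exp_add, map_mul, Complex.conj_ofReal, Complex.conj_I]
    congr 1
    push_cast
    ring
  simp only [e4]
  rw [h]
  congr 2
  ring

/-- The exponential factor in the mixed second moments of the waves. -/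
def momentFactor (P : Measure Ω) (X : Ω → (𝓢(Space d, ℝ) →L[ℝ] ℝ)) (η η' : Bump d)
    (β ε ε' : ℝ) (k j : ℤ) (x y : Space d) : ℝ :=
  Real.exp (β ^ 2 / 2 * ((1 - k ^ 2) * mollCov P X η η ε ε x x +
    (1 - j ^ 2) * mollCov P X η' η' ε' ε' y y + 2 * k * j * mollCov P X η η' ε ε' x y))

theorem measurable_momentFactor [SFinite P] (hX : IsLogCorrelatedField P U g X) (η η' : Bump d)
    (β ε ε' : ℝ) (k j : ℤ) : Measurable fun w : Space d × Space d =>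
      momentFactor P X η η' β ε ε' k j w.1 w.2 := by
  have h1 := (measurable_mollCov hX η η ε ε).comp
    (f := fun w : Space d × Space d => (w.1, w.1)) (by fun_prop)
  have h2 := (measurable_mollCov hX η' η' ε' ε').comp
    (f := fun w : Space d × Space d => (w.2, w.2)) (by fun_prop)
  have h3 := measurable_mollCov hX η η' ε ε'
  exact Real.measurable_exp.comp ((((h1.const_mul _).add (h2.const_mul _)).add
    (h3.const_mul _)).const_mul _)

/-- The mixed second moments of the modes: Fubini and the Gaussian characteristic function. -/
theorem integral_waveIntegral_mul_conj [IsProbabilityMeasure P]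
    (hX : IsLogCorrelatedField P U g X) (η η' : Bump d) (β : ℝ) {ε ε' : ℝ} {φ : Space d → ℂ}
    (hφ : Measurable φ) {B B' : ℝ} (hB : ∀ x, ‖waveWeight P X η β ε φ x‖ ≤ B)
    (hB' : ∀ x, ‖waveWeight P X η' β ε' φ x‖ ≤ B') (k j : ℤ) :
    ∫ ω, waveIntegral P U X η β ε φ k ω *
      (starRingEnd ℂ) (waveIntegral P U X η' β ε' φ j ω) ∂P =
    ∫ w, φ w.1 * (starRingEnd ℂ) (φ w.2) * (momentFactor P X η η' β ε ε' k j w.1 w.2 : ℝ)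
      ∂((volume.restrict (U : Set (Space d))).prod (volume.restrict (U : Set (Space d)))) := by
  have : IsFiniteMeasure (volume.restrict (U : Set (Space d))) :=
    ⟨by simpa using hX.kernel.bounded.measure_lt_top⟩
  obtain ⟨F, hF, hFn, hFX⟩ := exists_measurable_wave hX η β ε hφ k
  obtain ⟨G, hG, hGn, hGX⟩ := exists_measurable_wave hX η' β ε' hφ j
  have h := integral_mul_conj_integral (P := P) (μ := volume.restrict (U : Set (Space d)))
    hF hG (B := B) (B' := B') (fun x ω => (hFn x ω).trans_le (hB x))
    (fun x ω => (hGn x ω).trans_le (hB' x))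
  have h1 : ∫ ω, waveIntegral P U X η β ε φ k ω *
      (starRingEnd ℂ) (waveIntegral P U X η' β ε' φ j ω) ∂P =
      ∫ ω, (∫ x in (U : Set (Space d)), F x ω) *
        (starRingEnd ℂ) (∫ y in (U : Set (Space d)), G y ω) ∂P := by
    refine integral_congr_ae ?_
    filter_upwards [hFX, hGX] with ω e e'
    simp only [e, e', waveIntegral]
  rw [h1, h]
  refine integral_congr_ae (ae_of_all _ fun w => ?_)
  simp only
  have h2 : ∫ ω, F w.1 ω * (starRingEnd ℂ) (G w.2 ω) ∂P =
      (waveWeight P X η β ε φ w.1 * (starRingEnd ℂ) (waveWeight P X η' β ε' φ w.2)) *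
      ∫ ω, Complex.exp ((k * β * mollify X η ε w.1 ω : ℝ) * Complex.I) *
      (starRingEnd ℂ) (Complex.exp ((j * β * mollify X η' ε' w.2 ω : ℝ) * Complex.I)) ∂P := by
    rw [← integral_const_mul]
    refine integral_congr_ae ?_
    filter_upwards [hFX, hGX] with ω e e'
    rw [e, e', map_mul]
    ring
  rw [h2, integral_cexp_pair hX, waveWeight, waveWeight, map_mul, Complex.conj_ofReal]
  have h3 : momentFactor P X η η' β ε ε' k j w.1 w.2 =
      Real.exp (β ^ 2 / 2 * mollCov P X η η ε ε w.1 w.1) *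
      Real.exp (β ^ 2 / 2 * mollCov P X η' η' ε' ε' w.2 w.2) *
      Real.exp (-(β ^ 2 / 2) * (k ^ 2 * mollCov P X η η ε ε w.1 w.1 +
      j ^ 2 * mollCov P X η' η' ε' ε' w.2 w.2 - 2 * k * j * mollCov P X η η' ε ε' w.1 w.2)) := by
    rw [← Real.exp_add, ← Real.exp_add, momentFactor]
    congr 1
    ring
  rw [h3]
  push_cast
  ring

end Waves

/-! ### The random generalized function `cos (β X)` -/

theorem nonempty_bump (d : ℕ) : Nonempty (Bump d) := by
  set f : Space d → ℝ := fun x => Real.smoothTransition (1 / 2 - ‖x‖ ^ 2) with hf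
  have hfs : ContDiff ℝ (⊤ : ℕ∞) f :=
    Real.smoothTransition.contDiff.comp (contDiff_const.sub (contDiff_norm_sq ℝ))
  have hf0 : ∀ x, 0 ≤ f x := fun x => Real.smoothTransition.nonneg _
  have hz : ∀ x, 3 / 4 < ‖x‖ → f x = 0 := fun x hx =>
    Real.smoothTransition.zero_of_nonpos (by nlinarith)
  have hsupp : tsupport f ⊆ Metric.closedBall 0 (3 / 4) := by
    refine closure_minimal (fun x hx => ?_) Metric.isClosed_closedBall
    by_contra h
    rw [mem_closedBall_zero_iff, not_le] at h
    exact hx (hz x h)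
  have hc : HasCompactSupport f :=
    HasCompactSupport.of_support_subset_isCompact (isCompact_closedBall 0 (3 / 4))
      ((subset_tsupport _).trans hsupp)
  have hpos : 0 < ∫ x, f x := by
    refine hfs.continuous.integral_pos_of_hasCompactSupport_nonneg_nonzero hc hf0 (x := 0) ?_
    exact (Real.smoothTransition.pos_of_pos (by simp)).ne'
  refine ⟨⟨fun x => (∫ x, f x)⁻¹ * f x, contDiff_const.mul hfs,
    fun x => mul_nonneg (inv_nonneg.2 hpos.le) (hf0 x), fun x y hxy => by simp [hf, hxy], ?_, ?_⟩⟩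
  · rw [integral_const_mul, inv_mul_cancel₀ hpos.ne']
  · refine (closure_mono fun x hx => ?_).trans (hsupp.trans (Metric.closedBall_subset_ball
      (by norm_num)))
    exact right_ne_zero_of_mul hx

section Cosine

variable {d : ℕ} {Ω : Type*} [MeasurableSpace Ω] {P : Measure Ω} {U : Opens (Space d)}
  {g : Space d → Space d → ℝ} {X : Ω → (𝓢(Space d, ℝ) →L[ℝ] ℝ)}

theorem exists_waveWeight_bound [NeZero d] (hX : IsLogCorrelatedField P U g X) (η : Bump d)
    (β : ℝ) (φ : 𝓓(U, ℂ)) :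
    ∃ ε₀ > 0, ∀ ε, 0 < ε → ε ≤ ε₀ → ∃ B : ℝ, ∀ x, ‖waveWeight P X η β ε φ x‖ ≤ B := by
  obtain ⟨ε₀, hε₀, C, -, hC⟩ := exists_mollCov_bounds hX φ.hasCompactSupport.isCompact
    φ.tsupport_subset η η
  obtain ⟨M, hM⟩ := φ.hasCompactSupport.exists_bound_of_continuous φ.continuous
  exact ⟨ε₀, hε₀, fun ε h1 h2 => ⟨_, norm_waveWeight_le P X η β ε hM fun x hx =>
    (hC ε ε h1 h2 h1 h2 x hx x hx).2.1⟩⟩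

theorem exp_mul_neg_log_add {r : ℝ} (hr : 0 < r) (b C : ℝ) :
    Real.exp (b * (-Real.log r + C)) = Real.exp (b * C) * r ^ (-b) := by
  rw [Real.rpow_def_of_pos hr, ← Real.exp_add]
  congr 1
  ring

/-- The mixed second moments of `e^{± i β X}` at two vanishing scales have a limit that does not
depend on the mollifiers. -/
theorem tendsto_integral_waveIntegral_mul_conj [NeZero d] [IsProbabilityMeasure P]
    (hX : IsLogCorrelatedField P U g X) {β : ℝ} (hβd : β ^ 2 < d) (φ : 𝓓(U, ℂ))
    (η η' : Bump d) {k : ℤ} (hk : (k : ℝ) ^ 2 = 1) {ι : Type*} {l : Filter ι}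
    [l.IsCountablyGenerated] {e e' : ι → ℝ} (he : ∀ᶠ i in l, 0 < e i)
    (he' : ∀ᶠ i in l, 0 < e' i) (h : Tendsto e l (𝓝 0)) (h' : Tendsto e' l (𝓝 0)) :
    Tendsto (fun i => ∫ ω, waveIntegral P U X η β (e i) φ k ω *
      (starRingEnd ℂ) (waveIntegral P U X η' β (e' i) φ k ω) ∂P) l
      (𝓝 (∫ w, φ w.1 * (starRingEnd ℂ) (φ w.2) *
        (Real.exp (β ^ 2 * (-Real.log ‖w.1 - w.2‖ + g w.1 w.2)) : ℝ)
        ∂((volume.restrict (U : Set (Space d))).prod (volume.restrict (U : Set (Space d)))))) := by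
  obtain ⟨ε₁, hε₁, hw₁⟩ := exists_waveWeight_bound hX η β φ
  obtain ⟨ε₂, hε₂, hw₂⟩ := exists_waveWeight_bound hX η' β φ
  obtain ⟨ε₀, hε₀, C, hC0, hC⟩ := exists_mollCov_bounds hX φ.hasCompactSupport.isCompact
    φ.tsupport_subset η η'
  obtain ⟨M, hM⟩ := φ.hasCompactSupport.exists_bound_of_continuous φ.continuous
  have hM0 : 0 ≤ M := (norm_nonneg _).trans (hM 0)
  have hfac : ∀ (i : ι) (x y : Space d), momentFactor P X η η' β (e i) (e' i) k k x y =
      Real.exp (β ^ 2 * mollCov P X η η' (e i) (e' i) x y) := by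
    intro i x y
    rw [momentFactor]
    congr 1
    linear_combination (β ^ 2 / 2 * (-mollCov P X η η (e i) (e i) x x -
      mollCov P X η' η' (e' i) (e' i) y y + 2 * mollCov P X η η' (e i) (e' i) x y)) * hk
  have hev : ∀ᶠ i in l, 0 < e i ∧ e i ≤ ε₀ ∧ e i ≤ ε₁ ∧ 0 < e' i ∧ e' i ≤ ε₀ ∧ e' i ≤ ε₂ := by
    filter_upwards [he, he', h.eventually_lt_const hε₀, h'.eventually_lt_const hε₀,
      h.eventually_lt_const hε₁, h'.eventually_lt_const hε₂] with i a a' b b' c c'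
    exact ⟨a, b.le, c.le, a', b'.le, c'.le⟩
  have hmain : Tendsto (fun i => ∫ w, φ w.1 * (starRingEnd ℂ) (φ w.2) *
      (momentFactor P X η η' β (e i) (e' i) k k w.1 w.2 : ℝ)
      ∂((volume.restrict (U : Set (Space d))).prod (volume.restrict (U : Set (Space d))))) l
      (𝓝 (∫ w, φ w.1 * (starRingEnd ℂ) (φ w.2) *
        (Real.exp (β ^ 2 * (-Real.log ‖w.1 - w.2‖ + g w.1 w.2)) : ℝ)
        ∂((volume.restrict (U : Set (Space d))).prod
          (volume.restrict (U : Set (Space d)))))) := by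
    refine tendsto_integral_filter_of_dominated_convergence
      (fun w => M * M * (Real.exp (β ^ 2 * C) * ‖w.1 - w.2‖ ^ (-(β ^ 2)))) ?_ ?_ ?_ ?_
    · refine Eventually.of_forall fun i => ?_
      have h1 := measurable_momentFactor hX η η' β (e i) (e' i) k k
      have h2 : Measurable fun w : Space d × Space d => φ w.1 :=
        φ.continuous.measurable.comp measurable_fst
      have h3 : Measurable fun w : Space d × Space d => (starRingEnd ℂ) (φ w.2) :=
        Complex.continuous_conj.measurable.comp (φ.continuous.measurable.comp measurable_snd)
      exact ((h2.mul h3).mul (Complex.measurable_ofReal.comp h1)).aestronglyMeasurable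
    · filter_upwards [hev] with i ⟨a, b, _, a', b', _⟩
      filter_upwards [ae_fst_ne_snd (U : Set (Space d))] with w hw
      by_cases hx : w.1 ∈ tsupport φ
      · by_cases hy : w.2 ∈ tsupport φ
        · rw [hfac, norm_mul, norm_mul, RCLike.norm_conj, Complex.norm_real, Real.norm_eq_abs,
            Real.abs_exp, ← exp_mul_neg_log_add (norm_pos_iff.2 (sub_ne_zero.2 hw))]
          gcongr
          · exact hM _
          · exact hM _
          · exact (hC _ _ a b a' b' _ hx _ hy).1 hw
        · rw [image_eq_zero_of_notMem_tsupport hy]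
          simp only [map_zero, mul_zero, zero_mul, norm_zero]
          positivity
      · rw [image_eq_zero_of_notMem_tsupport hx]
        simp only [zero_mul, norm_zero]
        positivity
    · exact ((integrable_norm_sub_rpow_neg U.isOpen.measurableSet hX.kernel.bounded
        hβd).const_mul _).const_mul _
    · filter_upwards [ae_fst_ne_snd (U : Set (Space d))] with w hw
      by_cases hx : w.1 ∈ tsupport φ
      · by_cases hy : w.2 ∈ tsupport φ
        · have := tendsto_mollCov hX η η' he he' h h' (φ.tsupport_subset hx)
            (φ.tsupport_subset hy) hw
          simp only [hfac]
          refine Tendsto.const_mul _ ?_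
          refine (Complex.continuous_ofReal.tendsto _).comp ?_
          exact (Real.continuous_exp.tendsto _).comp (this.const_mul _)
        · rw [image_eq_zero_of_notMem_tsupport hy]
          simp only [map_zero, mul_zero, zero_mul]
          exact tendsto_const_nhds
      · rw [image_eq_zero_of_notMem_tsupport hx]
        simp only [zero_mul]
        exact tendsto_const_nhds
  refine hmain.congr' ?_
  filter_upwards [hev] with i ⟨a, b, c, a', b', c'⟩
  obtain ⟨B, hB⟩ := hw₁ _ a c
  obtain ⟨B', hB'⟩ := hw₂ _ a' c'
  exact (integral_waveIntegral_mul_conj hX η η' β φ.continuous.measurable hB hB' k k).symm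

theorem eLpNorm_two_eq_sqrt {f : Ω → ℂ} (hf : MemLp f 2 P) :
    eLpNorm f 2 P = ENNReal.ofReal (Real.sqrt (∫ ω, ‖f ω‖ ^ 2 ∂P)) := by
  rw [hf.eLpNorm_eq_integral_rpow_norm (by norm_num) (by norm_num), Real.sqrt_eq_rpow]
  simp

theorem integral_norm_sub_sq {a b : Ω → ℂ} (ha : MemLp a 2 P) (hb : MemLp b 2 P) :
    ((∫ ω, ‖(a - b) ω‖ ^ 2 ∂P : ℝ) : ℂ) =
      ∫ ω, a ω * (starRingEnd ℂ) (a ω) ∂P - ∫ ω, a ω * (starRingEnd ℂ) (b ω) ∂P -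
      ∫ ω, b ω * (starRingEnd ℂ) (a ω) ∂P + ∫ ω, b ω * (starRingEnd ℂ) (b ω) ∂P := by
  have ic : ∀ {a b : Ω → ℂ}, MemLp a 2 P → MemLp b 2 P →
      Integrable (fun ω => a ω * (starRingEnd ℂ) (b ω)) P :=
    fun ha hb => ha.integrable_mul hb.star
  have i1 : Integrable (fun ω => a ω * (starRingEnd ℂ) (a ω) - a ω * (starRingEnd ℂ) (b ω)) P :=
    (ic ha ha).sub (ic ha hb)
  have i2 : Integrable (fun ω => a ω * (starRingEnd ℂ) (a ω) - a ω * (starRingEnd ℂ) (b ω) -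
      b ω * (starRingEnd ℂ) (a ω)) P := i1.sub (ic hb ha)
  rw [← integral_sub (ic ha ha) (ic ha hb), ← integral_sub i1 (ic hb ha),
    ← integral_add i2 (ic hb hb)]
  refine Eq.trans (integral_ofReal (𝕜 := ℂ)).symm ?_
  refine integral_congr_ae (ae_of_all _ fun ω => ?_)
  change ((‖a ω - b ω‖ ^ 2 : ℝ) : ℂ) = _
  push_cast
  rw [← Complex.mul_conj', map_sub]
  ring

theorem memLp_waveIntegral [IsProbabilityMeasure P] (hX : IsLogCorrelatedField P U g X)
    (η : Bump d) (β ε : ℝ) {φ : Space d → ℂ} (hφ : Measurable φ) {B : ℝ}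
    (hB : ∀ x, ‖waveWeight P X η β ε φ x‖ ≤ B) (k : ℤ) :
    MemLp (waveIntegral P U X η β ε φ k) 2 P :=
  MemLp.of_bound (aestronglyMeasurable_waveIntegral hX η β ε hφ k) _
    (ae_of_all _ (norm_waveIntegral_le hX η β ε hB k))

theorem tendsto_eLpNorm_waveIntegral_sub [NeZero d] [IsProbabilityMeasure P]
    (hX : IsLogCorrelatedField P U g X) {β : ℝ} (hβd : β ^ 2 < d) (φ : 𝓓(U, ℂ))
    (η η' : Bump d) {k : ℤ} (hk : (k : ℝ) ^ 2 = 1) {ι : Type*} {l : Filter ι}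
    [l.IsCountablyGenerated] {e e' : ι → ℝ} (he : ∀ᶠ i in l, 0 < e i)
    (he' : ∀ᶠ i in l, 0 < e' i) (h : Tendsto e l (𝓝 0)) (h' : Tendsto e' l (𝓝 0)) :
    Tendsto (fun i => eLpNorm (waveIntegral P U X η β (e i) φ k -
      waveIntegral P U X η' β (e' i) φ k) 2 P) l (𝓝 0) := by
  obtain ⟨ε₁, hε₁, hw₁⟩ := exists_waveWeight_bound hX η β φ
  obtain ⟨ε₂, hε₂, hw₂⟩ := exists_waveWeight_bound hX η' β φ
  have hev : ∀ᶠ i in l, MemLp (waveIntegral P U X η β (e i) φ k) 2 P ∧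
      MemLp (waveIntegral P U X η' β (e' i) φ k) 2 P := by
    filter_upwards [he, he', h.eventually_lt_const hε₁, h'.eventually_lt_const hε₂]
      with i a a' c c'
    obtain ⟨B, hB⟩ := hw₁ _ a c.le
    obtain ⟨B', hB'⟩ := hw₂ _ a' c'.le
    exact ⟨memLp_waveIntegral hX η β _ φ.continuous.measurable hB k,
      memLp_waveIntegral hX η' β _ φ.continuous.measurable hB' k⟩
  have t11 := tendsto_integral_waveIntegral_mul_conj hX hβd φ η η hk he he h h
  have t12 := tendsto_integral_waveIntegral_mul_conj hX hβd φ η η' hk he he' h h'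
  have t21 := tendsto_integral_waveIntegral_mul_conj hX hβd φ η' η hk he' he h' h
  have t22 := tendsto_integral_waveIntegral_mul_conj hX hβd φ η' η' hk he' he' h' h'
  have ht := ((t11.sub t12).sub t21).add t22
  have hc : Tendsto (fun i => ((∫ ω, ‖(waveIntegral P U X η β (e i) φ k -
      waveIntegral P U X η' β (e' i) φ k) ω‖ ^ 2 ∂P : ℝ) : ℂ)) l (𝓝 0) := by
    have h0 : ∀ z : ℂ, z - z - z + z = 0 := fun z => by ring
    rw [h0] at ht
    refine ht.congr' ?_
    filter_upwards [hev] with i ⟨m1, m2⟩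
    exact (integral_norm_sub_sq m1 m2).symm
  have hr : Tendsto (fun i => ∫ ω, ‖(waveIntegral P U X η β (e i) φ k -
      waveIntegral P U X η' β (e' i) φ k) ω‖ ^ 2 ∂P) l (𝓝 0) := by
    exact (Complex.continuous_re.tendsto _).comp hc
  have hs : Tendsto (fun i => ENNReal.ofReal (Real.sqrt (∫ ω, ‖(waveIntegral P U X η β (e i) φ k -
      waveIntegral P U X η' β (e' i) φ k) ω‖ ^ 2 ∂P))) l (𝓝 0) := by
    have := ENNReal.tendsto_ofReal ((Real.continuous_sqrt.tendsto _).comp hr)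
    simpa using this
  refine hs.congr' ?_
  filter_upwards [hev] with i ⟨m1, m2⟩
  exact (eLpNorm_two_eq_sqrt (m1.sub m2)).symm

/-- The imaginary multiplicative chaos `e^{± i β X}`, tested against `φ`. -/
theorem exists_waveIntegral_limit [NeZero d] [IsProbabilityMeasure P]
    (hX : IsLogCorrelatedField P U g X) {β : ℝ} (hβd : β ^ 2 < d) (φ : 𝓓(U, ℂ))
    {k : ℤ} (hk : (k : ℝ) ^ 2 = 1) :
    ∃ W : Ω → ℂ, MemLp W 2 P ∧ ∀ (η : Bump d) (c : ℕ → ℝ), (∀ n, 0 < c n) →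
      Tendsto c atTop (𝓝 0) →
      Tendsto (fun n => eLpNorm (waveIntegral P U X η β (c n) φ k - W) 2 P) atTop (𝓝 0) := by
  obtain ⟨η₀⟩ := nonempty_bump d
  obtain ⟨ε₁, hε₁, hw₁⟩ := exists_waveWeight_bound hX η₀ β φ
  set s : ℕ → ℝ := fun n => ε₁ * (1 / ((n : ℝ) + 1)) with hs
  have hs0 : ∀ n, 0 < s n := fun n => by positivity
  have hs1 : ∀ n, s n ≤ ε₁ := fun n => by
    have : 1 / ((n : ℝ) + 1) ≤ 1 := by
      rw [div_le_one (by positivity)]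
      linarith [(Nat.cast_nonneg n : (0 : ℝ) ≤ n)]
    nlinarith
  have hst : Tendsto s atTop (𝓝 0) := by
    simpa [hs] using (tendsto_one_div_add_atTop_nhds_zero_nat (𝕜 := ℝ)).const_mul ε₁
  have hmem : ∀ n, MemLp (waveIntegral P U X η₀ β (s n) φ k) 2 P := fun n => by
    obtain ⟨B, hB⟩ := hw₁ _ (hs0 n) (hs1 n)
    exact memLp_waveIntegral hX η₀ β _ φ.continuous.measurable hB k
  have hcau : CauchySeq fun n => (hmem n).toLp := by
    rw [cauchySeq_iff_tendsto_dist_atTop_0]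
    rw [← prod_atTop_atTop_eq]
    have h1 : Tendsto (fun p : ℕ × ℕ => s p.1) (atTop ×ˢ atTop) (𝓝 0) := hst.comp tendsto_fst
    have h2 : Tendsto (fun p : ℕ × ℕ => s p.2) (atTop ×ˢ atTop) (𝓝 0) := hst.comp tendsto_snd
    have h3 := tendsto_eLpNorm_waveIntegral_sub hX hβd φ η₀ η₀ hk
      (Eventually.of_forall fun p : ℕ × ℕ => hs0 p.1) (Eventually.of_forall fun p => hs0 p.2) h1 h2
    have h4 := (ENNReal.tendsto_toReal ENNReal.zero_ne_top).comp h3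
    refine h4.congr fun p => ?_
    rw [Lp.dist_def]
    simp only [Function.comp]
    congr 1
    refine eLpNorm_congr_ae ?_
    exact (((hmem p.1).coeFn_toLp).sub (hmem p.2).coeFn_toLp).symm
  obtain ⟨W, hW⟩ := cauchySeq_tendsto_of_complete hcau
  have hWt : Tendsto (fun n => eLpNorm (waveIntegral P U X η₀ β (s n) φ k - (W : Ω → ℂ)) 2 P)
      atTop (𝓝 0) := by
    have := (Lp.tendsto_Lp_iff_tendsto_eLpNorm' _ _).1 hW
    refine this.congr fun n => eLpNorm_congr_ae ?_
    exact ((hmem n).coeFn_toLp).sub (ae_eq_refl _)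
  refine ⟨(W : Ω → ℂ), Lp.memLp W, fun η c hc hct => ?_⟩
  have h1 := tendsto_eLpNorm_waveIntegral_sub hX hβd φ η η₀ hk
    (Eventually.of_forall hc) (Eventually.of_forall hs0) hct hst
  have h2 := h1.add hWt
  rw [add_zero] at h2
  refine tendsto_of_tendsto_of_tendsto_of_le_of_le tendsto_const_nhds h2 (fun n => zero_le)
    fun n => ?_
  have e : waveIntegral P U X η β (c n) φ k - (W : Ω → ℂ) =
      (waveIntegral P U X η β (c n) φ k - waveIntegral P U X η₀ β (s n) φ k) +
      (waveIntegral P U X η₀ β (s n) φ k - (W : Ω → ℂ)) := by abel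
  simp only
  rw [e]
  refine eLpNorm_add_le ?_ ((hmem n).aestronglyMeasurable.sub (Lp.aestronglyMeasurable W))
    (by norm_num)
  exact (aestronglyMeasurable_waveIntegral hX η β _ φ.continuous.measurable k).sub
    (hmem n).aestronglyMeasurable

theorem integrableOn_wave (hX : IsLogCorrelatedField P U g X) [SFinite P] (η : Bump d)
    (β ε : ℝ) {φ : Space d → ℂ} (hφ : Measurable φ) {B : ℝ}
    (hB : ∀ x, ‖waveWeight P X η β ε φ x‖ ≤ B) (k : ℤ) (ω : Ω) :
    IntegrableOn (fun x => waveWeight P X η β ε φ x *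
      Complex.exp ((k * β * mollify X η ε x ω : ℝ) * Complex.I)) (U : Set (Space d)) := by
  have : IsFiniteMeasure (volume.restrict (U : Set (Space d))) :=
    ⟨by simpa using hX.kernel.bounded.measure_lt_top⟩
  refine Integrable.of_bound (C := B) (Measurable.aestronglyMeasurable ?_) (ae_of_all _ fun x => ?_)
  · refine (measurable_waveWeight hX η β ε hφ).mul (Complex.measurable_exp.comp ?_)
    have := (continuous_mollify X η ε ω).measurable
    exact (Complex.measurable_ofReal.comp (this.const_mul _)).mul_const _
  · rw [norm_mul, norm_cexp_real_mul_I, mul_one]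
    exact hB x

theorem renormIntegral_cos_eq (hX : IsLogCorrelatedField P U g X) [SFinite P] (η : Bump d)
    (β ε : ℝ) {φ : Space d → ℂ} (hφ : Measurable φ) {B : ℝ}
    (hB : ∀ x, ‖waveWeight P X η β ε φ x‖ ≤ B) :
    renormIntegral P U X η β ε (fun t => Real.cos (β * t)) φ =
      (1 / 2 : ℂ) • (waveIntegral P U X η β ε φ 1 + waveIntegral P U X η β ε φ (-1)) := by
  funext ω
  simp only [Pi.smul_apply, Pi.add_apply, waveIntegral, renormIntegral]
  rw [← integral_add (integrableOn_wave hX η β ε hφ hB 1 ω)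
    (integrableOn_wave hX η β ε hφ hB (-1) ω), ← integral_smul]
  refine integral_congr_ae (ae_of_all _ fun x => ?_)
  simp only [renormIntegrand_eq, smul_eq_mul]
  rw [Complex.ofReal_cos, Complex.cos]
  push_cast
  ring_nf

end Cosine

/-! ### Approximation by trigonometric polynomials in `L¹` -/

section Circle

open AddCircle

theorem norm_fourier_apply {T : ℝ} (n : ℤ) (z : AddCircle T) : ‖fourier n z‖ = 1 := by
  rw [fourier_apply, Circle.norm_coe]

theorem continuous_trigSum {T : ℝ} (s : Finset ℤ) (t : ℤ → ℂ) :
    Continuous fun z : AddCircle T => ∑ k ∈ s, t k * fourier k z :=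
  continuous_finsetSum _ fun k _ => continuous_const.mul (fourier k).continuous

variable {T : ℝ} [hT : Fact (0 < T)]

theorem norm_fourierCoeff_le {f : AddCircle T → ℂ} (n : ℤ) :
    ‖fourierCoeff f n‖ ≤ ∫ z, ‖f z‖ ∂haarAddCircle := by
  refine (norm_integral_le_integral_norm _).trans (le_of_eq ?_)
  refine integral_congr_ae (ae_of_all _ fun z => ?_)
  simp only [norm_smul]
  rw [fourier_apply, Circle.norm_coe, one_mul]

theorem integrable_of_continuous_circle {f : AddCircle T → ℂ} (hf : Continuous f) :
    Integrable f haarAddCircle :=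
  hf.integrable_of_hasCompactSupport (HasCompactSupport.of_compactSpace f)

theorem fourierCoeff_sub {f h : AddCircle T → ℂ} (hf : Integrable f haarAddCircle)
    (hh : Integrable h haarAddCircle) (n : ℤ) :
    fourierCoeff (fun z => f z - h z) n = fourierCoeff f n - fourierCoeff h n := by
  unfold fourierCoeff
  rw [← integral_sub (hf.fourier_smul _) (hh.fourier_smul _)]
  simp only [smul_sub]

theorem fourierCoeff_trigSum (s : Finset ℤ) (t : ℤ → ℂ) (n : ℤ) :
    fourierCoeff (fun z : AddCircle T => ∑ k ∈ s, t k * fourier k z) n =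
      if n ∈ s then t n else 0 := by
  have hsum : (fun z : AddCircle T => ∑ k ∈ s, t k * fourier k z) =
      ∑ k ∈ s, fun z : AddCircle T => t k * fourier k z := by
    ext z; simp
  rw [hsum, fourierCoeff.sum s (fun k (z : AddCircle T) => t k * fourier k z)]
  · have h : ∀ k, fourierCoeff (fun z : AddCircle T => t k * fourier k z) n =
        if n = k then t k else 0 := by
      intro k
      rw [fourierCoeff.const_mul, fourierCoeff_fourier]
      by_cases hnk : n = k
      · subst hnk; simp
      · simp [hnk]
    rw [Finset.sum_apply, Finset.sum_congr rfl fun k _ => h k, Finset.sum_ite_eq]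
  · exact fun k _ => integrable_of_continuous_circle
      (continuous_const.mul (fourier k).continuous)

theorem exists_trigSum_approx {f : AddCircle T → ℂ} (hf : Integrable f haarAddCircle) {δ : ℝ}
    (hδ : 0 < δ) : ∃ (s : Finset ℤ) (t : ℤ → ℂ),
      ∫ z, ‖f z - ∑ k ∈ s, t k * fourier k z‖ ∂haarAddCircle < δ := by
  have hf1 : MemLp f 1 haarAddCircle := memLp_one_iff_integrable.2 hf
  have hmem : hf1.toLp ∈ (Submodule.span ℂ
      (Set.range (@fourierLp T _ 1 _))).topologicalClosure := by
    rw [span_fourierLp_closure_eq_top (by norm_num)]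
    exact Submodule.mem_top
  obtain ⟨q, hq, hqd⟩ := Metric.mem_closure_iff.1 hmem δ hδ
  obtain ⟨c, rfl⟩ := Finsupp.mem_span_range_iff_exists_finsupp.1 hq
  refine ⟨c.support, c, ?_⟩
  rw [dist_eq_norm, L1.norm_eq_integral_norm] at hqd
  refine lt_of_le_of_lt (le_of_eq ?_) hqd
  refine integral_congr_ae ?_
  have h1 : ∀ᵐ z ∂(haarAddCircle (T := T)), ∀ k, @fourierLp T _ 1 _ k z = fourier k z :=
    ae_all_iff.2 fun k => coeFn_fourierLp 1 k
  have h2 : ((c.sum fun i a => a • @fourierLp T _ 1 _ i : Lp ℂ 1 haarAddCircle) :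
      AddCircle T → ℂ) =ᵐ[haarAddCircle] fun z => ∑ k ∈ c.support, c k * fourier k z := by
    have h3 : ∀ s : Finset ℤ, ((∑ k ∈ s, c k • @fourierLp T _ 1 _ k : Lp ℂ 1 haarAddCircle) :
        AddCircle T → ℂ) =ᵐ[haarAddCircle] fun z => ∑ k ∈ s, c k * fourier k z := by
      classical
      intro s
      induction s using Finset.induction_on with
      | empty =>
        simp only [Finset.sum_empty]
        exact Lp.coeFn_zero ℂ 1 haarAddCircle
      | insert k s hk ih =>
        rw [Finset.sum_insert hk]
        filter_upwards [Lp.coeFn_add (c k • @fourierLp T _ 1 _ k)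
          (∑ k ∈ s, c k • @fourierLp T _ 1 _ k), ih, Lp.coeFn_smul (c k) (@fourierLp T _ 1 _ k),
          h1] with z e1 e2 e3 e4
        rw [e1, Pi.add_apply, e2, e3, Pi.smul_apply, e4, Finset.sum_insert hk, smul_eq_mul]
    exact h3 c.support
  filter_upwards [Lp.coeFn_sub hf1.toLp (c.sum fun i a => a • @fourierLp T _ 1 _ i),
    hf1.coeFn_toLp, h2] with z e1 e2 e3
  rw [e1, Pi.sub_apply, e2, e3]

/-- The partial Fourier sum of order one. -/
def lowModes (f : AddCircle T → ℂ) (z : AddCircle T) : ℂ :=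
  ∑ k ∈ Finset.Icc (-1 : ℤ) 1, fourierCoeff f k * fourier k z

theorem continuous_lowModes (f : AddCircle T → ℂ) : Continuous (lowModes f) :=
  continuous_trigSum _ _

/-- An integrable function is, up to its lowest modes, an `L¹` limit of trigonometric polynomials
with bounded coefficients. -/
theorem exists_bounded_trigSum_approx {f : AddCircle T → ℂ} (hf : Integrable f haarAddCircle) :
    ∃ M : ℝ, ∀ δ > 0, ∃ (s : Finset ℤ) (t : ℤ → ℂ), (∀ k ∈ s, 2 ≤ |k|) ∧ (∀ k ∈ s, ‖t k‖ ≤ M) ∧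
      ∫ z, ‖f z - lowModes f z - ∑ k ∈ s, t k * fourier k z‖ ∂haarAddCircle ≤ δ := by
  classical
  refine ⟨(∫ z, ‖f z‖ ∂haarAddCircle) + 1, fun δ hδ => ?_⟩
  set δ' : ℝ := min 1 (δ / 4) with hδ'
  have hδ'0 : 0 < δ' := lt_min one_pos (by positivity)
  obtain ⟨s, t, hst⟩ := exists_trigSum_approx hf hδ'0
  set p : AddCircle T → ℂ := fun z => ∑ k ∈ s, t k * fourier k z with hp
  have hpi : Integrable p haarAddCircle := integrable_of_continuous_circle (continuous_trigSum s t)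
  have hcoeff : ∀ k, ‖fourierCoeff f k - fourierCoeff p k‖ ≤ δ' := fun k => by
    rw [← fourierCoeff_sub hf hpi]
    exact (norm_fourierCoeff_le k).trans hst.le
  refine ⟨s.filter fun k => 2 ≤ |k|, t, fun k hk => (Finset.mem_filter.1 hk).2, fun k hk => ?_, ?_⟩
  · have h1 : fourierCoeff p k = t k := by
      rw [hp, fourierCoeff_trigSum, if_pos (Finset.mem_filter.1 hk).1]
    have h2 := hcoeff k
    rw [h1] at h2
    have h3 := norm_sub_norm_le (t k) (fourierCoeff f k)
    rw [norm_sub_rev] at h3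
    have h4 := norm_fourierCoeff_le (f := f) k
    have h5 : δ' ≤ 1 := min_le_left _ _
    linarith
  · -- The low modes of the approximating polynomial are replaced by those of `f`.
    have hsplit : ∀ z, ∑ k ∈ s with 2 ≤ |k|, t k * fourier k z =
        p z - ∑ k ∈ Finset.Icc (-1 : ℤ) 1, fourierCoeff p k * fourier k z := by
      intro z
      have h1 : ∀ k, fourierCoeff p k * fourier k z =
          if k ∈ s then t k * fourier k z else 0 := by
        intro k
        rw [hp, fourierCoeff_trigSum]
        split_ifs <;> simp
      have h2 : p z = ∑ k ∈ s, t k * fourier k z := rfl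
      simp only [h1]
      rw [h2, ← Finset.sum_filter, ← Finset.sum_filter_add_sum_filter_not s (fun k => 2 ≤ |k|)
        (fun k => t k * fourier k z), eq_sub_iff_add_eq]
      congr 1
      refine Finset.sum_congr ?_ fun _ _ => rfl
      ext k
      simp only [Finset.mem_filter, Finset.mem_Icc, not_le]
      rw [← abs_le, ← Int.lt_add_one_iff (a := |k|) (b := 1)]
      exact and_comm
    have hpt : ∀ z, ‖f z - lowModes f z - ∑ k ∈ s with 2 ≤ |k|, t k * fourier k z‖ ≤
        ‖f z - p z‖ + 3 * δ' := by
      intro z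
      have h1 : f z - lowModes f z - ∑ k ∈ s with 2 ≤ |k|, t k * fourier k z =
          (f z - p z) - ∑ k ∈ Finset.Icc (-1 : ℤ) 1,
            (fourierCoeff f k - fourierCoeff p k) * fourier k z := by
        rw [hsplit, lowModes]
        simp only [sub_mul, Finset.sum_sub_distrib]
        ring
      rw [h1]
      refine (norm_sub_le _ _).trans (add_le_add le_rfl ?_)
      refine (norm_sum_le _ _).trans ?_
      calc _ ≤ ∑ _k ∈ Finset.Icc (-1 : ℤ) 1, δ' := by
            refine Finset.sum_le_sum fun k _ => ?_
            rw [norm_mul, norm_fourier_apply, mul_one]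
            exact hcoeff k
        _ = 3 * δ' := by simp
    have i1 : Integrable (fun z => ‖f z - p z‖) haarAddCircle := (hf.sub hpi).norm
    calc _ ≤ ∫ z, (‖f z - p z‖ + 3 * δ') ∂haarAddCircle := by
          refine integral_mono ?_ (i1.add (integrable_const _)) hpt
          exact ((hf.sub (integrable_of_continuous_circle (continuous_lowModes f))).sub
            (integrable_of_continuous_circle (continuous_trigSum _ t))).norm
      _ = ∫ z, ‖f z - p z‖ ∂haarAddCircle + 3 * δ' := by
          rw [integral_add i1 (integrable_const _)]; simp
      _ ≤ δ := by
          have : δ' ≤ δ / 4 := min_le_right _ _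
          linarith

/-- An integrable function on the circle whose Fourier coefficients all vanish is zero. -/
theorem ae_eq_zero_of_fourierCoeff_eq_zero {f : AddCircle T → ℂ}
    (hf : Integrable f haarAddCircle) (h0 : ∀ n, fourierCoeff f n = 0) :
    ∀ᵐ x : ℝ, x ∈ Set.Ioo 0 T → f x = 0 := by
  have hT' : 0 < T := hT.out
  have key : ∀ G : C(AddCircle T, ℂ), ∫ z, G z * f z ∂haarAddCircle = 0 := by
    intro G
    have hint : ∀ G : C(AddCircle T, ℂ), Integrable (fun z => G z * f z) haarAddCircle := by
      intro G
      refine hf.bdd_mul (c := ‖G‖) G.continuous.aestronglyMeasurable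
        (ae_of_all _ fun z => G.norm_coe_le_norm z)
    have hG : G ∈ (Submodule.span ℂ (Set.range <| @fourier T)).topologicalClosure := by
      rw [span_fourier_closure_eq_top]
      exact Submodule.mem_top
    have hcl : IsClosed {G : C(AddCircle T, ℂ) | ∫ z, G z * f z ∂haarAddCircle = 0} := by
      refine isClosed_eq ?_ continuous_const
      rw [Metric.continuous_iff]
      intro G γ hγ
      set J : ℝ := ∫ z, ‖f z‖ ∂haarAddCircle with hJ
      have hJ0 : 0 ≤ J := integral_nonneg fun z => norm_nonneg _
      refine ⟨γ / (J + 1), by positivity, fun G' hG' => ?_⟩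
      rw [dist_eq_norm, ← integral_sub (hint G') (hint G)]
      calc _ ≤ ∫ z, ‖G' - G‖ * ‖f z‖ ∂haarAddCircle := by
            refine norm_integral_le_of_norm_le (hf.norm.const_mul _) (ae_of_all _ fun z => ?_)
            rw [← sub_mul, norm_mul]
            gcongr
            exact (G' - G).norm_coe_le_norm z
        _ = ‖G' - G‖ * J := integral_const_mul _ _
        _ ≤ γ / (J + 1) * J := by
            rw [dist_eq_norm] at hG'
            gcongr
        _ < γ := by
            rw [div_mul_eq_mul_div, div_lt_iff₀ (by positivity)]
            nlinarith
    refine closure_minimal (fun G hG => ?_) hcl hG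
    induction hG using Submodule.span_induction with
    | mem x hx =>
      obtain ⟨n, rfl⟩ := hx
      have := h0 (-n)
      simpa [fourierCoeff] using this
    | zero => simp
    | add x y _ _ hx hy =>
      simp only [Set.mem_ofPred_eq, ContinuousMap.add_apply, add_mul] at *
      rw [integral_add (hint x) (hint y), hx, hy, add_zero]
    | smul a x _ hx =>
      simp only [Set.mem_ofPred_eq, ContinuousMap.smul_apply, smul_mul_assoc] at *
      rw [integral_smul, hx, smul_zero]
  have hfv : Integrable f := by
    have := (memLp_haarAddCircle_iff (p := 1)).1 (memLp_one_iff_integrable.2 hf)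
    exact memLp_one_iff_integrable.1 this
  have hfr : IntegrableOn (fun x : ℝ => f x) (Set.Ioc 0 (0 + T)) :=
    (AddCircle.measurePreserving_mk T 0).integrable_comp_of_integrable hfv
  rw [zero_add] at hfr
  refine isOpen_Ioo.ae_eq_zero_of_integral_contDiff_smul_eq_zero
    ((hfr.mono_set Set.Ioo_subset_Ioc_self).locallyIntegrableOn) fun G hG hGc hGs => ?_
  have hz : ∀ x, x ∉ Set.Ioo 0 T → G x = 0 := fun x hx =>
    image_eq_zero_of_notMem_tsupport fun h => hx (hGs h)
  have hGcont : Continuous (AddCircle.liftIco T 0 fun x => ((G x : ℝ) : ℂ)) := by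
    refine AddCircle.liftIco_zero_continuous ?_ ?_
    · rw [hz 0 (by simp), hz T (by simp)]
    · exact (Complex.continuous_ofReal.comp hG.continuous).continuousOn
  have h1 := key ⟨_, hGcont⟩
  rw [integral_haarAddCircle, smul_eq_zero, inv_eq_zero] at h1
  have h2 := h1.resolve_left hT'.ne'
  rw [← AddCircle.integral_preimage T 0] at h2
  rw [zero_add] at h2
  have h3 : ∫ x, G x • f x = ∫ x in Set.Ioc 0 T, G x • f x := by
    rw [setIntegral_eq_integral_of_forall_compl_eq_zero]
    intro x hx
    rw [hz x fun h => hx (Set.Ioo_subset_Ioc_self h), zero_smul]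
  rw [h3, ← h2]
  refine setIntegral_congr_fun measurableSet_Ioc fun x hx => ?_
  simp only [ContinuousMap.coe_mk]
  rcases hx.2.lt_or_eq with h | h
  · rw [AddCircle.liftIco_coe_apply (by simpa using ⟨hx.1.le, h⟩)]
    simp
  · have e1 : G x = 0 := hz x (by simp [h])
    have e2 : AddCircle.liftIco T 0 (fun x => ((G x : ℝ) : ℂ)) x = 0 := by
      have : ((x : ℝ) : AddCircle T) = ((0 : ℝ) : AddCircle T) := by
        rw [h]; simp
      rw [this, AddCircle.liftIco_coe_apply (by simpa using hT'), hz 0 (by simp),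
        Complex.ofReal_zero]
    rw [e1, e2, zero_smul, zero_mul]

/-- If the Fourier series converges absolutely, the approximating polynomials can be taken to have
bounded sums of coefficients. -/
theorem exists_summable_trigSum_approx {f : AddCircle T → ℂ} (hf : Integrable f haarAddCircle)
    (hs : Summable fun n => ‖fourierCoeff f n‖) :
    ∃ M : ℝ, ∀ δ > 0, ∃ (s : Finset ℤ) (t : ℤ → ℂ), (∀ k ∈ s, 2 ≤ |k|) ∧
      ∑ k ∈ s, ‖t k‖ ≤ M ∧
      ∫ z, ‖f z - lowModes f z - ∑ k ∈ s, t k * fourier k z‖ ∂haarAddCircle ≤ δ := by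
  classical
  have hT' : 0 < T := hT.out
  have hsC : Summable fun n => fourierCoeff f n • (fourier n : C(AddCircle T, ℂ)) := by
    refine Summable.of_norm ?_
    simpa only [norm_smul, fourier_norm, mul_one] using hs
  obtain ⟨S, hS⟩ := hsC
  have hSc : ∀ n, fourierCoeff S n = fourierCoeff f n := by
    intro n
    have hlim : Tendsto (fun s : Finset ℤ => fourierCoeff
        (fun z : AddCircle T => ∑ k ∈ s, fourierCoeff f k * fourier k z) n) atTop
        (𝓝 (fourierCoeff S n)) := by
      rw [tendsto_iff_norm_sub_tendsto_zero]
      have h1 : Tendsto (fun s : Finset ℤ =>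
          ‖∑ k ∈ s, fourierCoeff f k • (fourier k : C(AddCircle T, ℂ)) - S‖) atTop (𝓝 0) :=
        tendsto_iff_norm_sub_tendsto_zero.1 hS
      refine squeeze_zero (fun _ => norm_nonneg _) (fun s => ?_) h1
      rw [← fourierCoeff_sub (integrable_of_continuous_circle (continuous_trigSum _ _))
        (integrable_of_continuous_circle S.continuous)]
      refine (norm_fourierCoeff_le n).trans ?_
      refine (integral_mono_of_nonneg (ae_of_all _ fun z => norm_nonneg _)
        (integrable_const ‖∑ k ∈ s, fourierCoeff f k • (fourier k : C(AddCircle T, ℂ)) - S‖)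
        (ae_of_all _ fun z => ?_)).trans_eq (by simp)
      have := (∑ k ∈ s, fourierCoeff f k • (fourier k : C(AddCircle T, ℂ)) - S).norm_coe_le_norm z
      simpa using this
    refine tendsto_nhds_unique hlim ?_
    refine tendsto_const_nhds.congr' ?_
    filter_upwards [eventually_ge_atTop {n}] with s hs
    rw [fourierCoeff_trigSum, if_pos (hs (Finset.mem_singleton_self n))]
  have hSi := integrable_of_continuous_circle S.continuous
  have hae := ae_eq_zero_of_fourierCoeff_eq_zero (hf.sub hSi) fun n => by
    have := fourierCoeff_sub hf hSi n
    rw [hSc, sub_self] at this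
    exact this
  have hfS : f =ᵐ[haarAddCircle] S := by
    have h1 : ∫ z, ‖f z - S z‖ ∂haarAddCircle = 0 := by
      rw [integral_haarAddCircle, ← AddCircle.integral_preimage T 0, zero_add,
        integral_Ioc_eq_integral_Ioo, setIntegral_eq_zero_of_ae_eq_zero, smul_zero]
      filter_upwards [hae] with x hx hxT
      rw [norm_eq_zero]
      exact hx hxT
    have h2 := (integral_eq_zero_iff_of_nonneg (fun z => norm_nonneg _) (hf.sub hSi).norm).1 h1
    filter_upwards [h2] with z hz
    exact sub_eq_zero.1 (norm_eq_zero.1 hz)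
  refine ⟨∑' n, ‖fourierCoeff f n‖, fun δ hδ => ?_⟩
  have h1 : Tendsto (fun s : Finset ℤ =>
      ‖∑ k ∈ s, fourierCoeff f k • (fourier k : C(AddCircle T, ℂ)) - S‖) atTop (𝓝 0) :=
    tendsto_iff_norm_sub_tendsto_zero.1 hS
  obtain ⟨s, hs1, hs2⟩ := ((h1.eventually_lt_const hδ).and
    (eventually_ge_atTop (Finset.Icc (-1 : ℤ) 1))).exists
  refine ⟨s.filter fun k => 2 ≤ |k|, fourierCoeff f, fun k hk => (Finset.mem_filter.1 hk).2,
    hs.sum_le_tsum _ (fun _ _ => norm_nonneg _), ?_⟩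
  have hsplit : ∀ z, lowModes f z + ∑ k ∈ s with 2 ≤ |k|, fourierCoeff f k * fourier k z =
      ∑ k ∈ s, fourierCoeff f k * fourier k z := by
    intro z
    rw [← Finset.sum_filter_add_sum_filter_not s (fun k => 2 ≤ |k|), add_comm, lowModes]
    congr 1
    refine Finset.sum_congr ?_ fun _ _ => rfl
    ext k
    simp only [Finset.mem_filter, Finset.mem_Icc, not_le]
    rw [← abs_le, ← Int.lt_add_one_iff (a := |k|) (b := 1)]
    refine ⟨fun h => ⟨hs2 ?_, h⟩, fun h => h.2⟩
    rw [Finset.mem_Icc, ← abs_le]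
    exact Int.lt_add_one_iff.1 h
  calc _ ≤ ∫ _z, δ ∂(haarAddCircle (T := T)) := by
        refine integral_mono_of_nonneg (ae_of_all _ fun z => norm_nonneg _) (integrable_const _) ?_
        filter_upwards [hfS] with z hz
        have h3 := (∑ k ∈ s, fourierCoeff f k • (fourier k : C(AddCircle T, ℂ))
          - S).norm_coe_le_norm z
        simp only [ContinuousMap.sub_apply, ContinuousMap.sum_apply, ContinuousMap.smul_apply,
          smul_eq_mul] at h3
        rw [sub_sub, hsplit, hz, norm_sub_rev]
        exact h3.trans hs1.le
    _ = δ := by simp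

end Circle

/-- The trigonometric polynomial `∑ t_k e^{i k β τ}`. -/
def trigSum (β : ℝ) (s : Finset ℤ) (t : ℤ → ℂ) (τ : ℝ) : ℂ :=
  ∑ k ∈ s, t k * Complex.exp ((k * β * τ : ℝ) * Complex.I)

theorem fourier_period_apply {β : ℝ} (hβ : 0 < β) (k : ℤ) (τ : ℝ) :
    fourier k (τ : AddCircle (2 * Real.pi / β)) = Complex.exp ((k * β * τ : ℝ) * Complex.I) := by
  rw [fourier_coe_apply]
  congr 1
  push_cast
  have : (β : ℂ) ≠ 0 := by exact_mod_cast hβ.ne'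
  have : (Real.pi : ℂ) ≠ 0 := by exact_mod_cast Real.pi_ne_zero
  field_simp

theorem fourierCoeffOn_eq_integral_cexp {β : ℝ} (hβ : 0 < β) (hT : 0 < 2 * Real.pi / β)
    (f : ℝ → ℂ) (k : ℤ) :
    fourierCoeffOn hT f k = ((2 * Real.pi / β)⁻¹ : ℝ) • ∫ τ in (0 : ℝ)..(2 * Real.pi / β),
      Complex.exp ((-k * β * τ : ℝ) * Complex.I) * f τ := by
  rw [fourierCoeffOn_eq_integral, sub_zero, one_div]
  congr 1
  refine intervalIntegral.integral_congr fun τ _ => ?_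
  simp only [smul_eq_mul, fourier_period_apply hβ]
  push_cast
  rfl

namespace IsEvenMeanZeroPeriodic

/-- The Fourier coefficients of an even real function are even. -/
theorem fourierCoeffOn_neg {β : ℝ} {H : ℝ → ℝ} (hβ : 0 < β)
    (hH : IsEvenMeanZeroPeriodic (2 * Real.pi / β) H) (hT : 0 < 2 * Real.pi / β) (k : ℤ) :
    fourierCoeffOn hT (fun τ => (H τ : ℂ)) (-k) = fourierCoeffOn hT (fun τ => (H τ : ℂ)) k := by
  rw [fourierCoeffOn_eq_integral_cexp hβ, fourierCoeffOn_eq_integral_cexp hβ]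
  congr 1
  have h := intervalIntegral.integral_comp_sub_left (a := 0) (b := 2 * Real.pi / β)
    (fun τ => Complex.exp ((-k * β * τ : ℝ) * Complex.I) * (H τ : ℂ)) (2 * Real.pi / β)
  rw [sub_self, sub_zero] at h
  rw [← h]
  refine intervalIntegral.integral_congr fun τ _ => ?_
  have e1 : H (2 * Real.pi / β - τ) = H τ := by
    rw [← hH.even, neg_sub, hH.periodic.sub_eq]
  have e2 : Complex.exp ((-k * β * (2 * Real.pi / β - τ) : ℝ) * Complex.I) =
      Complex.exp ((-(-k : ℤ) * β * τ : ℝ) * Complex.I) := by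
    rw [Complex.exp_eq_exp_iff_exists_int]
    refine ⟨-k, ?_⟩
    push_cast
    have : (β : ℂ) ≠ 0 := by exact_mod_cast hβ.ne'
    field_simp
    ring
  simp only [e1, e2]

theorem conj_fourierCoeffOn {β : ℝ} {H : ℝ → ℝ} (hβ : 0 < β) (hT : 0 < 2 * Real.pi / β) (k : ℤ) :
    (starRingEnd ℂ) (fourierCoeffOn hT (fun τ => (H τ : ℂ)) k) =
      fourierCoeffOn hT (fun τ => (H τ : ℂ)) (-k) := by
  rw [fourierCoeffOn_eq_integral_cexp hβ, fourierCoeffOn_eq_integral_cexp hβ,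
    Complex.real_smul, Complex.real_smul, map_mul, Complex.conj_ofReal,
    intervalIntegral.integral_of_le hT.le, intervalIntegral.integral_of_le hT.le, ← integral_conj]
  congr 1
  refine integral_congr_ae (ae_of_all _ fun τ => ?_)
  simp only [map_mul, Complex.conj_ofReal, ← Complex.exp_conj, Complex.conj_I]
  congr 2
  push_cast
  ring

theorem fourierCoeffOn_zero {β : ℝ} {H : ℝ → ℝ} (hβ : 0 < β)
    (hH : IsEvenMeanZeroPeriodic (2 * Real.pi / β) H) (hT : 0 < 2 * Real.pi / β) :
    fourierCoeffOn hT (fun τ => (H τ : ℂ)) 0 = 0 := by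
  rw [fourierCoeffOn_eq_integral_cexp hβ]
  simp [intervalIntegral.integral_ofReal, hH.mean_zero]

end IsEvenMeanZeroPeriodic

/-- Up to a multiple of `cos (β ·)`, the function `H` is an `L¹` limit of trigonometric polynomials
without modes of order less than two, with coefficients bounded in the sense of `ℓ^∞`, and in the
sense of `ℓ¹` when the Fourier series converges absolutely. -/
theorem exists_trigSum_approx_even {β : ℝ} {H : ℝ → ℝ} (hβ : 0 < β)
    (hH : IsEvenMeanZeroPeriodic (2 * Real.pi / β) H) :
    ∃ a : ℝ,
      (∃ M : ℝ, ∀ δ > 0, ∃ (s : Finset ℤ) (t : ℤ → ℂ), ((∀ k ∈ s, 2 ≤ |k|) ∧ ∀ k ∈ s, ‖t k‖ ≤ M) ∧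
        ∫ τ in Set.Ioc 0 (2 * Real.pi / β),
          ‖(H τ : ℂ) - (a * Real.cos (β * τ) : ℝ) - trigSum β s t τ‖ ≤ δ) ∧
      (HasAbsConvFourierSeries (div_pos Real.two_pi_pos hβ) H →
        ∃ M : ℝ, ∀ δ > 0, ∃ (s : Finset ℤ) (t : ℤ → ℂ),
        ((∀ k ∈ s, 2 ≤ |k|) ∧ ∑ k ∈ s, ‖t k‖ ≤ M) ∧
        ∫ τ in Set.Ioc 0 (2 * Real.pi / β),
          ‖(H τ : ℂ) - (a * Real.cos (β * τ) : ℝ) - trigSum β s t τ‖ ≤ δ) := by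
  have hT : 0 < 2 * Real.pi / β := div_pos Real.two_pi_pos hβ
  have : Fact (0 < 2 * Real.pi / β) := ⟨hT⟩
  set T := 2 * Real.pi / β with hTdef
  set f : AddCircle T → ℂ := AddCircle.liftIoc T 0 fun τ => (H τ : ℂ) with hf
  have hHi : IntegrableOn H (Set.Ioc 0 T) :=
    (hH.locallyIntegrable.integrableOn_isCompact isCompact_Icc).mono_set Set.Ioc_subset_Icc_self
  have hfi : Integrable f AddCircle.haarAddCircle := by
    refine memLp_one_iff_integrable.1 (MemLp.haarAddCircle (MemLp.memLp_liftIoc ?_))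
    rw [zero_add]
    exact memLp_one_iff_integrable.2 hHi.ofReal
  have hcoeff : ∀ k, fourierCoeff f k = fourierCoeffOn hT (fun τ => (H τ : ℂ)) k := by
    intro k
    rw [hf, fourierCoeff_liftIoc_eq, fourierCoeffOn_eq_integral, fourierCoeffOn_eq_integral]
    simp only [zero_add, sub_zero, fourier_coe_apply]
  set a₁ : ℝ := (fourierCoeff f 1).re with ha₁
  have h1 : fourierCoeff f 1 = a₁ := by
    have : (starRingEnd ℂ) (fourierCoeff f 1) = fourierCoeff f 1 := by
      rw [hcoeff, IsEvenMeanZeroPeriodic.conj_fourierCoeffOn hβ, hH.fourierCoeffOn_neg hβ]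
    exact (Complex.conj_eq_iff_re.1 this).symm
  have h2 : fourierCoeff f (-1) = a₁ := by
    rw [hcoeff, hH.fourierCoeffOn_neg hβ, ← hcoeff, h1]
  have h0 : fourierCoeff f 0 = 0 := by rw [hcoeff, hH.fourierCoeffOn_zero hβ]
  have hlow : ∀ τ : ℝ, lowModes f τ = (2 * a₁ * Real.cos (β * τ) : ℝ) := by
    intro τ
    have hI : Finset.Icc (-1 : ℤ) 1 = {-1, 0, 1} := by decide
    rw [lowModes, hI]
    simp only [fourier_period_apply hβ]
    rw [Finset.sum_insert (by decide), Finset.sum_insert (by decide), Finset.sum_singleton, h0, h1,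
      h2]
    push_cast
    rw [Complex.cos]
    ring_nf
  have htrig : ∀ (s : Finset ℤ) (t : ℤ → ℂ) (τ : ℝ),
      ∑ k ∈ s, t k * fourier k (τ : AddCircle T) = trigSum β s t τ := by
    intro s t τ
    simp only [trigSum, fourier_period_apply hβ]
  have hint : ∀ (s : Finset ℤ) (t : ℤ → ℂ) (δ : ℝ),
      ∫ z, ‖f z - lowModes f z - ∑ k ∈ s, t k * fourier k z‖ ∂AddCircle.haarAddCircle ≤ δ / T →
      ∫ τ in Set.Ioc 0 T, ‖(H τ : ℂ) - (2 * a₁ * Real.cos (β * τ) : ℝ) - trigSum β s t τ‖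
        ≤ δ := by
    intro s t δ h
    rw [AddCircle.integral_haarAddCircle, ← AddCircle.integral_preimage T 0, zero_add, smul_eq_mul,
      le_div_iff₀ hT, mul_comm, mul_inv_cancel_left₀ hT.ne'] at h
    refine le_trans (le_of_eq ?_) h
    refine setIntegral_congr_fun measurableSet_Ioc fun τ hτ => ?_
    simp only [hlow, htrig]
    rw [hf, AddCircle.liftIoc_coe_apply (by rwa [zero_add])]
  refine ⟨2 * a₁, ?_, fun hs => ?_⟩
  · obtain ⟨M, hM⟩ := exists_bounded_trigSum_approx hfi
    refine ⟨M, fun δ hδ => ?_⟩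
    obtain ⟨s, t, k1, k2, k3⟩ := hM (δ / T) (by positivity)
    exact ⟨s, t, ⟨k1, k2⟩, hint s t δ k3⟩
  · obtain ⟨M, hM⟩ := exists_summable_trigSum_approx hfi (by
      simp only [hcoeff]; exact hs)
    refine ⟨M, fun δ hδ => ?_⟩
    obtain ⟨s, t, k1, k2, k3⟩ := hM (δ / T) (by positivity)
    exact ⟨s, t, ⟨k1, k2⟩, hint s t δ k3⟩

/-! ### Periodic functions of nondegenerate Gaussian variables -/

theorem summable_exp_neg_mul_sq_int {b : ℝ} (hb : 0 < b) :
    Summable fun m : ℤ => Real.exp (-b * (m : ℝ) ^ 2) := by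
  have h : Summable fun n : ℕ => Real.exp (-b * (n : ℝ) ^ 2) := by
    have hg : Summable fun n : ℕ => Real.exp (-b) ^ n :=
      summable_geometric_of_lt_one (Real.exp_pos _).le (by simpa using hb)
    refine Summable.of_nonneg_of_le (fun _ => (Real.exp_pos _).le) (fun n => ?_) hg
    rw [← Real.exp_nat_mul, Real.exp_le_exp]
    have : (n : ℝ) ≤ (n : ℝ) ^ 2 := by exact_mod_cast Nat.le_self_pow two_ne_zero n
    nlinarith
  refine Summable.of_nat_of_neg (by simpa using h) (by simpa using h)

/-- Wrapped around a circle, centred Gaussian densities with variance in `[1, V]` are bounded. -/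
theorem exists_lintegral_gaussianReal_le {T : ℝ} (hT : 0 < T) (V : ℝ) :
    ∃ C : NNReal, ∀ v : NNReal, 1 ≤ v → (v : ℝ) ≤ V → ∀ r : ℝ → ENNReal, Function.Periodic r T →
      AEMeasurable r → ∫⁻ τ, r τ ∂(gaussianReal 0 v) ≤ C * ∫⁻ τ in Set.Ioc 0 T, r τ := by
  rcases lt_or_ge V 1 with hV | hV
  · refine ⟨0, fun v h1 h2 => ?_⟩
    have : (1 : ℝ) ≤ v := by exact_mod_cast h1
    linarith
  have hV0 : 0 < V := by linarith
  have hb : 0 < T ^ 2 / (4 * V) := by positivity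
  have hsum := (summable_exp_neg_mul_sq_int hb).mul_left (Real.exp (T ^ 2 / (2 * V)))
  set A : ℤ → ℝ := fun m => Real.exp (T ^ 2 / (2 * V)) *
    Real.exp (-(T ^ 2 / (4 * V)) * (m : ℝ) ^ 2) with hA
  have hA0 : ∀ m, 0 ≤ A m := fun m => by positivity
  refine ⟨(∑' m, A m).toNNReal, fun v hv1 hvV r hr hrm => ?_⟩
  have hv0 : (1 : ℝ) ≤ v := by exact_mod_cast hv1
  have hpdf : ∀ τ, gaussianPDF 0 v τ ≤ ENNReal.ofReal (Real.exp (-τ ^ 2 / (2 * V))) := by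
    intro τ
    rw [gaussianPDF, gaussianPDFReal]
    refine ENNReal.ofReal_le_ofReal ?_
    have h1 : (√(2 * Real.pi * v))⁻¹ ≤ 1 := by
      refine inv_le_one_of_one_le₀ ?_
      rw [Real.one_le_sqrt]
      have := Real.pi_gt_three
      nlinarith
    have h2 : Real.exp (-(τ - 0) ^ 2 / (2 * v)) ≤ Real.exp (-τ ^ 2 / (2 * V)) := by
      rw [sub_zero, Real.exp_le_exp, neg_div, neg_div, neg_le_neg_iff]
      gcongr
    calc _ ≤ 1 * Real.exp (-τ ^ 2 / (2 * V)) := by gcongr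
      _ = _ := one_mul _
  have hper : ∀ m : ℤ, ∫⁻ τ in Set.Ioc (m • T) ((m + 1) • T), r τ =
      ∫⁻ τ in Set.Ioc 0 T, r τ := by
    intro m
    have h := (measurePreserving_add_right (volume : Measure ℝ)
      (m • T)).setLIntegral_comp_preimage_emb
      (measurableEmbedding_addRight (m • T)) r (Set.Ioc (m • T) ((m + 1) • T))
    rw [← h]
    have e : (fun x : ℝ => x + m • T) ⁻¹' Set.Ioc (m • T) ((m + 1) • T) = Set.Ioc 0 T := by
      ext x
      simp only [Set.mem_preimage, Set.mem_Ioc, add_smul, one_smul]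
      constructor <;> rintro ⟨h1, h2⟩ <;> constructor <;> linarith
    rw [e]
    refine lintegral_congr fun τ => ?_
    exact (hr.zsmul m) τ
  have hpiece : ∀ m : ℤ, ∫⁻ τ in Set.Ioc (m • T) ((m + 1) • T),
      r τ * ENNReal.ofReal (Real.exp (-τ ^ 2 / (2 * V))) ≤
      ENNReal.ofReal (A m) * ∫⁻ τ in Set.Ioc 0 T, r τ := by
    intro m
    rw [← hper m, ← lintegral_const_mul'' _ hrm.restrict]
    refine setLIntegral_mono' measurableSet_Ioc fun τ hτ => ?_
    rw [mul_comm]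
    gcongr
    change _ ≤ Real.exp (T ^ 2 / (2 * V)) * Real.exp (-(T ^ 2 / (4 * V)) * (m : ℝ) ^ 2)
    rw [← Real.exp_add, Real.exp_le_exp]
    simp only [zsmul_eq_mul, Int.cast_add, Int.cast_one] at hτ
    obtain ⟨h1, h2⟩ := hτ
    have h3 : (m : ℝ) ^ 2 * T ^ 2 / 2 - T ^ 2 ≤ τ ^ 2 := by
      nlinarith [sq_nonneg (m * T + 2 * (τ - m * T)), sq_nonneg (τ - m * T - T)]
    have h4 : T ^ 2 / (2 * V) + -(T ^ 2 / (4 * V)) * (m : ℝ) ^ 2 =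
        -((m : ℝ) ^ 2 * T ^ 2 / 2 - T ^ 2) / (2 * V) := by
      field_simp
      ring
    rw [h4]
    gcongr
  have hv : v ≠ 0 := by
    intro h; rw [h] at hv1; exact absurd hv1 (by norm_num)
  rw [gaussianReal_of_var_ne_zero 0 hv,
    lintegral_withDensity_eq_lintegral_mul₀ (measurable_gaussianPDF 0 v).aemeasurable hrm]
  calc ∫⁻ τ, (gaussianPDF 0 v * r) τ
      ≤ ∫⁻ τ, r τ * ENNReal.ofReal (Real.exp (-τ ^ 2 / (2 * V))) := by
        refine lintegral_mono fun τ => ?_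
        rw [Pi.mul_apply, mul_comm]
        gcongr
        exact hpdf τ
    _ = ∫⁻ τ in ⋃ m : ℤ, Set.Ioc (m • T) ((m + 1) • T),
          r τ * ENNReal.ofReal (Real.exp (-τ ^ 2 / (2 * V))) := by
        rw [iUnion_Ioc_zsmul hT, Measure.restrict_univ]
    _ ≤ ∑' m : ℤ, ∫⁻ τ in Set.Ioc (m • T) ((m + 1) • T),
          r τ * ENNReal.ofReal (Real.exp (-τ ^ 2 / (2 * V))) := lintegral_iUnion_le _ _
    _ ≤ ∑' m : ℤ, ENNReal.ofReal (A m) * ∫⁻ τ in Set.Ioc 0 T, r τ := ENNReal.tsum_le_tsum hpiece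
    _ = _ := by
        rw [ENNReal.tsum_mul_right, ← ENNReal.ofReal_tsum_of_nonneg hA0 hsum]
        rfl

/-! ### From periodic functions to random variables -/

section Transfer

variable {d : ℕ} {Ω : Type*} [MeasurableSpace Ω] {P : Measure Ω} {U : Opens (Space d)}
  {g : Space d → Space d → ℝ} {X : Ω → (𝓢(Space d, ℝ) →L[ℝ] ℝ)}

/-- The random variable `∫_U φ(x) e^{β² E[X_ε(x)²] / 2} R(X_ε(x)) dx`. -/
def fieldIntegral (P : Measure Ω) (U : Opens (Space d)) (X : Ω → (𝓢(Space d, ℝ) →L[ℝ] ℝ))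
    (η : Bump d) (β ε : ℝ) (φ : Space d → ℂ) (R : ℝ → ℂ) (ω : Ω) : ℂ :=
  ∫ x in (U : Set (Space d)), waveWeight P X η β ε φ x * R (mollify X η ε x ω)

theorem map_mollify (hX : IsLogCorrelatedField P U g X) (η : Bump d) (ε : ℝ) (x : Space d) :
    P.map (mollify X η ε x) = gaussianReal 0 (mollCov P X η η ε ε x x).toNNReal := by
  have hg := hX.gaussian.hasGaussianLaw_eval (η.scaled ε x)
  have : IsProbabilityMeasure P := hX.gaussian.isProbabilityMeasure
  have hm := hg.map_eq_gaussianReal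
  rw [variance_of_integral_eq_zero hg.aemeasurable (hX.centred _), hX.centred] at hm
  rw [← integral_mollify_sq]
  exact hm

/-- Where the variance is nondegenerate, a function of the field depends on the function only up
to a null set, and its `L¹` norm is controlled by that of the function over a period. -/
theorem exists_lintegral_field_le (hX : IsLogCorrelatedField P U g X) (η : Bump d)
    {β ε : ℝ} {φ : Space d → ℂ} (hφ : Measurable φ) {B V T : ℝ}
    (hB : ∀ x, ‖waveWeight P X η β ε φ x‖ ≤ B)
    (hV : ∀ x ∈ tsupport φ, 1 ≤ mollCov P X η η ε ε x x ∧ mollCov P X η η ε ε x x ≤ V)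
    (hT : 0 < T) :
    ∃ C : NNReal, ∀ R : ℝ → ℂ, Function.Periodic R T → AEStronglyMeasurable R →
      AEStronglyMeasurable (fun q : Space d × Ω => waveWeight P X η β ε φ q.1 *
        R (mollify X η ε q.1 q.2)) ((volume.restrict (U : Set (Space d))).prod P) ∧
      ∫⁻ q, ‖waveWeight P X η β ε φ q.1 * R (mollify X η ε q.1 q.2)‖ₑ
        ∂((volume.restrict (U : Set (Space d))).prod P) ≤ C * ∫⁻ τ in Set.Ioc 0 T, ‖R τ‖ₑ := by
  have : IsProbabilityMeasure P := hX.gaussian.isProbabilityMeasure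
  obtain ⟨C₀, hC₀⟩ := exists_lintegral_gaussianReal_le hT V
  obtain ⟨Y, hY, hYX⟩ := exists_measurable_mollify hX η ε
  refine ⟨B.toNNReal * C₀ * (volume (U : Set (Space d))).toNNReal, fun R hR hRm => ?_⟩
  have hUfin : volume (U : Set (Space d)) ≠ ⊤ := hX.kernel.bounded.measure_lt_top.ne
  have hw0 : ∀ x ∉ tsupport φ, waveWeight P X η β ε φ x = 0 := fun x hx => by
    rw [waveWeight, image_eq_zero_of_notMem_tsupport hx, zero_mul]
  have hae : ∀ x, AEMeasurable (mollify X η ε x) P := fun x => hX.gaussian.aemeasurable _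
  have hac : ∀ x ∈ tsupport φ, P.map (mollify X η ε x) ≪ volume := by
    intro x hx
    rw [map_mollify hX]
    refine gaussianReal_absolutelyContinuous 0 ?_
    rw [Ne, Real.toNNReal_eq_zero, not_le]
    linarith [(hV x hx).1]
  have hm : AEStronglyMeasurable (fun q : Space d × Ω => waveWeight P X η β ε φ q.1 *
      R (mollify X η ε q.1 q.2)) ((volume.restrict (U : Set (Space d))).prod P) := by
    set N := toMeasurable volume {τ | R τ ≠ hRm.mk R τ} with hN
    have hN0 : volume N = 0 := by rw [hN, measure_toMeasurable]; exact hRm.ae_eq_mk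
    have hNm : MeasurableSet N := measurableSet_toMeasurable _ _
    have hYm : Measurable fun q : Space d × Ω => Y q.1 q.2 := hY
    refine ⟨fun q => waveWeight P X η β ε φ q.1 * hRm.mk R (Y q.1 q.2), ?_, ?_⟩
    · exact ((measurable_waveWeight hX η β ε hφ).comp measurable_fst).stronglyMeasurable.mul
        (hRm.stronglyMeasurable_mk.comp_measurable hYm)
    · have h1 : ∀ᵐ q ∂((volume.restrict (U : Set (Space d))).prod P),
          ∀ x, Y x q.2 = mollify X η ε x q.2 :=
        Measure.quasiMeasurePreserving_snd.ae hYX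
      have h2 : ∀ᵐ q ∂((volume.restrict (U : Set (Space d))).prod P),
          ¬ (waveWeight P X η β ε φ q.1 ≠ 0 ∧ Y q.1 q.2 ∈ N) := by
        have hms : MeasurableSet {q : Space d × Ω |
            ¬ (waveWeight P X η β ε φ q.1 ≠ 0 ∧ Y q.1 q.2 ∈ N)} := by
          refine (MeasurableSet.inter ?_ (hYm hNm)).compl
          exact ((measurable_waveWeight hX η β ε hφ).comp measurable_fst)
            (measurableSet_singleton 0).compl
        refine (Measure.ae_prod_iff_ae_ae (p := fun q : Space d × Ω =>
          ¬ (waveWeight P X η β ε φ q.1 ≠ 0 ∧ Y q.1 q.2 ∈ N)) hms).2 (ae_of_all _ fun x => ?_)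
        by_cases hx : x ∈ tsupport φ
        · have h3 : ∀ᵐ ω ∂P, mollify X η ε x ω ∉ N :=
            ae_of_ae_map (hae x) (hac x hx (measure_eq_zero_iff_ae_notMem.1 hN0))
          filter_upwards [h3, hYX] with ω h4 h5 h6
          exact h4 (h5 x ▸ h6.2)
        · exact ae_of_all _ fun ω h => h.1 (hw0 x hx)
      filter_upwards [h1, h2] with q h3 h4
      by_cases h5 : waveWeight P X η β ε φ q.1 = 0
      · simp only [h5, zero_mul]
      · have h6 : Y q.1 q.2 ∉ N := fun h => h4 ⟨h5, h⟩
        have h7 : R (Y q.1 q.2) = hRm.mk R (Y q.1 q.2) := by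
          by_contra h
          exact h6 (subset_toMeasurable _ _ h)
        rw [← h7, h3]
  refine ⟨hm, ?_⟩
  rw [lintegral_prod _ hm.enorm]
  have hfib : ∀ x, ∫⁻ ω, ‖waveWeight P X η β ε φ x * R (mollify X η ε x ω)‖ₑ ∂P ≤
      B.toNNReal * (C₀ * ∫⁻ τ in Set.Ioc 0 T, ‖R τ‖ₑ) := by
    intro x
    by_cases hx : x ∈ tsupport φ
    · simp only [enorm_mul]
      rw [lintegral_const_mul' _ _ enorm_ne_top]
      gcongr
      · rw [← ofReal_norm]
        exact ENNReal.ofReal_le_ofReal (hB x)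
      · have h1 : ∫⁻ ω, ‖R (mollify X η ε x ω)‖ₑ ∂P = ∫⁻ τ, ‖R τ‖ₑ ∂(P.map (mollify X η ε x)) := by
          rw [lintegral_map' (hRm.mono_ac (hac x hx)).enorm (hae x)]
        rw [h1, map_mollify hX]
        have hv := hV x hx
        have h0 : (0 : ℝ) ≤ mollCov P X η η ε ε x x := by linarith
        refine hC₀ _ ?_ ?_ _ (fun τ => by simp only [hR τ]) hRm.enorm
        · rw [← Real.toNNReal_one]
          exact Real.toNNReal_le_toNNReal hv.1
        · rw [Real.coe_toNNReal _ h0]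
          exact hv.2
    · simp [hw0 x hx]
  calc _ ≤ ∫⁻ _ in (U : Set (Space d)), B.toNNReal * (C₀ * ∫⁻ τ in Set.Ioc 0 T, ‖R τ‖ₑ) :=
        lintegral_mono fun x => hfib x
    _ = _ := by
        rw [lintegral_const, Measure.restrict_apply_univ]
        push_cast
        rw [ENNReal.coe_toNNReal hUfin]
        ring

/-- Integrability, measurability and an `L¹` bound for `fieldIntegral`. -/
theorem exists_eLpNorm_fieldIntegral_le (hX : IsLogCorrelatedField P U g X) (η : Bump d)
    {β ε : ℝ} {φ : Space d → ℂ} (hφ : Measurable φ) {B V T : ℝ}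
    (hB : ∀ x, ‖waveWeight P X η β ε φ x‖ ≤ B)
    (hV : ∀ x ∈ tsupport φ, 1 ≤ mollCov P X η η ε ε x x ∧ mollCov P X η η ε ε x x ≤ V)
    (hT : 0 < T) :
    ∃ C : NNReal, ∀ R : ℝ → ℂ, Function.Periodic R T → LocallyIntegrable R →
      (∀ᵐ ω ∂P, IntegrableOn (fun x => waveWeight P X η β ε φ x * R (mollify X η ε x ω))
        (U : Set (Space d))) ∧
      AEStronglyMeasurable (fieldIntegral P U X η β ε φ R) P ∧
      eLpNorm (fieldIntegral P U X η β ε φ R) 1 P ≤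
        C * ENNReal.ofReal (∫ τ in Set.Ioc 0 T, ‖R τ‖) := by
  have : IsProbabilityMeasure P := hX.gaussian.isProbabilityMeasure
  obtain ⟨C, hC⟩ := exists_lintegral_field_le hX η hφ hB hV hT
  refine ⟨C, fun R hR hRl => ?_⟩
  obtain ⟨hm, hle⟩ := hC R hR hRl.aestronglyMeasurable
  have hRi : IntegrableOn R (Set.Ioc 0 T) :=
    (hRl.integrableOn_isCompact isCompact_Icc).mono_set Set.Ioc_subset_Icc_self
  have hfin : ∫⁻ τ in Set.Ioc 0 T, ‖R τ‖ₑ = ENNReal.ofReal (∫ τ in Set.Ioc 0 T, ‖R τ‖) :=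
    (ofReal_integral_norm_eq_lintegral_enorm hRi).symm
  rw [hfin] at hle
  have hi : Integrable (fun q : Space d × Ω => waveWeight P X η β ε φ q.1 *
      R (mollify X η ε q.1 q.2)) ((volume.restrict (U : Set (Space d))).prod P) :=
    ⟨hm, lt_of_le_of_lt hle (ENNReal.mul_lt_top ENNReal.coe_lt_top ENNReal.ofReal_lt_top)⟩
  refine ⟨hi.prod_left_ae, hm.prod_swap.integral_prod_right', ?_⟩
  refine le_trans ?_ hle
  rw [eLpNorm_one_eq_lintegral_enorm, lintegral_prod_symm _ hm.enorm]
  exact lintegral_mono fun ω => enorm_integral_le_lintegral_enorm _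

theorem exists_fieldIntegral_bound [NeZero d] (hX : IsLogCorrelatedField P U g X) (η : Bump d)
    (β : ℝ) {T : ℝ} (hT : 0 < T) (φ : 𝓓(U, ℂ)) :
    ∃ ε₀ > 0, ∀ ε, 0 < ε → ε ≤ ε₀ → (∃ B : ℝ, ∀ x, ‖waveWeight P X η β ε φ x‖ ≤ B) ∧
      ∃ C : NNReal, ∀ R : ℝ → ℂ, Function.Periodic R T → LocallyIntegrable R →
      (∀ᵐ ω ∂P, IntegrableOn (fun x => waveWeight P X η β ε φ x * R (mollify X η ε x ω))
        (U : Set (Space d))) ∧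
      AEStronglyMeasurable (fieldIntegral P U X η β ε φ R) P ∧
      eLpNorm (fieldIntegral P U X η β ε φ R) 1 P ≤
        C * ENNReal.ofReal (∫ τ in Set.Ioc 0 T, ‖R τ‖) := by
  obtain ⟨ε₀, hε₀, C, hC0, hC⟩ := exists_mollCov_bounds hX φ.hasCompactSupport.isCompact
    φ.tsupport_subset η η
  obtain ⟨M, hM⟩ := φ.hasCompactSupport.exists_bound_of_continuous φ.continuous
  refine ⟨min ε₀ (Real.exp (-C - 1) / 2), by positivity, fun ε hε hεle => ?_⟩
  have h1 : ε ≤ ε₀ := hεle.trans (min_le_left _ _)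
  have h2 : ε + ε ≤ Real.exp (-C - 1) := by linarith [hεle.trans (min_le_right _ _)]
  have hB := norm_waveWeight_le P X η β ε (φ := φ) hM
    fun x hx => (hC ε ε hε h1 hε h1 x hx x hx).2.1
  refine ⟨⟨_, hB⟩, exists_eLpNorm_fieldIntegral_le hX η φ.continuous.measurable hB
    (fun x hx => ⟨?_, (hC ε ε hε h1 hε h1 x hx x hx).2.1⟩) hT⟩
  have h3 := (hC ε ε hε h1 hε h1 x hx x hx).2.2
  rw [sub_self, norm_zero, zero_add] at h3
  have h4 : Real.log (ε + ε) ≤ -C - 1 := by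
    rw [← Real.log_exp (-C - 1)]
    exact Real.log_le_log (by positivity) h2
  linarith

/-! ### Convergence in probability -/

theorem tendstoInMeasure_of_eventually {f : ℕ → Ω → ℂ} {h : Ω → ℂ} {p : ENNReal} (hp : p ≠ 0)
    (hf : ∀ᶠ n in atTop, AEStronglyMeasurable (f n) P) (hh : AEStronglyMeasurable h P)
    (hlim : Tendsto (fun n => eLpNorm (f n - h) p P) atTop (𝓝 0)) :
    TendstoInMeasure P f atTop h := by
  classical
  set f' : ℕ → Ω → ℂ := fun n => if AEStronglyMeasurable (f n) P then f n else h with hf'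
  have hm : ∀ n, AEStronglyMeasurable (f' n) P := fun n => by
    simp only [hf']
    split_ifs with h1
    · exact h1
    · exact hh
  have heq : ∀ᶠ n in atTop, f' n = f n := hf.mono fun n h1 => if_pos h1
  have h2 : TendstoInMeasure P f' atTop h := by
    refine tendstoInMeasure_of_tendsto_eLpNorm hp hm hh (hlim.congr' ?_)
    exact heq.mono fun n h1 => by simp only [h1]
  intro δ hδ
  exact (h2 δ hδ).congr' (heq.mono fun n h1 => by rw [h1])

theorem tendstoInMeasure_trans {f f' : ℕ → Ω → ℂ} {h : Ω → ℂ}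
    (h1 : TendstoInMeasure P (f - f') atTop 0) (h2 : TendstoInMeasure P f' atTop h) :
    TendstoInMeasure P f atTop h := by
  intro δ hδ
  have hδ2 : 0 < δ / 2 := ENNReal.half_pos hδ.ne'
  have h3 := (h1 _ hδ2).add (h2 _ hδ2)
  rw [add_zero] at h3
  refine tendsto_of_tendsto_of_tendsto_of_le_of_le tendsto_const_nhds h3 (fun n => zero_le)
    fun n => le_trans (measure_mono fun ω hω => ?_) (measure_union_le _ _)
  by_contra h4
  simp only [Set.mem_union, Set.mem_ofPred_eq, not_or, not_le] at h4 hω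
  have h5 : edist (f n ω) (f' n ω) < δ / 2 := by
    have := h4.1
    rwa [Pi.zero_apply, Pi.sub_apply, Pi.sub_apply, edist_zero_right, ← edist_eq_enorm_sub] at this
  have h6 := (edist_triangle (f n ω) (f' n ω) (h ω)).trans_lt (ENNReal.add_lt_add h5 h4.2)
  rw [ENNReal.add_halves] at h6
  exact absurd hω (not_le.2 h6)

theorem tendstoInMeasure_const_mul {f : ℕ → Ω → ℂ} {h : Ω → ℂ} (a : ℂ)
    (h1 : TendstoInMeasure P f atTop h) :
    TendstoInMeasure P (fun n ω => a * f n ω) atTop (fun ω => a * h ω) := by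
  rcases eq_or_ne a 0 with rfl | ha
  · intro δ hδ
    simp [hδ.ne']
  · refine tendstoInMeasure_of_ne_top fun δ hδ hδt => ?_
    have h2 := h1 (δ / ‖a‖ₑ) (ENNReal.div_pos hδ.ne' enorm_ne_top)
    refine h2.congr fun n => ?_
    congr 1
    ext ω
    simp only [Set.mem_ofPred_eq]
    rw [edist_eq_enorm_sub, edist_eq_enorm_sub, ← mul_sub, enorm_mul,
      ENNReal.div_le_iff (by simpa using ha) enorm_ne_top, mul_comm]

theorem continuous_real_trigSum (β : ℝ) (s : Finset ℤ) (t : ℤ → ℂ) :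
    Continuous (trigSum β s t) := by
  unfold trigSum
  fun_prop

theorem periodic_trigSum {β : ℝ} (hβ : 0 < β) (s : Finset ℤ) (t : ℤ → ℂ) :
    Function.Periodic (trigSum β s t) (2 * Real.pi / β) := by
  intro τ
  refine Finset.sum_congr rfl fun k _ => ?_
  congr 1
  rw [Complex.exp_eq_exp_iff_exists_int]
  refine ⟨k, ?_⟩
  push_cast
  have : (β : ℂ) ≠ 0 := by exact_mod_cast hβ.ne'
  field_simp

/-- If `H - a cos (β ·)` is an `L¹` limit of trigonometric polynomials of a class for which the
corresponding random variables tend to zero in `L¹` uniformly over the class, then the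
approximations built from `H` converge to `a cos (β X)`. -/
theorem convergesToMultiple_of_trigSum_approx [NeZero d] (hX : IsLogCorrelatedField P U g X)
    {β : ℝ} (hβ : 0 < β) {η : Bump d} {c : ℕ → ℝ} (hc : ∀ n, 0 < c n)
    (hct : Tendsto c atTop (𝓝 0)) {H : ℝ → ℝ}
    (hH : IsEvenMeanZeroPeriodic (2 * Real.pi / β) H) {cosX : 𝓓(U, ℂ) → Ω → ℂ}
    (hcos : IsCosine P U X β cosX) {A : Finset ℤ → (ℤ → ℂ) → Prop} {a : ℝ}
    (happ : ∀ δ > 0, ∃ (s : Finset ℤ) (t : ℤ → ℂ), A s t ∧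
      ∫ τ in Set.Ioc 0 (2 * Real.pi / β),
        ‖(H τ : ℂ) - (a * Real.cos (β * τ) : ℝ) - trigSum β s t τ‖ ≤ δ)
    (hdecay : ∀ φ : 𝓓(U, ℂ), ∃ κ : ℕ → ENNReal, Tendsto κ atTop (𝓝 0) ∧ ∀ᶠ n in atTop,
      ∀ s t, A s t → eLpNorm (fun ω => ∑ k ∈ s, t k * waveIntegral P U X η β (c n) φ k ω) 1 P ≤
        κ n) :
    ConvergesToMultiple P U X η c β H cosX := by
  have : IsProbabilityMeasure P := hX.gaussian.isProbabilityMeasure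
  have hT : 0 < 2 * Real.pi / β := div_pos Real.two_pi_pos hβ
  refine ⟨a, fun φ => ?_⟩
  obtain ⟨ε₀, hε₀, hbd⟩ := exists_fieldIntegral_bound hX η β hT φ
  obtain ⟨κ, hκ, hκn⟩ := hdecay φ
  have hsmall : ∀ᶠ n in atTop, c n ≤ ε₀ := (hct.eventually_lt_const hε₀).mono fun n h => h.le
  have hHl : LocallyIntegrable fun τ => (H τ : ℂ) := fun x =>
    (hH.locallyIntegrable x).imp fun s hs => ⟨hs.1, hs.2.ofReal⟩
  have hHp : Function.Periodic (fun τ => (H τ : ℂ)) (2 * Real.pi / β) := fun τ => by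
    simp only [hH.periodic τ]
  have hren : ∀ n, renormIntegral P U X η β (c n) H φ =
      fieldIntegral P U X η β (c n) φ fun τ => (H τ : ℂ) := fun n => by
    funext ω
    simp only [renormIntegral, fieldIntegral, renormIntegrand_eq]
  have hcosl : LocallyIntegrable fun τ => ((a * Real.cos (β * τ) : ℝ) : ℂ) :=
    (by fun_prop : Continuous fun τ : ℝ => ((a * Real.cos (β * τ) : ℝ) : ℂ)).locallyIntegrable
  have hcosp : Function.Periodic (fun τ => ((a * Real.cos (β * τ) : ℝ) : ℂ))
      (2 * Real.pi / β) := fun τ => by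
    have : β * (τ + 2 * Real.pi / β) = β * τ + 2 * Real.pi := by field_simp
    simp only [this, Real.cos_add_two_pi]
  have hrencos : ∀ n ω, fieldIntegral P U X η β (c n) φ
      (fun τ => ((a * Real.cos (β * τ) : ℝ) : ℂ)) ω =
      a * renormIntegral P U X η β (c n) (fun τ => Real.cos (β * τ)) φ ω := fun n ω => by
    simp only [renormIntegral, fieldIntegral, renormIntegrand_eq]
    rw [← integral_const_mul]
    refine integral_congr_ae (ae_of_all _ fun x => ?_)
    push_cast
    ring
  refine ⟨?_, ?_⟩
  · filter_upwards [hsmall] with n hn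
    obtain ⟨-, C, hC⟩ := hbd _ (hc n) hn
    obtain ⟨h1, h2, -⟩ := hC _ hHp hHl
    rw [hren]
    refine ⟨?_, h2.aemeasurable⟩
    filter_upwards [h1] with ω hω
    refine hω.congr (ae_of_all _ fun x => ?_)
    simp only [renormIntegrand_eq]
  · refine tendstoInMeasure_trans (f' := fun n ω => (a : ℂ) *
      renormIntegral P U X η β (c n) (fun τ => Real.cos (β * τ)) φ ω) ?_
      (tendstoInMeasure_const_mul _ ((hcos φ).2 η c hc hct))
    have hkey : ∀ᶠ n in atTop,
        AEStronglyMeasurable (renormIntegral P U X η β (c n) H φ - fun ω => (a : ℂ) *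
          renormIntegral P U X η β (c n) (fun τ => Real.cos (β * τ)) φ ω) P ∧
        eLpNorm (renormIntegral P U X η β (c n) H φ - fun ω => (a : ℂ) *
          renormIntegral P U X η β (c n) (fun τ => Real.cos (β * τ)) φ ω) 1 P ≤ κ n := by
      filter_upwards [hsmall, hκn] with n hn hk
      obtain ⟨⟨B, hB⟩, C, hC⟩ := hbd _ (hc n) hn
      obtain ⟨h1, h2, -⟩ := hC _ hHp hHl
      obtain ⟨h3, h4, -⟩ := hC _ hcosp hcosl
      have hfun : (renormIntegral P U X η β (c n) H φ - fun ω => (a : ℂ) *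
          renormIntegral P U X η β (c n) (fun τ => Real.cos (β * τ)) φ ω) =
          fieldIntegral P U X η β (c n) φ (fun τ => (H τ : ℂ)) -
          fieldIntegral P U X η β (c n) φ (fun τ => ((a * Real.cos (β * τ) : ℝ) : ℂ)) := by
        funext ω
        simp only [Pi.sub_apply, hrencos, hren]
      rw [hfun]
      refine ⟨h2.sub h4, ?_⟩
      refine ENNReal.le_of_forall_pos_le_add fun δ hδ _ => ?_
      obtain ⟨s, t, hA, hst⟩ := happ (δ / (C + 1)) (by positivity)
      have htl := (continuous_real_trigSum β s t).locallyIntegrable (μ := volume)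
      have hRl := (hHl.sub hcosl).sub htl
      have hRp := (hHp.sub hcosp).sub (periodic_trigSum hβ s t)
      obtain ⟨h5, h6, h7⟩ := hC _ hRp hRl
      have hZm : AEStronglyMeasurable
          (fun ω => ∑ k ∈ s, t k * waveIntegral P U X η β (c n) φ k ω) P :=
        Finset.aestronglyMeasurable_fun_sum _ fun k _ =>
          (aestronglyMeasurable_waveIntegral hX η β (c n) φ.continuous.measurable k).const_mul _
      have hsplit : fieldIntegral P U X η β (c n) φ (fun τ => (H τ : ℂ)) -
          fieldIntegral P U X η β (c n) φ (fun τ => ((a * Real.cos (β * τ) : ℝ) : ℂ)) =ᵐ[P]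
          fieldIntegral P U X η β (c n) φ (((fun τ => (H τ : ℂ)) -
            fun τ => ((a * Real.cos (β * τ) : ℝ) : ℂ)) - trigSum β s t) +
          fun ω => ∑ k ∈ s, t k * waveIntegral P U X η β (c n) φ k ω := by
        filter_upwards [h1, h3] with ω i1 i2
        have i3 : ∀ k ∈ s, IntegrableOn (fun x => t k * (waveWeight P X η β (c n) φ x *
            Complex.exp ((k * β * mollify X η (c n) x ω : ℝ) * Complex.I)))
            (U : Set (Space d)) := fun k _ =>
          (integrableOn_wave hX η β (c n) φ.continuous.measurable hB k ω).const_mul _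
        have i4 : ∑ k ∈ s, t k * waveIntegral P U X η β (c n) φ k ω =
            ∫ x in (U : Set (Space d)), waveWeight P X η β (c n) φ x *
              trigSum β s t (mollify X η (c n) x ω) := by
          simp only [waveIntegral, ← integral_const_mul]
          rw [← integral_finsetSum _ i3]
          refine integral_congr_ae (ae_of_all _ fun x => ?_)
          simp only [trigSum, Finset.mul_sum]
          refine Finset.sum_congr rfl fun k _ => ?_
          ring
        have i5 : IntegrableOn (fun x => waveWeight P X η β (c n) φ x *
              trigSum β s t (mollify X η (c n) x ω)) (U : Set (Space d)) := by
          have := integrable_finsetSum s i3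
          refine this.congr (ae_of_all _ fun x => ?_)
          simp only [trigSum, Finset.mul_sum]
          refine Finset.sum_congr rfl fun k _ => ?_
          ring
        simp only [Pi.sub_apply, Pi.add_apply, i4, fieldIntegral]
        have i6 := integral_sub i1 i2
        have i7 := integral_sub (i1.sub i2) i5
        rw [← i6, ← sub_eq_iff_eq_add]
        refine i7.symm.trans ?_
        refine integral_congr_ae (ae_of_all _ fun x => ?_)
        simp only [Pi.sub_apply]
        ring
      rw [eLpNorm_congr_ae hsplit]
      refine (eLpNorm_add_le h6 hZm le_rfl).trans ?_
      rw [add_comm]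
      refine add_le_add (hk s t hA) (h7.trans ?_)
      calc (C : ENNReal) * ENNReal.ofReal _ ≤ C * ENNReal.ofReal (δ / (C + 1)) := by
            gcongr
            exact hst
        _ = ENNReal.ofReal (C * (δ / (C + 1))) := by
            rw [ENNReal.ofReal_mul C.coe_nonneg, ENNReal.ofReal_coe_nnreal]
        _ ≤ ENNReal.ofReal δ := by
            refine ENNReal.ofReal_le_ofReal ?_
            rw [mul_div_assoc', div_le_iff₀ (by positivity)]
            have : (0 : ℝ) ≤ δ := δ.2
            nlinarith [C.2]
        _ = δ := ENNReal.ofReal_coe_nnreal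
    refine tendstoInMeasure_of_eventually one_ne_zero (hkey.mono fun n h => h.1)
      aestronglyMeasurable_const ?_
    refine tendsto_of_tendsto_of_tendsto_of_le_of_le' tendsto_const_nhds hκ
      (Eventually.of_forall fun n => zero_le) (hkey.mono fun n h => ?_)
    refine le_trans (le_of_eq ?_) h.2
    congr 1
    exact sub_zero _

/-- The random generalized function `cos (β X)` exists. -/
theorem exists_isCosine [NeZero d] (hX : IsLogCorrelatedField P U g X) {β : ℝ}
    (hβd : β ^ 2 < d) : ∃ cosX : 𝓓(U, ℂ) → Ω → ℂ, IsCosine P U X β cosX := by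
  have : IsProbabilityMeasure P := hX.gaussian.isProbabilityMeasure
  choose W hW hWt using fun φ : 𝓓(U, ℂ) =>
    exists_waveIntegral_limit hX hβd φ (k := 1) (by norm_num)
  choose W' hW' hWt' using fun φ : 𝓓(U, ℂ) =>
    exists_waveIntegral_limit hX hβd φ (k := -1) (by norm_num)
  refine ⟨fun φ => (1 / 2 : ℂ) • (W φ + W' φ), fun φ => ?_⟩
  have hWm := (hW φ).aestronglyMeasurable
  have hWm' := (hW' φ).aestronglyMeasurable
  refine ⟨((hWm.add hWm').const_smul _).aemeasurable, fun η c hc hct => ?_⟩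
  obtain ⟨ε₀, hε₀, hB⟩ := exists_waveWeight_bound hX η β φ
  have heq : ∀ᶠ n in atTop,
      renormIntegral P U X η β (c n) (fun t => Real.cos (β * t)) φ =
      (1 / 2 : ℂ) • (waveIntegral P U X η β (c n) φ 1 + waveIntegral P U X η β (c n) φ (-1)) := by
    filter_upwards [hct.eventually_lt_const hε₀] with n hn
    obtain ⟨B, hB'⟩ := hB _ (hc n) hn.le
    exact renormIntegral_cos_eq hX η β (c n) φ.continuous.measurable hB'
  have hZm := fun n k =>
    aestronglyMeasurable_waveIntegral hX η β (c n) φ.continuous.measurable k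
  refine tendstoInMeasure_of_eventually two_ne_zero ?_ ((hWm.add hWm').const_smul _) ?_
  · filter_upwards [heq] with n hn
    rw [hn]
    exact ((hZm n 1).add (hZm n (-1))).const_smul _
  · have h1 := (hWt φ η c hc hct).add (hWt' φ η c hc hct)
    rw [add_zero] at h1
    refine tendsto_of_tendsto_of_tendsto_of_le_of_le' tendsto_const_nhds h1
      (Eventually.of_forall fun n => zero_le) ?_
    filter_upwards [heq] with n hn
    rw [hn, ← smul_sub, add_sub_add_comm]
    refine (eLpNorm_const_smul_le).trans ?_
    have h2 : ‖(1 / 2 : ℂ)‖ₑ ≤ 1 := by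
      rw [← ofReal_norm]
      norm_num
    refine (mul_le_of_le_one_left' h2).trans ?_
    exact eLpNorm_add_le ((hZm n 1).sub hWm) ((hZm n (-1)).sub hWm') (by norm_num)

end Transfer

/-! ### Decay of the modes of order at least two -/

section Decay

variable {d : ℕ} {Ω : Type*} [MeasurableSpace Ω] {P : Measure Ω} {U : Opens (Space d)}
  {g : Space d → Space d → ℝ} {X : Ω → (𝓢(Space d, ℝ) →L[ℝ] ℝ)}

/-- The mean `(E[X_ε(x)²] + E[X_ε(y)²]) / 2` of the variances at two points. -/
def meanVar (P : Measure Ω) (X : Ω → (𝓢(Space d, ℝ) →L[ℝ] ℝ)) (η : Bump d) (ε : ℝ)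
    (x y : Space d) : ℝ :=
  (mollCov P X η η ε ε x x + mollCov P X η η ε ε y y) / 2

/-- The excess of the mean variance over the absolute value of the covariance. It is nonnegative,
and it is large when the points are far apart in comparison with `ε`. -/
def covGap (P : Measure Ω) (X : Ω → (𝓢(Space d, ℝ) →L[ℝ] ℝ)) (η : Bump d) (ε : ℝ)
    (x y : Space d) : ℝ :=
  meanVar P X η ε x y - |mollCov P X η η ε ε x y|

/-- The kernel `e^{β² (|C| - G / 2)}`, where `C` is the covariance and `G` is `covGap`. -/
def decayKernel (P : Measure Ω) (X : Ω → (𝓢(Space d, ℝ) →L[ℝ] ℝ)) (η : Bump d) (β ε : ℝ)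
    (x y : Space d) : ℝ :=
  Real.exp (β ^ 2 * (|mollCov P X η η ε ε x y| - covGap P X η ε x y / 2))

theorem covGap_nonneg (hX : IsLogCorrelatedField P U g X) (η : Bump d) (ε : ℝ) (x y : Space d) :
    0 ≤ covGap P X η ε x y := by
  have := abs_mollCov_le hX η ε x y
  rw [covGap, meanVar]
  linarith

theorem momentFactor_le_decayKernel (hX : IsLogCorrelatedField P U g X) (η : Bump d) (β ε : ℝ)
    {k : ℤ} (hk : 2 ≤ |k|) (x y : Space d) :
    momentFactor P X η η β ε ε k k x y ≤ decayKernel P X η β ε x y := by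
  have hG := covGap_nonneg hX η ε x y
  have hk2 : (2 : ℝ) ≤ |(k : ℝ)| := by exact_mod_cast hk
  have hk4 : (4 : ℝ) ≤ (k : ℝ) ^ 2 := by
    rw [← sq_abs]
    nlinarith
  rw [momentFactor, decayKernel, Real.exp_le_exp]
  have hC := le_abs_self (mollCov P X η η ε ε x y)
  have h1 : (1 - (k : ℝ) ^ 2) * mollCov P X η η ε ε x x +
      (1 - (k : ℝ) ^ 2) * mollCov P X η η ε ε y y +
      2 * k * k * mollCov P X η η ε ε x y ≤
      2 * (|mollCov P X η η ε ε x y| - covGap P X η ε x y / 2) := by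
    rw [covGap, meanVar] at *
    nlinarith [mul_le_mul_of_nonneg_left hC (sq_nonneg (k : ℝ))]
  nlinarith [sq_nonneg β]

theorem measurable_decayKernel [SFinite P] (hX : IsLogCorrelatedField P U g X) (η : Bump d)
    (β ε : ℝ) : Measurable fun w : Space d × Space d => decayKernel P X η β ε w.1 w.2 := by
  have h1 := measurable_mollCov hX η η ε ε
  have h2 : Measurable fun w : Space d × Space d => mollCov P X η η ε ε w.1 w.1 :=
    h1.comp (f := fun w : Space d × Space d => (w.1, w.1)) (by fun_prop)
  have h3 : Measurable fun w : Space d × Space d => mollCov P X η η ε ε w.2 w.2 :=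
    h1.comp (f := fun w : Space d × Space d => (w.2, w.2)) (by fun_prop)
  unfold decayKernel covGap meanVar
  have h4 : Measurable fun w : Space d × Space d => |mollCov P X η η ε ε w.1 w.2| :=
    measurable_abs.comp h1
  exact Real.measurable_exp.comp
    ((h4.sub ((((h2.add h3).div_const 2).sub h4).div_const 2)).const_mul _)

/-- The integrals of the decay kernel against a test function vanish in the limit: off the
diagonal the covariances stay bounded while the variances blow up. -/
theorem tendsto_integral_decayKernel [NeZero d] (hX : IsLogCorrelatedField P U g X) {β : ℝ}
    (hβ : 0 < β) (hβd : β ^ 2 < d) (φ : 𝓓(U, ℂ)) (η : Bump d) {c : ℕ → ℝ} (hc : ∀ n, 0 < c n)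
    (hct : Tendsto c atTop (𝓝 0)) :
    (∀ᶠ n in atTop, Integrable (fun w : Space d × Space d =>
      ‖φ w.1‖ * ‖φ w.2‖ * decayKernel P X η β (c n) w.1 w.2)
      ((volume.restrict (U : Set (Space d))).prod (volume.restrict (U : Set (Space d))))) ∧
    Tendsto (fun n => ∫ w : Space d × Space d,
      ‖φ w.1‖ * ‖φ w.2‖ * decayKernel P X η β (c n) w.1 w.2
      ∂((volume.restrict (U : Set (Space d))).prod (volume.restrict (U : Set (Space d)))))
      atTop (𝓝 0) := by
  have : IsProbabilityMeasure P := hX.gaussian.isProbabilityMeasure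
  have hKc := φ.hasCompactSupport.isCompact
  obtain ⟨ε₀, hε₀, C, hC0, hC⟩ := exists_mollCov_bounds hX hKc φ.tsupport_subset η η
  obtain ⟨M, hM⟩ := φ.hasCompactSupport.exists_bound_of_continuous φ.continuous
  have hM0 : 0 ≤ M := (norm_nonneg _).trans (hM 0)
  obtain ⟨D, hD⟩ := Metric.isBounded_iff.1 hKc.isBounded
  have hD' : ∀ x ∈ tsupport φ, ∀ y ∈ tsupport φ, ‖x - y‖ ≤ |D| := fun x hx y hy => by
    rw [← dist_eq_norm]
    exact (hD hx hy).trans (le_abs_self D)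
  set C' : ℝ := C + |D| + |D| + 2 * ε₀ with hC'
  -- an upper bound for the absolute value of the covariance, as `log s ≤ s`
  have habs : ∀ ε, 0 < ε → ε ≤ ε₀ → ∀ x ∈ tsupport φ, ∀ y ∈ tsupport φ, x ≠ y →
      |mollCov P X η η ε ε x y| ≤ -Real.log ‖x - y‖ + C' := by
    intro ε h1 h2 x hx y hy hxy
    obtain ⟨h3, -, h4⟩ := hC ε ε h1 h2 h1 h2 x hx y hy
    have hr : 0 < ‖x - y‖ := norm_pos_iff.2 (sub_ne_zero.2 hxy)
    have h5 := Real.log_le_self hr.le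
    have h6 := Real.log_le_self (show 0 ≤ ‖x - y‖ + ε + ε by positivity)
    have h7 := hD' x hx y hy
    have h8 := h3 hxy
    have := abs_nonneg D
    rw [abs_le, hC']
    constructor <;> linarith
  have hev : ∀ᶠ n in atTop, c n ≤ ε₀ := (hct.eventually_lt_const hε₀).mono fun n h => h.le
  have hmeas : ∀ n, AEStronglyMeasurable (fun w : Space d × Space d =>
      ‖φ w.1‖ * ‖φ w.2‖ * decayKernel P X η β (c n) w.1 w.2)
      ((volume.restrict (U : Set (Space d))).prod (volume.restrict (U : Set (Space d)))) := by
    intro n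
    have h2 : Measurable fun w : Space d × Space d => ‖φ w.1‖ :=
      (φ.continuous.norm).measurable.comp measurable_fst
    have h3 : Measurable fun w : Space d × Space d => ‖φ w.2‖ :=
      (φ.continuous.norm).measurable.comp measurable_snd
    exact ((h2.mul h3).mul (measurable_decayKernel hX η β (c n))).aestronglyMeasurable
  have hdom : Integrable (fun w : Space d × Space d =>
      M * M * (Real.exp (β ^ 2 * C') * ‖w.1 - w.2‖ ^ (-(β ^ 2))))
      ((volume.restrict (U : Set (Space d))).prod (volume.restrict (U : Set (Space d)))) :=
    ((integrable_norm_sub_rpow_neg U.isOpen.measurableSet hX.kernel.bounded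
      hβd).const_mul _).const_mul _
  have hle : ∀ᶠ n in atTop, ∀ᵐ w : Space d × Space d
      ∂((volume.restrict (U : Set (Space d))).prod (volume.restrict (U : Set (Space d)))),
      ‖‖φ w.1‖ * ‖φ w.2‖ * decayKernel P X η β (c n) w.1 w.2‖ ≤
      M * M * (Real.exp (β ^ 2 * C') * ‖w.1 - w.2‖ ^ (-(β ^ 2))) := by
    filter_upwards [hev] with n hn
    filter_upwards [ae_fst_ne_snd (U : Set (Space d))] with w hw
    by_cases hx : w.1 ∈ tsupport φ
    · by_cases hy : w.2 ∈ tsupport φ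
      · rw [norm_mul, norm_mul, norm_norm, norm_norm, decayKernel, Real.norm_eq_abs, Real.abs_exp,
          ← exp_mul_neg_log_add (norm_pos_iff.2 (sub_ne_zero.2 hw))]
        have h1 := covGap_nonneg hX η (c n) w.1 w.2
        have h2 := habs _ (hc n) hn _ hx _ hy hw
        gcongr
        · exact hM _
        · exact hM _
        · linarith
      · rw [image_eq_zero_of_notMem_tsupport hy]
        simp only [mul_zero, zero_mul, norm_zero]
        positivity
    · rw [image_eq_zero_of_notMem_tsupport hx]
      simp only [zero_mul, norm_zero]
      positivity
  refine ⟨hle.mono fun n hn => hdom.mono' (hmeas n) hn, ?_⟩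
  rw [← integral_zero (Space d × Space d) ℝ (μ := (volume.restrict (U : Set (Space d))).prod
    (volume.restrict (U : Set (Space d))))]
  refine tendsto_integral_filter_of_dominated_convergence _ (Eventually.of_forall hmeas) hle hdom ?_
  filter_upwards [ae_fst_ne_snd (U : Set (Space d))] with w hw
  by_cases hx : w.1 ∈ tsupport φ
  · by_cases hy : w.2 ∈ tsupport φ
    · have h1 := (tendsto_mollCov hX η η (Eventually.of_forall hc) (Eventually.of_forall hc) hct hct
        (φ.tsupport_subset hx) (φ.tsupport_subset hy) hw).abs
      have h2 : Tendsto (fun n => meanVar P X η (c n) w.1 w.2) atTop atTop := by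
        have h3 : Tendsto (fun n => -Real.log (c n + c n) - C) atTop atTop := by
          refine tendsto_atTop_add_const_right _ _ (tendsto_neg_atBot_atTop.comp ?_)
          refine Real.tendsto_log_nhdsGT_zero.comp (tendsto_nhdsWithin_iff.2 ⟨?_, ?_⟩)
          · simpa using hct.add hct
          · exact Eventually.of_forall fun n => add_pos (hc n) (hc n)
        refine tendsto_atTop_mono' _ ?_ h3
        filter_upwards [hev] with n hn
        have h4 := (hC _ _ (hc n) hn (hc n) hn _ hx _ hx).2.2
        have h5 := (hC _ _ (hc n) hn (hc n) hn _ hy _ hy).2.2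
        rw [sub_self, norm_zero, zero_add] at h4 h5
        rw [meanVar]
        linarith
      have h6 : Tendsto (fun n => decayKernel P X η β (c n) w.1 w.2) atTop (𝓝 0) := by
        refine Real.tendsto_exp_atBot.comp ?_
        have h7 := (h1.const_mul (3 / 2)).add_atBot
          ((tendsto_neg_atTop_atBot.comp h2).const_mul_atBot (show (0 : ℝ) < 1 / 2 by norm_num))
        refine (h7.const_mul_atBot (show 0 < β ^ 2 by positivity)).congr fun n => ?_
        simp only [Function.comp, covGap]
        ring
      simpa using h6.const_mul (‖φ w.1‖ * ‖φ w.2‖)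
    · rw [image_eq_zero_of_notMem_tsupport hy]
      simp
  · rw [image_eq_zero_of_notMem_tsupport hx]
    simp

/-- The second moment of a linear combination of the modes. -/
theorem integral_norm_sq_sum_le (hX : IsLogCorrelatedField P U g X) (η : Bump d) (β : ℝ)
    {ε : ℝ} {φ : Space d → ℂ} (hφ : Measurable φ) {B : ℝ}
    (hB : ∀ x, ‖waveWeight P X η β ε φ x‖ ≤ B) (s : Finset ℤ) (t : ℤ → ℂ) :
    ∫ ω, ‖∑ k ∈ s, t k * waveIntegral P U X η β ε φ k ω‖ ^ 2 ∂P ≤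
      ∑ k ∈ s, ∑ j ∈ s, ‖t k‖ * ‖t j‖ * ∫ w : Space d × Space d,
        ‖φ w.1‖ * ‖φ w.2‖ * momentFactor P X η η β ε ε k j w.1 w.2
        ∂((volume.restrict (U : Set (Space d))).prod (volume.restrict (U : Set (Space d)))) := by
  have : IsProbabilityMeasure P := hX.gaussian.isProbabilityMeasure
  have hm := fun k => memLp_waveIntegral hX η β ε hφ hB k
  have hi : ∀ k j, Integrable (fun ω => t k * (starRingEnd ℂ) (t j) *
      (waveIntegral P U X η β ε φ k ω * (starRingEnd ℂ) (waveIntegral P U X η β ε φ j ω))) P :=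
    fun k j => ((hm k).integrable_mul (hm j).star).const_mul _
  have h1 : ((∫ ω, ‖∑ k ∈ s, t k * waveIntegral P U X η β ε φ k ω‖ ^ 2 ∂P : ℝ) : ℂ) =
      ∑ k ∈ s, ∑ j ∈ s, t k * (starRingEnd ℂ) (t j) * ∫ w : Space d × Space d,
        φ w.1 * (starRingEnd ℂ) (φ w.2) * (momentFactor P X η η β ε ε k j w.1 w.2 : ℝ)
        ∂((volume.restrict (U : Set (Space d))).prod (volume.restrict (U : Set (Space d)))) := by
    simp only [← integral_waveIntegral_mul_conj hX η η β hφ hB hB, ← integral_const_mul]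
    have e1 : ∀ k ∈ s, ∑ j ∈ s, ∫ ω, t k * (starRingEnd ℂ) (t j) *
        (waveIntegral P U X η β ε φ k ω * (starRingEnd ℂ) (waveIntegral P U X η β ε φ j ω)) ∂P =
        ∫ ω, ∑ j ∈ s, t k * (starRingEnd ℂ) (t j) *
        (waveIntegral P U X η β ε φ k ω *
          (starRingEnd ℂ) (waveIntegral P U X η β ε φ j ω)) ∂P :=
      fun k _ => (integral_finsetSum _ fun j _ => hi k j).symm
    rw [Finset.sum_congr rfl e1,
      ← integral_finsetSum _ fun k _ => integrable_finsetSum _ fun j _ => hi k j]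
    refine Eq.trans (integral_ofReal (𝕜 := ℂ)).symm ?_
    refine integral_congr_ae (ae_of_all _ fun ω => ?_)
    simp only [Complex.coe_algebraMap, Complex.ofReal_pow]
    rw [← Complex.mul_conj', map_sum, Finset.sum_mul_sum]
    refine Finset.sum_congr rfl fun k _ => Finset.sum_congr rfl fun j _ => ?_
    rw [map_mul]
    ring
  have h0 : 0 ≤ ∫ ω, ‖∑ k ∈ s, t k * waveIntegral P U X η β ε φ k ω‖ ^ 2 ∂P :=
    integral_nonneg fun ω => by positivity
  rw [← Complex.norm_of_nonneg h0, h1]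
  refine (norm_sum_le _ _).trans (Finset.sum_le_sum fun k _ => ?_)
  refine (norm_sum_le _ _).trans (Finset.sum_le_sum fun j _ => ?_)
  rw [norm_mul, norm_mul, RCLike.norm_conj]
  gcongr
  refine (norm_integral_le_integral_norm _).trans (le_of_eq ?_)
  refine integral_congr_ae (ae_of_all _ fun w => ?_)
  simp only [norm_mul, RCLike.norm_conj, Complex.norm_real, Real.norm_eq_abs]
  rw [abs_of_pos (a := momentFactor P X η η β ε ε k j w.1 w.2) (Real.exp_pos _)]

theorem eLpNorm_one_le_sqrt [IsProbabilityMeasure P] {f : Ω → ℂ} (hf : MemLp f 2 P) :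
    eLpNorm f 1 P ≤ ENNReal.ofReal (Real.sqrt (∫ ω, ‖f ω‖ ^ 2 ∂P)) := by
  rw [← eLpNorm_two_eq_sqrt hf]
  exact eLpNorm_le_eLpNorm_of_exponent_le (by norm_num) hf.aestronglyMeasurable

/-- The combinations of modes of order at least two with bounded `ℓ¹` norm of the coefficients
vanish in the limit. -/
theorem exists_decay_of_summable [NeZero d] (hX : IsLogCorrelatedField P U g X) {β : ℝ}
    (hβ : 0 < β) (hβd : β ^ 2 < d) (φ : 𝓓(U, ℂ)) (η : Bump d) {c : ℕ → ℝ} (hc : ∀ n, 0 < c n)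
    (hct : Tendsto c atTop (𝓝 0)) (M : ℝ) :
    ∃ κ : ℕ → ENNReal, Tendsto κ atTop (𝓝 0) ∧ ∀ᶠ n in atTop, ∀ (s : Finset ℤ) (t : ℤ → ℂ),
      ((∀ k ∈ s, 2 ≤ |k|) ∧ ∑ k ∈ s, ‖t k‖ ≤ M) →
      eLpNorm (fun ω => ∑ k ∈ s, t k * waveIntegral P U X η β (c n) φ k ω) 1 P ≤ κ n := by
  have : IsProbabilityMeasure P := hX.gaussian.isProbabilityMeasure
  obtain ⟨hint, hlim⟩ := tendsto_integral_decayKernel hX hβ hβd φ η hc hct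
  obtain ⟨ε₀, hε₀, hw⟩ := exists_waveWeight_bound hX η β φ
  set b : ℕ → ℝ := fun n => ∫ w : Space d × Space d,
      ‖φ w.1‖ * ‖φ w.2‖ * decayKernel P X η β (c n) w.1 w.2
      ∂((volume.restrict (U : Set (Space d))).prod (volume.restrict (U : Set (Space d)))) with hb
  refine ⟨fun n => ENNReal.ofReal (M * Real.sqrt (b n)), ?_, ?_⟩
  · have h1 := ENNReal.tendsto_ofReal
      (((Real.continuous_sqrt.tendsto _).comp hlim).const_mul M)
    simpa using h1
  · filter_upwards [hint, hct.eventually_lt_const hε₀] with n hn hcn s t ⟨hs, ht⟩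
    obtain ⟨B, hB⟩ := hw _ (hc n) hcn.le
    have hm := fun k => memLp_waveIntegral hX η β (c n) φ.continuous.measurable hB k
    have hone : ∀ k ∈ s, eLpNorm (fun ω => t k * waveIntegral P U X η β (c n) φ k ω) 1 P ≤
        ENNReal.ofReal (‖t k‖ * Real.sqrt (b n)) := by
      intro k hk
      have h1 := integral_norm_sq_sum_le hX η β φ.continuous.measurable hB {k} t
      simp only [Finset.sum_singleton] at h1
      have h2 : ∫ w : Space d × Space d,
          ‖φ w.1‖ * ‖φ w.2‖ * momentFactor P X η η β (c n) (c n) k k w.1 w.2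
          ∂((volume.restrict (U : Set (Space d))).prod (volume.restrict (U : Set (Space d)))) ≤
          b n := by
        refine integral_mono_of_nonneg (ae_of_all _ fun w => ?_) hn (ae_of_all _ fun w => ?_)
        · exact mul_nonneg (mul_nonneg (norm_nonneg _) (norm_nonneg _)) (Real.exp_pos _).le
        · exact mul_le_mul_of_nonneg_left (momentFactor_le_decayKernel hX η β _ (hs k hk) _ _)
            (mul_nonneg (norm_nonneg _) (norm_nonneg _))
      refine (eLpNorm_one_le_sqrt ((hm k).const_mul (t k))).trans (ENNReal.ofReal_le_ofReal ?_)
      rw [Real.sqrt_le_left (by positivity), mul_pow]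
      refine h1.trans ?_
      have h3 : 0 ≤ b n := integral_nonneg fun w =>
        mul_nonneg (mul_nonneg (norm_nonneg _) (norm_nonneg _)) (Real.exp_pos _).le
      rw [Real.sq_sqrt h3, ← pow_two]
      gcongr
    have h4 : (fun ω => ∑ k ∈ s, t k * waveIntegral P U X η β (c n) φ k ω) =
        ∑ k ∈ s, fun ω => t k * waveIntegral P U X η β (c n) φ k ω := by
      funext ω
      simp
    rw [h4]
    refine (eLpNorm_sum_le (fun k _ => ((hm k).const_mul (t k)).aestronglyMeasurable)
      le_rfl).trans ?_
    refine (Finset.sum_le_sum hone).trans ?_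
    rw [← ENNReal.ofReal_sum_of_nonneg fun k _ => by positivity, ← Finset.sum_mul]
    refine ENNReal.ofReal_le_ofReal ?_
    gcongr

end Decay

/-! ### Increments of the convolution approximations at the smallest scale -/

section Increments

variable {d : ℕ} {Ω : Type*} [MeasurableSpace Ω] {P : Measure Ω} {U : Opens (Space d)}
  {g : Space d → Space d → ℝ} {X : Ω → (𝓢(Space d, ℝ) →L[ℝ] ℝ)}

theorem exists_lipschitzOnWith_of_contDiffOn
    (hg : ContDiffOn ℝ 2 (Function.uncurry g) ((U : Set (Space d)) ×ˢ (U : Set (Space d))))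
    {K : Set (Space d)} (hK : IsCompact K) (hKU : K ⊆ U) :
    ∃ L : NNReal, LipschitzOnWith L (Function.uncurry g) (K ×ˢ K) := by
  refine LocallyLipschitzOn.exists_lipschitzOnWith_of_compact (hK.prod hK) fun x hx => ?_
  have hU : (U : Set (Space d)) ×ˢ (U : Set (Space d)) ∈ 𝓝 x :=
    (U.isOpen.prod U.isOpen).mem_nhds (Set.prod_mono hKU hKU hx)
  obtain ⟨L, t, ht, hL⟩ := ((hg.contDiffAt hU).of_le (by norm_num)).exists_lipschitzOnWith
  exact ⟨L, t, mem_nhdsWithin_of_mem_nhds ht, hL⟩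

theorem abs_smoothPart_sub_smoothPart_le {K : Set (Space d)} (hK : IsCompact K) {δ : ℝ}
    {L : NNReal} (hL : LipschitzOnWith L (Function.uncurry g)
      (Metric.cthickening δ K ×ˢ Metric.cthickening δ K)) (η : Bump d) {ε : ℝ} (hε : 0 < ε)
    (hεδ : ε ≤ δ) {x x' y y' : Space d} (hx : x ∈ K) (hx' : x' ∈ K) (hy : y ∈ K) (hy' : y' ∈ K) :
    |smoothPart g η η ε ε x y - smoothPart g η η ε ε x' y'| ≤ L * max ‖x - x'‖ ‖y - y'‖ := by
  have hg := hL.continuousOn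
  have hi := integrable_smoothPart hK hg η η hε hεδ hε hεδ hx hy
  have hi' := integrable_smoothPart hK hg η η hε hεδ hε hεδ hx' hy'
  rw [smoothPart, smoothPart, ← integral_sub hi hi', ← Real.norm_eq_abs]
  have h := norm_integral_le_of_norm_le_const (μ := η.law.prod η.law)
    (C := L * max ‖x - x'‖ ‖y - y'‖)
    (f := fun w => g (x - ε • w.1) (y - ε • w.2) - g (x' - ε • w.1) (y' - ε • w.2)) (by
      filter_upwards [ae_norm_lt_one_prod η η] with w hw
      have h1 := hL.dist_le_mul (x - ε • w.1, y - ε • w.2)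
        ⟨sub_smul_mem_cthickening hε hεδ hx hw.1, sub_smul_mem_cthickening hε hεδ hy hw.2⟩
        (x' - ε • w.1, y' - ε • w.2)
        ⟨sub_smul_mem_cthickening hε hεδ hx' hw.1, sub_smul_mem_cthickening hε hεδ hy' hw.2⟩
      rw [Prod.dist_eq, dist_sub_right, dist_sub_right, dist_eq_norm, dist_eq_norm,
        dist_eq_norm] at h1
      exact h1)
  simpa using h

theorem logPot_sub_logPot_le [NeZero d] (η : Bump d) {ε : ℝ} (hε : 0 < ε) {z z' : Space d} {ρ : ℝ}
    (hρ : ∀ h : Space d, ‖h‖ ≤ 2 * ε → ‖z' + h‖ ≤ ρ * ‖z + h‖) :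
    logPot η η ε ε z - logPot η η ε ε z' ≤ Real.log ρ := by
  have hi := integrable_log_norm η η hε hε z
  have hi' := integrable_log_norm η η hε hε z'
  rw [logPot, logPot, ← integral_sub hi hi']
  have := integral_mono_ae (hi.sub hi') (integrable_const (Real.log ρ)) (by
    filter_upwards [ae_norm_lt_one_prod η η, ae_ne_zero_prod η η ε hε z,
      ae_ne_zero_prod η η ε hε z'] with w hw h1 h2
    have h3 : ‖-(ε • w.1) + ε • w.2‖ ≤ 2 * ε := by
      refine (norm_add_le _ _).trans ?_
      rw [norm_neg, norm_smul, norm_smul, Real.norm_of_nonneg hε.le]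
      nlinarith [hw.1, hw.2]
    have h4 := hρ _ h3
    have e : ∀ z : Space d, z + (-(ε • w.1) + ε • w.2) = z - ε • w.1 + ε • w.2 := fun z => by
      abel
    rw [e, e] at h4
    have h5 := norm_pos_iff.2 h1
    have h6 := norm_pos_iff.2 h2
    have hρ0 : 0 < ρ := by
      by_contra h
      have := mul_nonpos_of_nonpos_of_nonneg (not_lt.1 h) h5.le
      linarith
    have h7 := Real.log_le_log h6 h4
    rw [Real.log_mul hρ0.ne' h5.ne'] at h7
    simp only [Pi.sub_apply]
    linarith)
  simpa using this

/-- The logarithmic part of the covariance between the increment over a step of length `r`, at most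
of order `ε`, and the increment between the points at distance `10 S ε` on both sides, all on one
line: it is negative, of order `r / ε`. -/
theorem logPot_increment_le [NeZero d] (η : Bump d) {ε S r : ℝ} (hε : 0 < ε) (hS : 1 ≤ S)
    (hr : 0 ≤ r) (hrS : r ≤ S * ε) {e : Space d} (he : ‖e‖ = 1) :
    logPot η η ε ε (-((10 * S * ε) • e)) - logPot η η ε ε (-((10 * S * ε) • e) + r • e) -
      logPot η η ε ε ((10 * S * ε) • e) + logPot η η ε ε ((10 * S * ε) • e + r • e) ≤
      -(r / (20 * S * ε)) := by
  have hS0 : 0 < S := by linarith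
  have hsq : ∀ w : Space d, ‖w + r • e‖ ^ 2 = ‖w‖ ^ 2 + 2 * r * inner ℝ w e + r ^ 2 := fun w => by
    rw [norm_add_sq_real, inner_smul_right, norm_smul, he, Real.norm_eq_abs, mul_one, sq_abs]
    ring
  have hinner : ∀ h : Space d, ‖h‖ ≤ 2 * ε → |inner ℝ h e| ≤ 2 * ε := fun h hh => by
    refine (abs_real_inner_le_norm h e).trans ?_
    rw [he, mul_one]
    exact hh
  have hee : ∀ a : ℝ, inner ℝ (a • e) e = a := fun a => by
    rw [inner_smul_left, real_inner_self_eq_norm_sq, he]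
    simp
  have hne : ∀ a : ℝ, 0 ≤ a → ‖a • e‖ = a := fun a ha => by
    rw [norm_smul, he, mul_one, Real.norm_of_nonneg ha]
  have h1 := logPot_sub_logPot_le η hε (z := -((10 * S * ε) • e))
    (z' := -((10 * S * ε) • e) + r • e) (ρ := Real.exp (-(r / (20 * S * ε)))) (by
      intro h hh
      set w : Space d := -((10 * S * ε) • e) + h with hw
      have e1 : -((10 * S * ε) • e) + r • e + h = w + r • e := by rw [hw]; abel
      rw [e1]
      have h2 : inner ℝ w e ≤ -(10 * S * ε) + 2 * ε := by
        rw [hw, inner_add_left, inner_neg_left, hee]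
        linarith [(abs_le.1 (hinner h hh)).2]
      have h3 : ‖w‖ ≤ 12 * S * ε := by
        refine (norm_add_le _ _).trans ?_
        rw [norm_neg, hne _ (by positivity)]
        nlinarith
      have h4 : ‖w + r • e‖ ^ 2 ≤ (Real.exp (-(r / (20 * S * ε))) * ‖w‖) ^ 2 := by
        have h5 : 1 - r / (10 * S * ε) ≤ Real.exp (-(r / (20 * S * ε))) ^ 2 := by
          rw [← Real.exp_nat_mul]
          have := Real.add_one_le_exp (-(r / (10 * S * ε)))
          have e2 : ((2 : ℕ) : ℝ) * -(r / (20 * S * ε)) = -(r / (10 * S * ε)) := by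
            push_cast
            field_simp
            ring
          rw [e2]
          linarith
        have h6 : ‖w‖ ^ 2 * (r / (10 * S * ε)) ≤ 15 * S * ε * r := by
          have : ‖w‖ ^ 2 ≤ (12 * S * ε) ^ 2 := by gcongr
          calc ‖w‖ ^ 2 * (r / (10 * S * ε)) ≤ (12 * S * ε) ^ 2 * (r / (10 * S * ε)) := by
                gcongr
            _ = 14.4 * S * ε * r := by
                field_simp
                ring
            _ ≤ 15 * S * ε * r := by
                have : 0 ≤ S * ε * r := by positivity
                nlinarith
        rw [hsq, mul_pow]
        have h7 : 0 ≤ ‖w‖ ^ 2 := by positivity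
        have h8 : 2 * r * inner ℝ w e ≤ 2 * r * (-(10 * S * ε) + 2 * ε) := by gcongr
        have h9 : r * r ≤ r * (S * ε) := by gcongr
        have h10 : r * ε ≤ r * (S * ε) := by
          gcongr
          nlinarith
        nlinarith
      exact abs_le_of_sq_le_sq' h4 (by positivity) |>.2)
  have h2 := logPot_sub_logPot_le η hε (z := (10 * S * ε) • e + r • e)
    (z' := (10 * S * ε) • e) (ρ := 1) (by
      intro h hh
      set w : Space d := (10 * S * ε) • e + h with hw
      have e1 : (10 * S * ε) • e + r • e + h = w + r • e := by rw [hw]; abel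
      rw [e1, one_mul]
      have h2 : 0 ≤ inner ℝ w e := by
        rw [hw, inner_add_left, hee]
        nlinarith [(abs_le.1 (hinner h hh)).1]
      refine abs_le_of_sq_le_sq' ?_ (norm_nonneg _) |>.2
      rw [hsq]
      have := mul_nonneg hr h2
      nlinarith [sq_nonneg r])
  rw [Real.log_exp] at h1
  rw [Real.log_one] at h2
  linarith

theorem sum_mollCov_nonneg (hX : IsLogCorrelatedField P U g X) (η : Bump d) (ε : ℝ)
    {ι : Type*} (s : Finset ι) (a : ι → ℝ) (p : ι → Space d) :
    0 ≤ ∑ i ∈ s, ∑ j ∈ s, a i * a j * mollCov P X η η ε ε (p i) (p j) := by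
  have hi : ∀ i j, Integrable (fun ω => a i * a j *
      (mollify X η ε (p i) ω * mollify X η ε (p j) ω)) P :=
    fun i j => (hX.integrable_mul _ _).const_mul _
  have h : ∑ i ∈ s, ∑ j ∈ s, a i * a j * mollCov P X η η ε ε (p i) (p j) =
      ∫ ω, (∑ i ∈ s, a i * mollify X η ε (p i) ω) ^ 2 ∂P := by
    have e1 : ∀ ω, (∑ i ∈ s, a i * mollify X η ε (p i) ω) ^ 2 = ∑ i ∈ s, ∑ j ∈ s, a i * a j *
        (mollify X η ε (p i) ω * mollify X η ε (p j) ω) := fun ω => by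
      rw [pow_two, Finset.sum_mul_sum]
      refine Finset.sum_congr rfl fun i _ => Finset.sum_congr rfl fun j _ => ?_
      ring
    simp only [e1]
    rw [integral_finsetSum _ fun i _ => integrable_finsetSum _ fun j _ => hi i j]
    refine Finset.sum_congr rfl fun i _ => ?_
    rw [integral_finsetSum _ fun j _ => hi i j]
    refine Finset.sum_congr rfl fun j _ => ?_
    rw [integral_const_mul, mollCov]
  rw [h]
  exact integral_nonneg fun ω => sq_nonneg _

theorem mollCov_comm (P : Measure Ω) (X : Ω → (𝓢(Space d, ℝ) →L[ℝ] ℝ)) (η : Bump d) (ε : ℝ)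
    (x y : Space d) : mollCov P X η η ε ε x y = mollCov P X η η ε ε y x := by
  simp only [mollCov, mul_comm]

/-- A lower bound for the variance of an increment, by the Cauchy–Schwarz inequality with another
increment. -/
theorem sq_div_le_mollCov_increment (hX : IsLogCorrelatedField P U g X) (η : Bump d) (ε : ℝ)
    {x y x' x'' : Space d} {q D : ℝ} (hq0 : 0 ≤ q) (hD0 : 0 < D)
    (hq : mollCov P X η η ε ε x x' - mollCov P X η η ε ε y x' - mollCov P X η η ε ε x x'' +
      mollCov P X η η ε ε y x'' ≤ -q)
    (hD : mollCov P X η η ε ε x' x' + mollCov P X η η ε ε x'' x'' -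
      2 * mollCov P X η η ε ε x' x'' ≤ D) :
    q ^ 2 / D ≤ mollCov P X η η ε ε x x + mollCov P X η η ε ε y y -
      2 * mollCov P X η η ε ε x y := by
  have h := sum_mollCov_nonneg hX η ε Finset.univ ![1, -1, q / D, -(q / D)] ![x, y, x', x'']
  simp only [Fin.sum_univ_four, Matrix.cons_val] at h
  rw [mollCov_comm P X η ε y x, mollCov_comm P X η ε x' x, mollCov_comm P X η ε x'' x,
    mollCov_comm P X η ε x' y, mollCov_comm P X η ε x'' y, mollCov_comm P X η ε x'' x'] at h
  have hl : 0 ≤ q / D := by positivity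
  have h1 := mul_le_mul_of_nonneg_left hq hl
  have h2 := mul_le_mul_of_nonneg_left hD (sq_nonneg (q / D))
  have h3 : (q / D) ^ 2 * D = q ^ 2 / D := by field_simp
  have h4 : q / D * q = q ^ 2 / D := by ring
  nlinarith

/-- Points at distance of order `ε` or less: the variance of the increment is at least of the order
of the squared distance in units of `ε`. -/
theorem exists_le_covGap [NeZero d] (hX : IsLogCorrelatedField P U g X)
    (hg : ContDiffOn ℝ 2 (Function.uncurry g) ((U : Set (Space d)) ×ˢ (U : Set (Space d))))
    {K : Set (Space d)} (hK : IsCompact K) (hKU : K ⊆ U) (η : Bump d) {S : ℝ} (hS : 1 ≤ S) :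
    ∃ ε₀ > 0, ∃ b > 0, ∀ ε, 0 < ε → ε ≤ ε₀ → ∀ x ∈ K, ∀ y ∈ K, ‖x - y‖ ≤ S * ε →
      b * (‖x - y‖ / ε) ^ 2 ≤ covGap P X η ε x y := by
  have hS0 : 0 < S := by linarith
  obtain ⟨δ, hδ, hδU⟩ := hK.exists_cthickening_subset_open U.isOpen hKU
  set K₁ := Metric.cthickening δ K with hK₁
  have hK₁c : IsCompact K₁ := hK.cthickening
  have hKK₁ : K ⊆ K₁ := Metric.self_subset_cthickening K
  obtain ⟨δ₁, hδ₁, hδ₁U⟩ := hK₁c.exists_cthickening_subset_open U.isOpen hδU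
  obtain ⟨L, hL⟩ := exists_lipschitzOnWith_of_contDiffOn hg
    (hK₁c.cthickening (r := δ₁)) hδ₁U
  obtain ⟨ε₂, hε₂, C, hC0, hC⟩ := exists_mollCov_bounds hX hK₁c hδU η η
  set D : ℝ := 4 * C + 2 * Real.log (20 * S + 2) + 1 with hDdef
  have hlog0 : 0 ≤ Real.log (20 * S + 2) := Real.log_nonneg (by linarith)
  have hD0 : 0 < D := by positivity
  set κ : ℝ := 1 / (40 * S) with hκ
  have hκ0 : 0 < κ := by positivity
  -- the four constraints: all points stay in the thickened set, the covariance bounds apply, the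
  -- smooth part is negligible, and the covariance of the two points is positive
  set ε₀ : ℝ := min (min (δ / (10 * S)) δ₁)
    (min (min ε₂ (κ / (2 * L + 1))) (Real.exp (-C) / (S + 2))) with hε₀
  have hε₀0 : 0 < ε₀ := by positivity
  refine ⟨ε₀, hε₀0, κ ^ 2 / (2 * D), by positivity, fun ε hε hεle x hx y hy hxy => ?_⟩
  have c1 : ε ≤ δ / (10 * S) := hεle.trans ((min_le_left _ _).trans (min_le_left _ _))
  have c2 : ε ≤ δ₁ := hεle.trans ((min_le_left _ _).trans (min_le_right _ _))
  have c3 : ε ≤ ε₂ := hεle.trans ((min_le_right _ _).trans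
    ((min_le_left _ _).trans (min_le_left _ _)))
  have c4 : ε ≤ κ / (2 * L + 1) := hεle.trans ((min_le_right _ _).trans
    ((min_le_left _ _).trans (min_le_right _ _)))
  have c5 : ε ≤ Real.exp (-C) / (S + 2) := hεle.trans ((min_le_right _ _).trans (min_le_right _ _))
  rw [le_div_iff₀ (by positivity)] at c1 c4 c5
  have hpos : 0 ≤ mollCov P X η η ε ε x y := by
    have h1 := (hC ε ε hε c3 hε c3 x (hKK₁ hx) y (hKK₁ hy)).2.2
    have h2 : Real.log (‖x - y‖ + ε + ε) ≤ -C := by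
      rw [← Real.log_exp (-C)]
      refine Real.log_le_log (by positivity) ?_
      linarith
    linarith
  rcases eq_or_ne x y with rfl | hne
  · rw [sub_self, norm_zero, zero_div]
    have := covGap_nonneg hX η ε x x
    simpa using this
  set r : ℝ := ‖x - y‖ with hrdef
  have hr : 0 < r := norm_pos_iff.2 (sub_ne_zero.2 hne)
  set e : Space d := r⁻¹ • (y - x) with hedef
  have he : ‖e‖ = 1 := by
    rw [hedef, norm_smul, norm_inv, Real.norm_of_nonneg hr.le, norm_sub_rev, ← hrdef,
      inv_mul_cancel₀ hr.ne']
  have hy' : y = x + r • e := by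
    rw [hedef, smul_inv_smul₀ hr.ne']
    abel
  have hR0 : 0 < 10 * S * ε := by positivity
  set x' : Space d := x + (10 * S * ε) • e with hx'
  set x'' : Space d := x - (10 * S * ε) • e with hx''
  have hne' : ‖(10 * S * ε) • e‖ = 10 * S * ε := by
    rw [norm_smul, he, mul_one, Real.norm_of_nonneg hR0.le]
  have mx' : x' ∈ K₁ := by
    refine Metric.mem_cthickening_of_dist_le _ x _ _ hx ?_
    rw [dist_eq_norm, hx', add_sub_cancel_left, hne']
    linarith
  have mx'' : x'' ∈ K₁ := by
    refine Metric.mem_cthickening_of_dist_le _ x _ _ hx ?_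
    rw [dist_eq_norm, hx'', sub_sub_cancel_left, norm_neg, hne']
    linarith
  have mx := hKK₁ hx
  have my := hKK₁ hy
  have hcov : ∀ p ∈ K₁, ∀ q ∈ K₁, mollCov P X η η ε ε p q =
      logPot η η ε ε (p - q) + smoothPart g η η ε ε p q := fun p hp q hq =>
    mollCov_eq hX hK₁c hδ₁U η η hε c2 hε c2 hp hq
  have hsm : ∀ q ∈ K₁, |smoothPart g η η ε ε x q - smoothPart g η η ε ε y q| ≤ L * r := by
    intro q hq
    have := abs_smoothPart_sub_smoothPart_le hK₁c hL η hε c2 mx my hq hq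
    rwa [sub_self, norm_zero, max_eq_left (norm_nonneg _)] at this
  have hinc := logPot_increment_le η hε hS hr.le hxy he
  have d1 : x - x' = -((10 * S * ε) • e) := by rw [hx']; abel
  have d2 : y - x' = -((10 * S * ε) • e) + r • e := by rw [hx', hy']; abel
  have d3 : x - x'' = (10 * S * ε) • e := by rw [hx'']; abel
  have d4 : y - x'' = (10 * S * ε) • e + r • e := by rw [hx'', hy']; abel
  have hq : mollCov P X η η ε ε x x' - mollCov P X η η ε ε y x' - mollCov P X η η ε ε x x'' +
      mollCov P X η η ε ε y x'' ≤ -(κ * (r / ε)) := by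
    rw [hcov x mx x' mx', hcov y my x' mx', hcov x mx x'' mx'', hcov y my x'' mx'', d1, d2, d3, d4]
    have h1 := (abs_le.1 (hsm x' mx')).2
    have h2 := (abs_le.1 (hsm x'' mx'')).1
    have h3 : 2 * (L * r) ≤ κ * (r / ε) := by
      rw [mul_div_assoc', le_div_iff₀ hε]
      have : ε * (2 * L) ≤ κ := by nlinarith
      nlinarith
    have h4 : r / (20 * S * ε) = 2 * (κ * (r / ε)) := by
      rw [hκ]
      field_simp
      norm_num
    linarith
  have hDle : mollCov P X η η ε ε x' x' + mollCov P X η η ε ε x'' x'' -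
      2 * mollCov P X η η ε ε x' x'' ≤ D := by
    have h1 := (hC ε ε hε c3 hε c3 x' mx' x' mx').2.1
    have h2 := (hC ε ε hε c3 hε c3 x'' mx'' x'' mx'').2.1
    have h3 := (hC ε ε hε c3 hε c3 x' mx' x'' mx'').2.2
    have h4 : ‖x' - x''‖ + ε + ε = (20 * S + 2) * ε := by
      have : x' - x'' = (2 : ℝ) • ((10 * S * ε) • e) := by
        rw [hx', hx'', two_smul]; abel
      rw [this, norm_smul, hne']
      norm_num
      ring
    rw [h4, Real.log_mul (by positivity) hε.ne'] at h3
    rw [hDdef]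
    linarith
  have hfin := sq_div_le_mollCov_increment hX η ε (by positivity) hD0 hq hDle
  rw [covGap, meanVar, abs_of_nonneg hpos]
  have : κ ^ 2 / (2 * D) * (r / ε) ^ 2 = (κ * (r / ε)) ^ 2 / D / 2 := by
    field_simp
  rw [this]
  linarith

end Increments

/-! ### Decay in the plane, for bounded coefficients -/

theorem sum_exp_abs_sub_sq_le {b : ℝ} (hb : 0 < b) (s : Finset ℤ) (k : ℤ) :
    ∑ j ∈ s, Real.exp (-b * (|(k : ℝ)| - |(j : ℝ)|) ^ 2) ≤
      2 * ∑' m : ℤ, Real.exp (-b * (m : ℝ) ^ 2) := by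
  have hs := summable_exp_neg_mul_sq_int hb
  have hshift : ∀ i : ℤ, ∑ j ∈ s, Real.exp (-b * ((i : ℝ) + j) ^ 2) ≤
      ∑' m : ℤ, Real.exp (-b * (m : ℝ) ^ 2) := by
    intro i
    have h1 := hs.comp_injective (Equiv.addLeft i).injective
    have h2 := h1.sum_le_tsum s fun j _ => (Real.exp_pos _).le
    rw [(Equiv.addLeft i).tsum_eq fun m : ℤ => Real.exp (-b * (m : ℝ) ^ 2)] at h2
    simpa using h2
  have h3 := hshift (-|k|)
  have h4 := hshift |k|
  rw [two_mul]
  refine le_trans ?_ (add_le_add h3 h4)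
  rw [← Finset.sum_add_distrib]
  refine Finset.sum_le_sum fun j _ => ?_
  push_cast
  rcases abs_cases (j : ℝ) with ⟨h, -⟩ | ⟨h, -⟩
  · have e1 : (|(k : ℝ)| - |(j : ℝ)|) ^ 2 = (-|(k : ℝ)| + j) ^ 2 := by rw [h]; ring
    rw [e1]
    linarith [Real.exp_pos (-b * (|(k : ℝ)| + j) ^ 2)]
  · have e1 : (|(k : ℝ)| - |(j : ℝ)|) ^ 2 = (|(k : ℝ)| + j) ^ 2 := by rw [h]; ring
    rw [e1]
    linarith [Real.exp_pos (-b * (-|(k : ℝ)| + j) ^ 2)]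

theorem exists_sum_exp_div_le {b : ℝ} (hb : 0 < b) :
    ∃ Θ : ℝ, ∀ s : Finset ℤ, (∀ k ∈ s, 2 ≤ |k|) → ∑ k ∈ s, ∑ j ∈ s,
      Real.exp (-b * (|(k : ℝ)| - |(j : ℝ)|) ^ 2) / (|(k : ℝ)| * |(j : ℝ)|) ≤ Θ := by
  set A := 2 * ∑' m : ℤ, Real.exp (-b * (m : ℝ) ^ 2) with hA
  have hA0 : 0 ≤ A := by
    have : 0 ≤ ∑' m : ℤ, Real.exp (-b * (m : ℝ) ^ 2) := tsum_nonneg fun m => (Real.exp_pos _).le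
    positivity
  have hsum : Summable fun k : ℤ => 1 / (k : ℝ) ^ 2 :=
    Real.summable_one_div_int_pow.2 one_lt_two
  refine ⟨A * ∑' k : ℤ, 1 / (k : ℝ) ^ 2, fun s hs => ?_⟩
  have hpos : ∀ k ∈ s, 0 < |(k : ℝ)| := fun k hk => by
    have : (2 : ℝ) ≤ |(k : ℝ)| := by exact_mod_cast hs k hk
    linarith
  set F : ℤ → ℤ → ℝ := fun k j => 1 / (k : ℝ) ^ 2 *
    Real.exp (-b * (|(k : ℝ)| - |(j : ℝ)|) ^ 2) with hF
  have h1 : ∀ k ∈ s, ∀ j ∈ s, Real.exp (-b * (|(k : ℝ)| - |(j : ℝ)|) ^ 2) /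
      (|(k : ℝ)| * |(j : ℝ)|) ≤ 1 / 2 * F k j + 1 / 2 * F j k := by
    intro k hk j hj
    have hk0 := hpos k hk
    have hj0 := hpos j hj
    have e1 : (|(j : ℝ)| - |(k : ℝ)|) ^ 2 = (|(k : ℝ)| - |(j : ℝ)|) ^ 2 := by ring
    simp only [hF, e1]
    have h2 : 1 / (|(k : ℝ)| * |(j : ℝ)|) ≤
        1 / 2 * (1 / (k : ℝ) ^ 2) + 1 / 2 * (1 / (j : ℝ) ^ 2) := by
      rw [← sq_abs (k : ℝ), ← sq_abs (j : ℝ)]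
      have h3 := sq_nonneg (1 / |(k : ℝ)| - 1 / |(j : ℝ)|)
      have h4 : 1 / (|(k : ℝ)| * |(j : ℝ)|) = 1 / |(k : ℝ)| * (1 / |(j : ℝ)|) := by
        rw [one_div_mul_one_div]
      rw [h4, ← one_div_pow, ← one_div_pow]
      nlinarith
    have h5 := mul_le_mul_of_nonneg_left h2
      (Real.exp_pos (-b * (|(k : ℝ)| - |(j : ℝ)|) ^ 2)).le
    rw [div_eq_mul_one_div]
    linarith
  have h6 : ∑ k ∈ s, ∑ j ∈ s, F k j ≤ A * ∑' k : ℤ, 1 / (k : ℝ) ^ 2 := by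
    calc ∑ k ∈ s, ∑ j ∈ s, F k j ≤ ∑ k ∈ s, 1 / (k : ℝ) ^ 2 * A := by
          refine Finset.sum_le_sum fun k _ => ?_
          rw [hF, ← Finset.mul_sum]
          exact mul_le_mul_of_nonneg_left (sum_exp_abs_sub_sq_le hb s k) (by positivity)
      _ = A * ∑ k ∈ s, 1 / (k : ℝ) ^ 2 := by rw [← Finset.sum_mul, mul_comm]
      _ ≤ _ := mul_le_mul_of_nonneg_left (hsum.sum_le_tsum s fun k _ => by positivity) hA0
  calc _ ≤ ∑ k ∈ s, ∑ j ∈ s, (1 / 2 * F k j + 1 / 2 * F j k) :=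
        Finset.sum_le_sum fun k hk => Finset.sum_le_sum fun j hj => h1 k hk j hj
    _ = 1 / 2 * ∑ k ∈ s, ∑ j ∈ s, F k j + 1 / 2 * ∑ k ∈ s, ∑ j ∈ s, F j k := by
        simp only [Finset.sum_add_distrib, ← Finset.mul_sum]
    _ = ∑ k ∈ s, ∑ j ∈ s, F k j := by
        rw [Finset.sum_comm (f := fun k j => F j k)]
        ring
    _ ≤ _ := h6

theorem summable_exp_neg_mul_abs {b : ℝ} (hb : 0 < b) :
    Summable fun k : ℤ => Real.exp (-b * |(k : ℝ)|) := by
  have h : Summable fun n : ℕ => Real.exp (-b * (n : ℝ)) := by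
    have hg : Summable fun n : ℕ => Real.exp (-b) ^ n :=
      summable_geometric_of_lt_one (Real.exp_pos _).le (by simpa using hb)
    refine hg.congr fun n => ?_
    rw [← Real.exp_nat_mul, mul_comm]
  exact Summable.of_nat_of_neg (by simpa using h) (by simpa using h)

/-- The exponent of a mixed moment of two modes, in terms of the mean variance `a`, half the
difference `Δ` of the variances, and the gap `G` between mean variance and absolute covariance. -/
theorem moment_exponent_le (k j a Δ C G : ℝ) (hG : G = a - |C|) (hΔ : 2 * Δ ^ 2 ≤ G) :
    (1 - k ^ 2) * (a + Δ) + (1 - j ^ 2) * (a - Δ) + 2 * k * j * C ≤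
      2 * a - (|k| - |j|) ^ 2 * (a - (1 + Δ ^ 2) / 2) - |k| * |j| * G := by
  have h1 : k * j * C ≤ |k| * |j| * |C| := by
    rw [← abs_mul, ← abs_mul]
    exact le_abs_self _
  have hp : 0 ≤ |k| * |j| := by positivity
  have h2 := mul_le_mul_of_nonneg_left hΔ hp
  have hC : |C| = a - G := by linarith
  rw [hC] at h1
  rw [← sq_abs k, ← sq_abs j]
  nlinarith [sq_nonneg ((|k| - |j|) + (|k| + |j|) * Δ)]

/-- The exponent of a mixed moment at two points at distance `r` of order `ε` or less. -/
theorem moment_exponent_le_of_close {β ε b₀ : ℝ} (hε : 0 < ε) {k j a Δ C C₀ G r : ℝ}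
    (hG : G = a - |C|) (hΔ : 2 * Δ ^ 2 ≤ G) (ha : 1 ≤ a - (1 + Δ ^ 2) / 2)
    (ha' : a ≤ -Real.log ε + C₀) (hr : b₀ * (r / ε) ^ 2 ≤ G) :
    β ^ 2 / 2 * ((1 - k ^ 2) * (a + Δ) + (1 - j ^ 2) * (a - Δ) + 2 * k * j * C) ≤
      β ^ 2 * (-Real.log ε + C₀) + -(β ^ 2 / 2 * min 1 b₀) * (|k| - |j|) ^ 2 +
        -(β ^ 2 / 2 * min 1 b₀ * (|k| * |j|) / ε ^ 2) * r ^ 2 := by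
  have hexp := moment_exponent_le k j a Δ C G hG hΔ
  have hpq : 0 ≤ (|k| - |j|) ^ 2 := sq_nonneg _
  have h1 : (|k| - |j|) ^ 2 ≤ (|k| - |j|) ^ 2 * (a - (1 + Δ ^ 2) / 2) :=
    le_mul_of_one_le_right hpq ha
  have h2 : |k| * |j| * (b₀ * (r / ε) ^ 2) ≤ |k| * |j| * G := by gcongr
  have h3 : min 1 b₀ * (|k| - |j|) ^ 2 ≤ (|k| - |j|) ^ 2 :=
    mul_le_of_le_one_left hpq (min_le_left _ _)
  have h4 : min 1 b₀ * (|k| * |j| * (r / ε) ^ 2) ≤ b₀ * (|k| * |j| * (r / ε) ^ 2) :=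
    mul_le_mul_of_nonneg_right (min_le_right _ _) (by positivity)
  have h5 : -(β ^ 2 / 2 * min 1 b₀ * (|k| * |j|) / ε ^ 2) * r ^ 2 =
      -(β ^ 2 / 2 * (min 1 b₀ * (|k| * |j| * (r / ε) ^ 2))) := by
    field_simp
  have h6 : (1 - k ^ 2) * (a + Δ) + (1 - j ^ 2) * (a - Δ) + 2 * k * j * C ≤
      2 * (-Real.log ε + C₀) - min 1 b₀ * (|k| - |j|) ^ 2 -
        min 1 b₀ * (|k| * |j| * (r / ε) ^ 2) := by
    linarith
  have h7 := mul_le_mul_of_nonneg_left h6 (show 0 ≤ β ^ 2 / 2 by positivity)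
  rw [h5]
  linarith

/-- The exponent of a mixed moment at two points for which the gap `G` is at least one. -/
theorem moment_exponent_le_of_far {β k j a Δ C G : ℝ} (hG : G = a - |C|) (hΔ : 2 * Δ ^ 2 ≤ G)
    (ha : 1 ≤ a - (1 + Δ ^ 2) / 2) (hG1 : 1 ≤ G) (hk : 2 ≤ |k|) (hj : 2 ≤ |j|) :
    β ^ 2 / 2 * ((1 - k ^ 2) * (a + Δ) + (1 - j ^ 2) * (a - Δ) + 2 * k * j * C) ≤
      -(β ^ 2 / 8) * |k| + -(β ^ 2 / 8) * |j| + β ^ 2 * (|C| - G / 2) := by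
  have hexp := moment_exponent_le k j a Δ C G hG hΔ
  have h1 : 0 ≤ (|k| - |j|) ^ 2 * (a - (1 + Δ ^ 2) / 2) :=
    mul_nonneg (sq_nonneg _) (by linarith)
  have h2 : (2 + (1 + (|k| + |j|) / 4)) * G ≤ |k| * |j| * G := by
    gcongr
    nlinarith
  have h3 : (|k| + |j|) / 4 * 1 ≤ (|k| + |j|) / 4 * G := by gcongr
  have h4 : (1 - k ^ 2) * (a + Δ) + (1 - j ^ 2) * (a - Δ) + 2 * k * j * C ≤
      2 * |C| - G - (|k| + |j|) / 4 := by
    linarith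
  have h5 := mul_le_mul_of_nonneg_left h4 (show 0 ≤ β ^ 2 / 2 by positivity)
  linarith

section Plane

variable {d : ℕ} {Ω : Type*} [MeasurableSpace Ω] {P : Measure Ω} {U : Opens (Space d)}
  {g : Space d → Space d → ℝ} {X : Ω → (𝓢(Space d, ℝ) →L[ℝ] ℝ)}

/-- Pointwise bound for the mixed moments of modes of order at least two: the first term is
effective when the points are far apart in comparison with `ε`, the second one when they are
close. -/
theorem exists_momentFactor_le [NeZero d] (hX : IsLogCorrelatedField P U g X)
    (hg : ContDiffOn ℝ 2 (Function.uncurry g) ((U : Set (Space d)) ×ˢ (U : Set (Space d))))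
    {K : Set (Space d)} (hK : IsCompact K) (hKU : K ⊆ U) (η : Bump d) {β : ℝ} (hβ : 0 < β) :
    ∃ ε₀ > 0, ∃ b > 0, ∃ A ≥ 0, ∀ ε, 0 < ε → ε ≤ ε₀ → ∀ x ∈ K, ∀ y ∈ K, x ≠ y →
      ∀ k j : ℤ, 2 ≤ |k| → 2 ≤ |j| → momentFactor P X η η β ε ε k j x y ≤
        Real.exp (-(β ^ 2 / 8) * |(k : ℝ)|) * Real.exp (-(β ^ 2 / 8) * |(j : ℝ)|) *
          decayKernel P X η β ε x y +
        A * ε ^ (-(β ^ 2)) * Real.exp (-b * (|(k : ℝ)| - |(j : ℝ)|) ^ 2) *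
          Real.exp (-(b * (|(k : ℝ)| * |(j : ℝ)|) / ε ^ 2) * ‖x - y‖ ^ 2) := by
  obtain ⟨δ, hδ, hδU⟩ := hK.exists_cthickening_subset_open U.isOpen hKU
  obtain ⟨L, hL⟩ := exists_lipschitzOnWith_of_contDiffOn hg (hK.cthickening (r := δ)) hδU
  obtain ⟨ε₂, hε₂, C, hC0, hC⟩ := exists_mollCov_bounds hX hK hKU η η
  obtain ⟨D, hD⟩ := Metric.isBounded_iff.1 hK.isBounded
  have hD' : ∀ x ∈ K, ∀ y ∈ K, ‖x - y‖ ≤ |D| := fun x hx y hy => by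
    rw [← dist_eq_norm]
    exact (hD hx hy).trans (le_abs_self D)
  have hD0 := abs_nonneg D
  have hL0 : (0 : ℝ) ≤ L := L.2
  -- for points further apart than `S ε`, the gap is at least `Q`
  set Q : ℝ := 1 + 2 * (L * |D|) ^ 2 with hQ
  have hQ1 : 1 ≤ Q := by
    have := sq_nonneg (L * |D|)
    linarith
  set S : ℝ := 2 * Real.exp (2 * C + Q) with hS
  have hS1 : 1 ≤ S := by
    have := Real.add_one_le_exp (2 * C + Q)
    linarith
  have hS0 : 0 < S := by linarith
  obtain ⟨ε₃, hε₃, b₀, hb₀, hgap⟩ := exists_le_covGap hX hg hK hKU η hS1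
  set b : ℝ := β ^ 2 / 2 * min 1 b₀ with hb
  have hb0 : 0 < b := by positivity
  -- besides the ranges of validity of the bounds used, `2 Δ² ≤ G` for close points, and a mean
  -- variance that exceeds `Q` plus the absolute covariance of distant points
  set ε₀ : ℝ := min (min (min 1 ε₂) (min δ ε₃)) (min (b₀ / (2 * L ^ 2 + b₀))
    (Real.exp (-(2 * C + Q + |D| + 2)) / 2)) with hε₀
  have hε₀0 : 0 < ε₀ := by positivity
  refine ⟨ε₀, hε₀0, b, hb0, Real.exp (β ^ 2 * C), (Real.exp_pos _).le,
    fun ε hε hεle x hx y hy hne k j hk hj => ?_⟩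
  have c1 : ε ≤ 1 :=
    hεle.trans ((min_le_left _ _).trans ((min_le_left _ _).trans (min_le_left _ _)))
  have c2 : ε ≤ ε₂ :=
    hεle.trans ((min_le_left _ _).trans ((min_le_left _ _).trans (min_le_right _ _)))
  have c3 : ε ≤ δ :=
    hεle.trans ((min_le_left _ _).trans ((min_le_right _ _).trans (min_le_left _ _)))
  have c4 : ε ≤ ε₃ :=
    hεle.trans ((min_le_left _ _).trans ((min_le_right _ _).trans (min_le_right _ _)))
  have c5 : ε ≤ b₀ / (2 * L ^ 2 + b₀) := hεle.trans ((min_le_right _ _).trans (min_le_left _ _))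
  have c6 : ε ≤ Real.exp (-(2 * C + Q + |D| + 2)) / 2 :=
    hεle.trans ((min_le_right _ _).trans (min_le_right _ _))
  rw [le_div_iff₀ (by positivity)] at c5
  have hlog : 2 * C + Q + |D| + 2 ≤ -Real.log (ε + ε) := by
    have h1 : Real.log (ε + ε) ≤ -(2 * C + Q + |D| + 2) := by
      rw [← Real.log_exp (-(2 * C + Q + |D| + 2))]
      exact Real.log_le_log (by positivity) (by linarith)
    linarith
  have hr : 0 < ‖x - y‖ := norm_pos_iff.2 (sub_ne_zero.2 hne)
  have hk2 : (2 : ℝ) ≤ |(k : ℝ)| := by exact_mod_cast hk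
  have hj2 : (2 : ℝ) ≤ |(j : ℝ)| := by exact_mod_cast hj
  have hxx := hC ε ε hε c2 hε c2 x hx x hx
  have hyy := hC ε ε hε c2 hε c2 y hy y hy
  have hxy := hC ε ε hε c2 hε c2 x hx y hy
  rw [sub_self, norm_zero, zero_add] at hxx hyy
  have hG0 := covGap_nonneg hX η ε x y
  set a := meanVar P X η ε x y with ha
  set G := covGap P X η ε x y with hGdef
  set c := mollCov P X η η ε ε x y with hc
  have hGeq : G = a - |c| := rfl
  set Δ := (mollCov P X η η ε ε x x - mollCov P X η η ε ε y y) / 2 with hΔ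
  have hxa : mollCov P X η η ε ε x x = a + Δ := by rw [ha, hΔ, meanVar]; ring
  have hya : mollCov P X η η ε ε y y = a - Δ := by rw [ha, hΔ, meanVar]; ring
  have ha1 : -Real.log (ε + ε) - C ≤ a := by rw [ha, meanVar]; linarith [hxx.2.2, hyy.2.2]
  have ha2 : a ≤ -Real.log ε + C := by rw [ha, meanVar]; linarith [hxx.2.1, hyy.2.1]
  have hΔr : |Δ| ≤ L * ‖x - y‖ := by
    have h1 := mollCov_eq hX hK hδU η η hε c3 hε c3 hx hx
    have h2 := mollCov_eq hX hK hδU η η hε c3 hε c3 hy hy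
    have h3 := abs_smoothPart_sub_smoothPart_le hK hL η hε c3 hx hy hx hy
    rw [max_self] at h3
    rw [sub_self] at h1 h2
    rw [hΔ, h1, h2, add_sub_add_left_eq_sub, abs_div, abs_of_pos (two_pos : (0 : ℝ) < 2)]
    have : 0 ≤ L * ‖x - y‖ := by positivity
    linarith
  have hΔsq : Δ ^ 2 ≤ (L * ‖x - y‖) ^ 2 := by
    rw [← sq_abs Δ]
    gcongr
  have hΔD : Δ ^ 2 ≤ (L * |D|) ^ 2 := by
    refine hΔsq.trans ?_
    gcongr
    exact hD' x hx y hy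
  have hA1 : 1 ≤ a - (1 + Δ ^ 2) / 2 := by linarith [sq_nonneg (L * |D|)]
  rw [momentFactor, hxa, hya]
  rcases le_or_gt ‖x - y‖ (S * ε) with hrS | hrS
  · have hG1 := hgap ε hε c4 x hx y hy hrS
    have hG2 : 2 * Δ ^ 2 ≤ G := by
      refine le_trans ?_ hG1
      have h1 : 2 * (L * ‖x - y‖) ^ 2 ≤ b₀ * (‖x - y‖ / ε) ^ 2 := by
        rw [div_pow, mul_div_assoc', le_div_iff₀ (by positivity)]
        have h2 : 2 * (L : ℝ) ^ 2 * ε ^ 2 ≤ b₀ := by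
          have h3 : ε ^ 2 ≤ ε := by
            rw [pow_two]
            exact mul_le_of_le_one_left hε.le c1
          have h4 := mul_le_mul_of_nonneg_left h3 (show 0 ≤ 2 * (L : ℝ) ^ 2 by positivity)
          have h5 : 0 ≤ ε * b₀ := by positivity
          rw [mul_add] at c5
          linarith
        calc 2 * (L * ‖x - y‖) ^ 2 * ε ^ 2 = 2 * (L : ℝ) ^ 2 * ε ^ 2 * ‖x - y‖ ^ 2 := by ring
          _ ≤ b₀ * ‖x - y‖ ^ 2 := by gcongr
      exact (mul_le_mul_of_nonneg_left hΔsq zero_le_two).trans h1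
    refine le_add_of_nonneg_of_le ?_ ?_
    · exact mul_nonneg (by positivity) (Real.exp_pos _).le
    · have e1 : Real.exp (β ^ 2 * C) * ε ^ (-(β ^ 2)) =
          Real.exp (β ^ 2 * (-Real.log ε + C)) := (exp_mul_neg_log_add hε _ _).symm
      rw [e1, ← Real.exp_add, ← Real.exp_add, Real.exp_le_exp]
      exact moment_exponent_le_of_close hε hGeq hG2 hA1 ha2 hG1
  · have hGQ : Q ≤ G := by
      have h1 : c ≤ a - Q := by
        have h2 := hxy.1 hne
        have h3 : Real.log (S * ε) ≤ Real.log ‖x - y‖ := Real.log_le_log (by positivity) hrS.le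
        have h4 : S * ε = Real.exp (2 * C + Q) * (ε + ε) := by rw [hS]; ring
        rw [h4, Real.log_mul (Real.exp_pos _).ne' (by positivity), Real.log_exp] at h3
        linarith
      have h5 : -c ≤ a - Q := by
        have h6 := hxy.2.2
        have h7 := Real.log_le_self (show 0 ≤ ‖x - y‖ + ε + ε by positivity)
        have h8 := hD' x hx y hy
        linarith
      have h9 : |c| ≤ a - Q := abs_le.2 ⟨by linarith, h1⟩
      linarith
    have hG2 : 2 * Δ ^ 2 ≤ G := by linarith
    have hG1 : 1 ≤ G := hQ1.trans hGQ
    refine le_add_of_le_of_nonneg ?_ (by positivity)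
    rw [decayKernel, ← Real.exp_add, ← Real.exp_add, Real.exp_le_exp]
    exact moment_exponent_le_of_far hGeq hG2 hA1 hG1 hk2 hj2

end Plane

theorem integral_exp_neg_mul_norm_sub_sq_le {U : Set (Space 2)} (hU : volume U ≠ ⊤) {b : ℝ}
    (hb : 0 < b) :
    Integrable (fun w : Space 2 × Space 2 => Real.exp (-b * ‖w.1 - w.2‖ ^ 2))
      ((volume.restrict U).prod (volume.restrict U)) ∧
    ∫ w : Space 2 × Space 2, Real.exp (-b * ‖w.1 - w.2‖ ^ 2)
      ∂((volume.restrict U).prod (volume.restrict U)) ≤ volume.real U * (Real.pi / b) := by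
  have : IsFiniteMeasure (volume.restrict U) := ⟨by simpa using hU.lt_top⟩
  have hi : Integrable (fun w : Space 2 × Space 2 => Real.exp (-b * ‖w.1 - w.2‖ ^ 2))
      ((volume.restrict U).prod (volume.restrict U)) := by
    refine Integrable.of_bound (C := 1) (by fun_prop) (ae_of_all _ fun w => ?_)
    rw [Real.norm_eq_abs, Real.abs_exp, Real.exp_le_one_iff]
    have : 0 ≤ b * ‖w.1 - w.2‖ ^ 2 := by positivity
    linarith
  refine ⟨hi, ?_⟩
  rw [integral_prod _ hi]
  have hgauss : ∫ v : Space 2, Real.exp (-b * ‖v‖ ^ 2) = Real.pi / b := by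
    rw [GaussianFourier.integral_rexp_neg_mul_sq_norm hb]
    simp
  have hgi : Integrable fun v : Space 2 => Real.exp (-b * ‖v‖ ^ 2) := by
    by_contra h
    rw [integral_undef h] at hgauss
    have : 0 < Real.pi / b := by positivity
    linarith
  have hone : ∀ x : Space 2, ∫ y in U, Real.exp (-b * ‖x - y‖ ^ 2) ≤ Real.pi / b := by
    intro x
    rw [← hgauss, ← integral_sub_left_eq_self (fun v : Space 2 => Real.exp (-b * ‖v‖ ^ 2)) volume x]
    exact setIntegral_le_integral (hgi.comp_sub_left x) (ae_of_all _ fun y => (Real.exp_pos _).le)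
  refine (integral_mono hi.integral_prod_left (integrable_const _) hone).trans (le_of_eq ?_)
  rw [integral_const, smul_eq_mul, measureReal_restrict_apply_univ]

section Plane

variable {Ω : Type*} [MeasurableSpace Ω] {P : Measure Ω} {U : Opens (Space 2)}
  {g : Space 2 → Space 2 → ℝ} {X : Ω → (𝓢(Space 2, ℝ) →L[ℝ] ℝ)}

/-- In the plane, the combinations of modes of order at least two with bounded coefficients vanish
in the limit: the Gaussian integral over the relative position of two points has a factor
`ε² / |k j|`, which makes the double sum converge and beats the growth `ε^{-β²}`. -/
theorem exists_decay_of_bounded (hX : IsLogCorrelatedField P U g X)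
    (hg : ContDiffOn ℝ 2 (Function.uncurry g) ((U : Set (Space 2)) ×ˢ (U : Set (Space 2))))
    {β : ℝ} (hβ : 0 < β) (hβd : β ^ 2 < (2 : ℕ)) (φ : 𝓓(U, ℂ)) (η : Bump 2) {c : ℕ → ℝ}
    (hc : ∀ n, 0 < c n) (hct : Tendsto c atTop (𝓝 0)) (M : ℝ) :
    ∃ κ : ℕ → ENNReal, Tendsto κ atTop (𝓝 0) ∧ ∀ᶠ n in atTop, ∀ (s : Finset ℤ) (t : ℤ → ℂ),
      ((∀ k ∈ s, 2 ≤ |k|) ∧ ∀ k ∈ s, ‖t k‖ ≤ M) →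
      eLpNorm (fun ω => ∑ k ∈ s, t k * waveIntegral P U X η β (c n) φ k ω) 1 P ≤ κ n := by
  have : IsProbabilityMeasure P := hX.gaussian.isProbabilityMeasure
  obtain ⟨hint, hlim⟩ := tendsto_integral_decayKernel hX hβ hβd φ η hc hct
  obtain ⟨ε₁, hε₁, hw⟩ := exists_waveWeight_bound hX η β φ
  obtain ⟨ε₀, hε₀, b, hb, A, hA, hmf⟩ := exists_momentFactor_le hX hg
    φ.hasCompactSupport.isCompact φ.tsupport_subset η hβ
  obtain ⟨N, hN⟩ := φ.hasCompactSupport.exists_bound_of_continuous φ.continuous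
  have hN0 : 0 ≤ N := (norm_nonneg _).trans (hN 0)
  obtain ⟨Θ, hΘ⟩ := exists_sum_exp_div_le hb
  have hE := summable_exp_neg_mul_abs (show 0 < β ^ 2 / 8 by positivity)
  set E : ℤ → ℝ := fun k => Real.exp (-(β ^ 2 / 8) * |(k : ℝ)|) with hEdef
  set μ := (volume.restrict (U : Set (Space 2))).prod (volume.restrict (U : Set (Space 2))) with hμ
  set v : ℝ := volume.real (U : Set (Space 2)) with hv
  have hv0 : 0 ≤ v := measureReal_nonneg
  have hUfin : volume (U : Set (Space 2)) ≠ ⊤ := hX.kernel.bounded.measure_lt_top.ne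
  set B : ℕ → ℝ := fun n => ∫ w : Space 2 × Space 2,
      ‖φ w.1‖ * ‖φ w.2‖ * decayKernel P X η β (c n) w.1 w.2 ∂μ with hB
  have hB0 : ∀ n, 0 ≤ B n := fun n => integral_nonneg fun w =>
        mul_nonneg (mul_nonneg (norm_nonneg _) (norm_nonneg _)) (Real.exp_pos _).le
  set q : ℕ → ℝ := fun n => N * N * A * c n ^ (-(β ^ 2)) * (v * Real.pi / b * c n ^ 2) with hq
  have hq0 : ∀ n, 0 ≤ q n := fun n => by
    have := hc n
    positivity
  have hqt : Tendsto q atTop (𝓝 0) := by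
    have h1 : Tendsto (fun n => c n ^ (2 - β ^ 2)) atTop (𝓝 0) := by
      have h2 : 0 < 2 - β ^ 2 := by
        have : β ^ 2 < 2 := by exact_mod_cast hβd
        linarith
      simpa [Real.zero_rpow h2.ne'] using hct.rpow_const (p := 2 - β ^ 2) (Or.inr h2.le)
    have h3 := h1.const_mul (N * N * A * (v * Real.pi / b))
    rw [mul_zero] at h3
    refine h3.congr fun n => ?_
    rw [sub_eq_add_neg, Real.rpow_add (hc n), Real.rpow_two, hq]
    ring
  set κ : ℕ → ℝ := fun n => M * M * ((∑' k, E k) * (∑' k, E k) * B n + q n * Θ) with hκ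
  have hκt : Tendsto κ atTop (𝓝 0) := by
    have h1 := ((hlim.const_mul ((∑' k, E k) * (∑' k, E k))).add
      (hqt.mul_const Θ)).const_mul (M * M)
    simpa using h1
  refine ⟨fun n => ENNReal.ofReal (Real.sqrt (κ n)), ?_, ?_⟩
  · have h1 := ENNReal.tendsto_ofReal ((Real.continuous_sqrt.tendsto _).comp hκt)
    simpa using h1
  filter_upwards [hint, hct.eventually_lt_const hε₀, hct.eventually_lt_const hε₁]
    with n hn hcn hcn1 s t ⟨hs, ht⟩
  have hcn0 := hc n
  obtain ⟨W, hW⟩ := hw _ hcn0 hcn1.le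
  have hm := fun k => memLp_waveIntegral hX η β (c n) φ.continuous.measurable hW k
  have hmem : MemLp (fun ω => ∑ k ∈ s, t k * waveIntegral P U X η β (c n) φ k ω) 2 P :=
    memLp_finsetSum s fun k _ => (hm k).const_mul (t k)
  refine (eLpNorm_one_le_sqrt hmem).trans
    (ENNReal.ofReal_le_ofReal (Real.sqrt_le_sqrt ?_))
  refine (integral_norm_sq_sum_le hX η β φ.continuous.measurable hW s t).trans ?_
  have hpair : ∀ k ∈ s, ∀ j ∈ s, ∫ w : Space 2 × Space 2,
      ‖φ w.1‖ * ‖φ w.2‖ * momentFactor P X η η β (c n) (c n) k j w.1 w.2 ∂μ ≤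
      E k * E j * B n + q n * (Real.exp (-b * (|(k : ℝ)| - |(j : ℝ)|) ^ 2) /
        (|(k : ℝ)| * |(j : ℝ)|)) := by
    intro k hk j hj
    have hk2 : (2 : ℝ) ≤ |(k : ℝ)| := by exact_mod_cast hs k hk
    have hj2 : (2 : ℝ) ≤ |(j : ℝ)| := by exact_mod_cast hs j hj
    have hb' : 0 < b * (|(k : ℝ)| * |(j : ℝ)|) / c n ^ 2 := by positivity
    obtain ⟨hgi, hgle⟩ := integral_exp_neg_mul_norm_sub_sq_le hUfin hb'
    set F := N * N * (A * c n ^ (-(β ^ 2)) * Real.exp (-b * (|(k : ℝ)| - |(j : ℝ)|) ^ 2)) with hF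
    have hF0 : 0 ≤ F := by positivity
    have hi2 := (hn.const_mul (E k * E j)).add (hgi.const_mul F)
    refine (integral_mono_of_nonneg (ae_of_all _ fun w => ?_) hi2 ?_).trans ?_
    · exact mul_nonneg (mul_nonneg (norm_nonneg _) (norm_nonneg _)) (Real.exp_pos _).le
    · filter_upwards [ae_fst_ne_snd (U : Set (Space 2))] with w hne
      simp only [Pi.add_apply]
      have hD0 : 0 ≤ decayKernel P X η β (c n) w.1 w.2 := (Real.exp_pos _).le
      by_cases hx : w.1 ∈ tsupport φ
      · by_cases hy : w.2 ∈ tsupport φ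
        · have h1 := hmf (c n) hcn0 hcn.le w.1 hx w.2 hy hne k j (hs k hk) (hs j hj)
          have h2 : ‖φ w.1‖ * ‖φ w.2‖ ≤ N * N := by
            gcongr
            · exact hN _
            · exact hN _
          have h3 := mul_le_mul_of_nonneg_left h1 (mul_nonneg (norm_nonneg (φ w.1))
            (norm_nonneg (φ w.2)))
          refine h3.trans ?_
          rw [mul_add]
          refine add_le_add (le_of_eq ?_) ?_
          · simp only [hEdef]
            ring
          · rw [← mul_assoc]
            refine mul_le_mul_of_nonneg_right ?_ (Real.exp_pos _).le
            rw [hF]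
            exact mul_le_mul_of_nonneg_right h2 (by positivity)
        · rw [image_eq_zero_of_notMem_tsupport hy]
          simp only [norm_zero, mul_zero, zero_mul, zero_add]
          positivity
      · rw [image_eq_zero_of_notMem_tsupport hx]
        simp only [norm_zero, mul_zero, zero_mul, zero_add]
        positivity
    · have e1 := integral_add (hn.const_mul (E k * E j)) (hgi.const_mul F)
      rw [integral_const_mul, integral_const_mul] at e1
      refine (le_of_eq e1).trans (add_le_add le_rfl ?_)
      refine (mul_le_mul_of_nonneg_left hgle hF0).trans (le_of_eq ?_)
      rw [hF, hq, ← hv]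
      field_simp
  have hM0 : ∀ k ∈ s, 0 ≤ M := fun k hk => (norm_nonneg _).trans (ht k hk)
  have hsumE : ∑ k ∈ s, E k ≤ ∑' k, E k := hE.sum_le_tsum s fun k _ => (Real.exp_pos _).le
  have hE0 : 0 ≤ ∑ k ∈ s, E k := Finset.sum_nonneg fun k _ => (Real.exp_pos _).le
  calc _ ≤ ∑ k ∈ s, ∑ j ∈ s, M * M * (E k * E j * B n + q n *
        (Real.exp (-b * (|(k : ℝ)| - |(j : ℝ)|) ^ 2) / (|(k : ℝ)| * |(j : ℝ)|))) := by
        refine Finset.sum_le_sum fun k hk => Finset.sum_le_sum fun j hj => ?_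
        have h0 : 0 ≤ M := hM0 k hk
        refine mul_le_mul (mul_le_mul (ht k hk) (ht j hj) (norm_nonneg _) h0) (hpair k hk j hj)
          (integral_nonneg fun w => ?_) (mul_nonneg h0 h0)
        exact mul_nonneg (mul_nonneg (norm_nonneg _) (norm_nonneg _)) (Real.exp_pos _).le
    _ = M * M * ((∑ k ∈ s, E k) * (∑ k ∈ s, E k) * B n + q n * ∑ k ∈ s, ∑ j ∈ s,
        (Real.exp (-b * (|(k : ℝ)| - |(j : ℝ)|) ^ 2) / (|(k : ℝ)| * |(j : ℝ)|))) := by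
        simp only [← Finset.mul_sum, Finset.sum_add_distrib]
        rw [Finset.sum_mul_sum, Finset.sum_mul]
        simp only [Finset.sum_mul]
    _ ≤ κ n := by
        refine mul_le_mul_of_nonneg_left (add_le_add ?_ ?_) (mul_self_nonneg M)
        · refine mul_le_mul_of_nonneg_right ?_ (hB0 n)
          exact mul_le_mul hsumE hsumE hE0 (hE0.trans hsumE)
        · exact mul_le_mul_of_nonneg_left (hΘ s hs) (hq0 n)

end Plane

end LogField

end

theorem mainTheorem7 {d : ℕ} {Ω : Type*} [MeasurableSpace Ω] (P : Measure Ω)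
    [IsProbabilityMeasure P] (U : Opens (LogField.Space d))
    (g : LogField.Space d → LogField.Space d → ℝ)
    (X : Ω → (𝓢(LogField.Space d, ℝ) →L[ℝ] ℝ))
    (hX : LogField.IsLogCorrelatedField P U g X)
    (β : ℝ) (hβ : 0 < β) (hβd : β < Real.sqrt d) :
    ∃ cosX : 𝓓(U, ℂ) → Ω → ℂ, LogField.IsCosine P U X β cosX ∧
      ∀ (η : LogField.Bump d) (c : ℕ → ℝ), (∀ n, 0 < c n) → Tendsto c atTop (𝓝 0) →
      ∀ H : ℝ → ℝ, LogField.IsEvenMeanZeroPeriodic (2 * Real.pi / β) H →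
        (LogField.HasAbsConvFourierSeries (div_pos Real.two_pi_pos hβ) H →
          LogField.ConvergesToMultiple P U X η c β H cosX) ∧
        (d = 2 →
          ContDiffOn ℝ 2 (Function.uncurry g)
            ((U : Set (LogField.Space d)) ×ˢ (U : Set (LogField.Space d))) →
          (∀ x ∈ U, ∀ y ∈ U, g x x = g y y) →
          η.RadiallyDecreasing →
          LogField.ConvergesToMultiple P U X η c β H cosX) := by
  have hβ2 : β ^ 2 < d := by
    rwa [Real.lt_sqrt hβ.le] at hβd
  have : NeZero d := by
    refine ⟨fun h => ?_⟩
    subst h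
    rw [Nat.cast_zero] at hβ2
    exact absurd hβ2 (not_lt.2 (sq_nonneg β))
  obtain ⟨cosX, hcos⟩ := LogField.exists_isCosine hX hβ2
  refine ⟨cosX, hcos, fun η c hc hct H hH => ?_⟩
  obtain ⟨a, ⟨M, hM⟩, hsum⟩ := LogField.exists_trigSum_approx_even hβ hH
  refine ⟨fun hF => ?_, fun hd hg _ _ => ?_⟩
  · obtain ⟨M', hM'⟩ := hsum hF
    exact LogField.convergesToMultiple_of_trigSum_approx hX hβ hc hct hH hcos hM' fun φ =>
      LogField.exists_decay_of_summable hX hβ hβ2 φ η hc hct M'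
  · subst hd
    exact LogField.convergesToMultiple_of_trigSum_approx hX hβ hc hct hH hcos hM fun φ =>
      LogField.exists_decay_of_bounded hX hg hβ hβ2 φ η hc hct M
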